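/- **Setting.** Let $\Sigma=\{\rho\le 0\}\subset\mathbb R^n$ be compact, with $\rho$ smooth and $\nabla\rho\neq0$ on $\partial\Sigma=\{\rho=0\}$. A *local function* is a smooth function of $(t,x)$, of finitely many spatial derivatives of the canonical fields $z^A(t,x)$ and of finitely many space and time derivatives of the multipliers $\lambda^a(t,x)$ (no time derivatives of $z$). A *functional* is $F=\int_\Sigma d^nx\,f+\oint_{\partial\Sigma}(d^{n-1}x)_i\,b^i$ with local $f,b^i$; $\frac{\delta F}{\delta z^A}$ and $\frac{\delta F}{\delta\lambda^{(l)a}}$ are the Euler–Lagrange derivatives of $f$, the time derivatives $\lambda^{(l)}$ being treated as independent. Let $\sigma^{AB}$ be a constant, antisymmetric, invertible matrix with inverse $\sigma_{AB}$, and consider $$S=\int dt\Big\{\int_\Sigma d^nx\,\tfrac12 z^A\sigma_{AB}\dot z^B-H\Big\},\qquad H=\int_\Sigma d^nx\,(h(z)+\lambda^a\phi_a(z))+\oint_{\partial\Sigma}(d^{n-1}x)_i\,b_H^i(z,\lambda),$$ with first-class constraints $\phi_a$ and first-class $h$, and internal boundary conditions $\chi_I^\alpha(z,\lambda)|_{\partial\Sigma}=\zeta^\alpha$,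 where $h,\phi_a,b_H^i,\chi_I^\alpha$ are local and contain no time derivatives of the fields. A smooth history $(z,\lambda)$ is *admissible* if it satisfies the external boundary conditions $\chi_E|_{\partial\Sigma}=0$: all spatial derivatives of $\phi_a$ and of $\dot z^A-\sigma^{AB}\frac{\delta H}{\delta z^B}$ vanish on $\partial\Sigma$ at all times. A variation $\delta$ at an admissible history *preserves the internal boundary conditions* if $\delta\chi_E|_{\partial\Sigma}=0$ and $\delta\chi_I^\alpha|_{\partial\Sigma}=0$. It is assumed that $\delta H=\int_\Sigma d^nx\,(\frac{\delta H}{\delta z^A}\delta z^A+\phi_a\delta\lambda^a)$ for all these variations. Let $\delta_Gz^A=Z^A$, $\delta_G\lambda^a=\Lambda^a$ be a transformation with local $Z^A,\Lambda^a$, let $\delta^\lambda_G$ be its part acting on $\lambda$ only, and let $G$ be a functional, such that for all admissible histories and all $\delta$ preserving the internal boundary conditions $$[\delta_G,\delta]\chi_I^\alpha|_{\partial\Sigma}=0,\qquad \delta G=\int_\Sigma d^nx\Big(\frac{\delta G}{\delta z^A}\delta z^A+\sum_l\frac{\delta G}{\delta\lambda^{(l)a}}\delta\lambda^{(l)a}\Big);$$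 the first condition means that $\delta(\delta_G\chi_I^\alpha)|_{\partial\Sigma}=0$, i.e. that the sources $\zeta^\alpha$ transform into functions of the sources only. The transformation is an *external symmetry* if $\delta_G\chi_E|_{\partial\Sigma}=0$, $[\delta_G,\delta]\chi_I^\alpha|_{\partial\Sigma}=0$, and there are a functional $U$ and local $V^i_G$ with $$\delta_GS=\int dt\Big\{\frac{d}{dt}U+\oint_{\partial\Sigma}(d^{n-1}x)_iV_G^i\Big\}\ \text{ on every time interval},\qquad \delta\oint_{\partial\Sigma}(d^{n-1}x)_iV_G^i=0,$$ for all admissible histories and all $\delta$ preserving the internal boundary conditions. The couple $(G,\delta^\lambda_G)$ *generates* this external symmetry if moreover $U$ can be chosen so that $G=\int_\Sigma d^nx\,\frac12\sigma_{AB}z^AZ^B-U$ on admissible histories. For functionals $F,K$ put $\delta_Fz^A=\sigma^{AB}\frac{\delta F}{\delta z^B}$, $\{F,K\}=\int_\Sigma d^nx\,\frac{\delta F}{\delta z^A}\sigma^{AB}\frac{\delta K}{\delta z^B}$ and $$\{F,K\}_\zeta=\{F,K\}+\oint\Theta_F[\delta_Kz]-\oint\Theta_K[\delta_Fz],$$ where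 $\oint\Theta_F[\delta z]$ is the boundary part $\delta F-\int_\Sigma\frac{\delta F}{\delta z^A}\delta z^A$ of the variation of $F$ under a variation of $z$ alone; $\frac{D}{Dt}=\frac{\partial}{\partial t}+\sum_l\partial_{(i)}\lambda^{(l+1)a}\frac{\partial}{\partial\lambda^{(l)a}_{(i)}}$. **Theorem.** (i) $(G,\delta^\lambda_G)$ generates the external symmetry $\delta_G$ of the action if and only if, on all admissible histories, $Z^A=\sigma^{AB}\frac{\delta G}{\delta z^B}$ on $\Sigma$ and there exists a boundary term with local $V_G^i$ such that $$\frac{D}{Dt}G+\{G,H\}_\zeta-\delta^\lambda_GH=\oint_{\partial\Sigma}(d^{n-1}x)_iV_G^i,\qquad \delta\oint_{\partial\Sigma}(d^{n-1}x)_iV_G^i=0$$ for all variations $\delta$ preserving the internal boundary conditions. (ii) The transformation $(Z^A,\Lambda^a)$ is an external symmetry (with no condition on $U$) if and only if there is some functional $G'$ for which the conditions on the right-hand side of (i) hold with $G'$ in place of $G$. -/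

import Mathlib

open scoped ContDiff MeasureTheory

noncomputable section

namespace GaugeField

/-! ## Space, time, and the region -/

/-- Space, with its coordinates `x^i`. -/
abbrev Space (n : ℕ) := EuclideanSpace ℝ (Fin n)

/-- Pairs `(t, x)`. -/
abbrev ST (n : ℕ) := ℝ × Space n

/-- A compact region `Σ = {ρ ≤ 0}` of space with smooth boundary `∂Σ = {ρ = 0}`. -/
structure Region (n : ℕ) where
  ρ : Space n → ℝ
  smooth : ContDiff ℝ ∞ ρ
  compact : IsCompact {x | ρ x ≤ 0}
  regular : ∀ x, ρ x = 0 → gradient ρ x ≠ 0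

namespace Region

variable {n : ℕ} (S : Region n)

def body : Set (Space n) := {x | S.ρ x ≤ 0}

def bdry : Set (Space n) := {x | S.ρ x = 0}

/-- The outward unit normal (on the boundary). -/
def normal (x : Space n) : Space n := (‖gradient S.ρ x‖)⁻¹ • gradient S.ρ x

/-- `∫_Σ d^n x f(t, x)`. -/
def bulkInt (f : ST n → ℝ) (t : ℝ) : ℝ := ∫ x in S.body, f (t, x)

/-- `∮_{∂Σ} (d^{n-1} x)_i b^i(t, x)`, the flux of `b` through `∂Σ`. -/
def bdryInt (b : Fin n → ST n → ℝ) (t : ℝ) : ℝ :=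
  ∫ x in S.bdry, (∑ i, b i (t, x) * S.normal x i) ∂μHE[n - 1]

end Region

/-! ## Derivatives of functions of `(t, x)` -/

/-- `∂f/∂t`. -/
def dt {n : ℕ} (f : ST n → ℝ) : ST n → ℝ := fun p => fderiv ℝ f p (1, 0)

/-- `∂f/∂x^i`. -/
def dx {n : ℕ} (i : Fin n) (f : ST n → ℝ) : ST n → ℝ :=
  fun p => fderiv ℝ f p (0, EuclideanSpace.single i 1)

/-- `∂_(α) f` for a spatial multi-index `α`. -/
def dMulti {n : ℕ} (α : Fin n → ℕ) (f : ST n → ℝ) : ST n → ℝ :=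
  (List.finRange n).foldr (fun i g => (dx i)^[α i] g) f

/-- Multi-indices all of whose entries are at most `r`. -/
abbrev MI (n r : ℕ) := Fin n → Fin (r + 1)

def MI.toNat {n r : ℕ} (α : MI n r) : Fin n → ℕ := fun i => (α i : ℕ)

/-! ## Local functions -/

/-- A smooth function of `(t, x)` and of finitely many spatial derivatives `∂_(α) u_j` of
functions `u_j` labelled by `j : J`. -/
structure JetFn (n : ℕ) (J : Type) [Fintype J] (r : ℕ) where
  toFun : ST n × (J × MI n r → ℝ) → ℝ
  smooth : ContDiff ℝ ∞ toFun

namespace JetFn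

variable {n r : ℕ} {J K : Type} [Fintype J] [Fintype K]

/-- The spatial jet of `u` at the point `p`. -/
def jet (r : ℕ) (u : J → ST n → ℝ) (p : ST n) : J × MI n r → ℝ :=
  fun q => dMulti q.2.toNat (u q.1) p

/-- `f` evaluated on the functions `u`. -/
def eval (f : JetFn n J r) (u : J → ST n → ℝ) : ST n → ℝ :=
  fun p => f.toFun (p, jet r u p)

/-- `∂f/∂u_{j,(α)}`, evaluated on `u`. -/
def jetDeriv (f : JetFn n J r) (u : J → ST n → ℝ) (j : J) (α : MI n r) : ST n → ℝ :=
  fun p => by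
    classical
    exact fderiv ℝ f.toFun (p, jet r u p) (0, Pi.single (j, α) 1)

/-- The Euler-Lagrange derivative
`δf/δu_j = ∑_α (-1)^|α| ∂_(α) (∂f/∂u_{j,(α)})`, evaluated on `u`. -/
def euler (f : JetFn n J r) (u : J → ST n → ℝ) (j : J) : ST n → ℝ :=
  fun p => ∑ α : MI n r, (-1 : ℝ) ^ (∑ i, α.toNat i) * dMulti α.toNat (f.jetDeriv u j α) p

/-- Regard a local function of `u_j`, `j : J`, as a local function of `v_k`, `k : K`, by the
substitution `u_j = v_{e j}`. -/
def relabel (f : JetFn n J r) (e : J → K) : JetFn n K r where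
  toFun q := f.toFun (q.1, fun a => q.2 (e a.1, a.2))
  smooth := by
    refine f.smooth.comp (contDiff_fst.prodMk (contDiff_pi.2 fun a => ?_))
    exact (contDiff_apply ℝ ℝ (e a.1, a.2)).comp contDiff_snd

/-- The product `ε f` with a function `ε` of `(t, x)`. -/
def smear (ε : ST n → ℝ) (hε : ContDiff ℝ ∞ ε) (f : JetFn n J r) : JetFn n J r where
  toFun q := ε q.1 * f.toFun q
  smooth := (hε.comp contDiff_fst).mul f.smooth

end JetFn

/-! ## Histories -/

/-- Histories of the canonical fields `z^A` (labels `Sum.inl A`) and of the Lagrange multipliers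
`λ^a` (labels `Sum.inr a`); also their variations `(δz, δλ)`. -/
abbrev Hist (n N m : ℕ) := Fin N ⊕ Fin m → ST n → ℝ

variable {n N m c : ℕ}

def Smooth (φ : Hist n N m) : Prop := ∀ j, ContDiff ℝ ∞ (φ j)

/-- The functions `z^A` and `λ^a, λ̇^a, …, (d/dt)^k λ^a`. -/
def columns (k : ℕ) (φ : Hist n N m) : Fin N ⊕ Fin m × Fin (k + 1) → ST n → ℝ :=
  Sum.elim (fun A => φ (Sum.inl A)) (fun q => dt^[(q.2 : ℕ)] (φ (Sum.inr q.1)))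

/-- A local function `f(t, x, z, λ, λ̇, …, (d/dt)^k λ)`, depending also on finitely many spatial
derivatives of these fields, but on no time derivative of `z`. -/
structure LocalFn (n N m : ℕ) where
  timeOrder : ℕ
  order : ℕ
  fn : JetFn n (Fin N ⊕ Fin m × Fin (timeOrder + 1)) order

namespace LocalFn

def eval (f : LocalFn n N m) (φ : Hist n N m) : ST n → ℝ := f.fn.eval (columns f.timeOrder φ)

/-- `D f/Dt = ∂f/∂t + ∑_l ∂_(i) λ^(l+1) ∂f/∂λ^(l)_(i)`, at fixed `z`. -/
def bigD (f : LocalFn n N m) (φ : Hist n N m) : ST n → ℝ := fun p =>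
  fderiv ℝ f.fn.toFun (p, JetFn.jet f.order (columns f.timeOrder φ) p)
    ((1, 0), JetFn.jet f.order
      (columns f.timeOrder (Sum.elim 0 (fun a => dt (φ (Sum.inr a))) : Hist n N m)) p)

end LocalFn

/-- The variation, along `ψ`, of a quantity `Φ` built from the fields. -/
def vary (Φ : Hist n N m → ST n → ℝ) (φ ψ : Hist n N m) : ST n → ℝ :=
  fun p => deriv (fun s : ℝ => Φ (φ + s • ψ) p) 0

/-- A local functional `F = ∫_Σ d^n x f + ∮_{∂Σ} (d^{n-1} x)_i b^i`. -/
structure Functional (n N m : ℕ) where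
  bulk : LocalFn n N m
  bdry : Fin n → LocalFn n N m

namespace Functional

variable (S : Region n) (F G : Functional n N m)

/-- The value at time `t`. -/
def val (φ : Hist n N m) (t : ℝ) : ℝ :=
  S.bulkInt (F.bulk.eval φ) t + S.bdryInt (fun i => (F.bdry i).eval φ) t

/-- The variation `δF`, boundary contributions included. -/
def var (φ ψ : Hist n N m) (t : ℝ) : ℝ := deriv (fun s : ℝ => F.val S (φ + s • ψ) t) 0

/-- `D F/Dt`. -/
def bigD (φ : Hist n N m) (t : ℝ) : ℝ :=
  S.bulkInt (F.bulk.bigD φ) t + S.bdryInt (fun i => (F.bdry i).bigD φ) t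

/-- `δF/δz^A`. -/
def eulerZ (φ : Hist n N m) (A : Fin N) : ST n → ℝ :=
  F.bulk.fn.euler (columns F.bulk.timeOrder φ) (Sum.inl A)

/-- The bulk part of `δF`, namely
`∫_Σ (δF/δz^A δz^A + ∑_l δF/δλ^(l)a δλ^(l)a)`. -/
def bulkVar (φ ψ : Hist n N m) (t : ℝ) : ℝ :=
  S.bulkInt (fun p => ∑ j, F.bulk.fn.euler (columns F.bulk.timeOrder φ) j p *
    columns F.bulk.timeOrder ψ j p) t

/-- The boundary part `∮ Θ_F[δ]` of `δF`. -/
def bdryVar (φ ψ : Hist n N m) (t : ℝ) : ℝ := F.var S φ ψ t - F.bulkVar S φ ψ t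

/-- The transformation of the canonical fields generated by `F`:
`δ_F z^A = σ^{AB} δF/δz^B`, the multipliers being fixed. -/
def hamZ (σ : Matrix (Fin N) (Fin N) ℝ) (φ : Hist n N m) : Hist n N m :=
  Sum.elim (fun A p => ∑ B, σ A B * F.eulerZ φ B p) 0

/-- `{F, G} = ∫_Σ δF/δz^A σ^{AB} δG/δz^B`. -/
def bracket (σ : Matrix (Fin N) (Fin N) ℝ) (φ : Hist n N m) (t : ℝ) : ℝ :=
  S.bulkInt (fun p => ∑ A, ∑ B, F.eulerZ φ A p * σ A B * G.eulerZ φ B p) t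

/-- The modified bracket (involving only `z`)
`{F, G}_ζ = {F, G} + ∮ Θ_F[δ_G z] - ∮ Θ_G[δ_F z]`. -/
def modBracket (σ : Matrix (Fin N) (Fin N) ℝ) (φ : Hist n N m) (t : ℝ) : ℝ :=
  F.bracket S G σ φ t + F.bdryVar S φ (G.hamZ σ φ) t - G.bdryVar S φ (F.hamZ σ φ) t

end Functional

/-! ## Gauge field theories -/

/-- The data of a gauge field theory: the constant Poisson structure `σ^{AB}`, the densities `h(z)`
and `φ_a(z)`, the boundary part `b^i(z, λ)` of the Hamiltonian, and the operators `χ_I^α(z, λ)`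
of the internal boundary conditions `χ_I^α|_{∂Σ} = ζ^α`. -/
structure Theory (n N m c : ℕ) where
  σ : Matrix (Fin N) (Fin N) ℝ
  antisymm : σ.transpose = -σ
  invertible : IsUnit σ.det
  order : ℕ
  h : JetFn n (Fin N) order
  constr : Fin m → JetFn n (Fin N) order
  b : Fin n → JetFn n (Fin N ⊕ Fin m) order
  χI : Fin c → JetFn n (Fin N ⊕ Fin m) order

namespace Theory

variable (T : Theory n N m c) (S : Region n)

/-- The Hamiltonian `H = ∫_Σ (h + λ^a φ_a) + ∮ b^i`. -/
def ham : Functional n N m where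
  bulk :=
    { timeOrder := 0
      order := T.order
      fn :=
        { toFun := fun q => (T.h.relabel Sum.inl).toFun q +
            ∑ a, q.2 (Sum.inr (a, 0), 0) * ((T.constr a).relabel Sum.inl).toFun q
          smooth := by
            refine (JetFn.smooth _).add (ContDiff.sum fun a _ => ?_)
            exact ((contDiff_apply ℝ ℝ _).comp contDiff_snd).mul (JetFn.smooth _) } }
  bdry := fun i => ⟨0, T.order, (T.b i).relabel (Sum.map id fun a => (a, 0))⟩

def constrVal (a : Fin m) (φ : Hist n N m) : ST n → ℝ :=
  (T.constr a).eval fun A => φ (Sum.inl A)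

/-- `ż^A - σ^{AB} δH/δz^B`. -/
def eom (A : Fin N) (φ : Hist n N m) : ST n → ℝ :=
  fun p => dt (φ (Sum.inl A)) p - ∑ B, T.σ A B * T.ham.eulerZ φ B p

/-- First-class constraints and first-class `h`: on every configuration that satisfies the
constraints, the brackets of the smeared constraints with one another and with `h` vanish. -/
def FirstClass : Prop :=
  ∀ (z : Fin N → ST n → ℝ) (t : ℝ), (∀ A, ContDiff ℝ ∞ (z A)) →
    (∀ a, ∀ x ∈ S.body, (T.constr a).eval z (t, x) = 0) →
    ∀ (ε : ST n → ℝ) (hε : ContDiff ℝ ∞ ε), tsupport ε ⊆ Set.univ ×ˢ interior S.body → ∀ a,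
      S.bulkInt (fun p => ∑ A, ∑ B,
        ((T.constr a).smear ε hε).euler z A p * T.σ A B * T.h.euler z B p) t = 0 ∧
      ∀ (η : ST n → ℝ) (hη : ContDiff ℝ ∞ η), tsupport η ⊆ Set.univ ×ˢ interior S.body → ∀ a',
        S.bulkInt (fun p => ∑ A, ∑ B,
          ((T.constr a).smear ε hε).euler z A p * T.σ A B *
            ((T.constr a').smear η hη).euler z B p) t = 0

/-- Smooth histories that satisfy the external boundary conditions `χ_E|_{∂Σ} = 0`:
`∂_(i) φ_a = 0` and `∂_(i) (ż^A - σ^{AB} δH/δz^B) = 0` on `∂Σ`. -/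
def Admissible (φ : Hist n N m) : Prop :=
  Smooth φ ∧ ∀ (β : Fin n → ℕ) (t : ℝ), ∀ x ∈ S.bdry,
    (∀ a, dMulti β (T.constrVal a φ) (t, x) = 0) ∧ ∀ A, dMulti β (T.eom A φ) (t, x) = 0

/-- `δχ_E|_{∂Σ} = 0` for the variation `ψ` at `φ`. -/
def PreservesExternal (φ ψ : Hist n N m) : Prop :=
  ∀ (β : Fin n → ℕ) (t : ℝ), ∀ x ∈ S.bdry,
    (∀ a, vary (fun φ' => dMulti β (T.constrVal a φ')) φ ψ (t, x) = 0) ∧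
    ∀ A, vary (fun φ' => dMulti β (T.eom A φ')) φ ψ (t, x) = 0

/-- Variations `ψ` at `φ` that preserve the internal boundary conditions:
`δχ_E|_{∂Σ} = 0` and `δχ_I^α|_{∂Σ} = 0`. -/
def InternalVariation (φ ψ : Hist n N m) : Prop :=
  Smooth ψ ∧ T.PreservesExternal S φ ψ ∧
    ∀ α (t : ℝ), ∀ x ∈ S.bdry, vary (T.χI α).eval φ ψ (t, x) = 0

/-- The total Hamiltonian has a well-defined variation: `δH` has no boundary term for variations
preserving the internal boundary conditions. -/
def HamDifferentiable : Prop :=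
  ∀ φ ψ, T.Admissible S φ → T.InternalVariation S φ ψ → ∀ t,
    T.ham.var S φ ψ t = S.bulkInt (fun p =>
      ∑ A, T.ham.eulerZ φ A p * ψ (Sum.inl A) p +
      ∑ a, T.constrVal a φ p * ψ (Sum.inr a) p) t

/-- The action on the time interval from `t₀` to `t₁`. -/
def action (φ : Hist n N m) (t₀ t₁ : ℝ) : ℝ :=
  ∫ t in t₀..t₁, (S.bulkInt (fun p => ∑ A, ∑ B,
    (1 / 2) * φ (Sum.inl A) p * T.σ⁻¹ A B * dt (φ (Sum.inl B)) p) t - T.ham.val S φ t)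

end Theory

/-! ## Transformations and their generators -/

/-- The transformation `δ_G z^A = Z^A`, `δ_G λ^a = Λ^a`, evaluated at `φ`. -/
def transf (Z : Fin N → LocalFn n N m) (Λ : Fin m → LocalFn n N m) (φ : Hist n N m) :
    Hist n N m :=
  Sum.elim (fun A => (Z A).eval φ) (fun a => (Λ a).eval φ)

/-- The part `δ^λ_G` of the transformation: `δz = 0`, `δλ^a = Λ^a`. -/
def transfLam (Λ : Fin m → LocalFn n N m) (φ : Hist n N m) : Hist n N m :=
  Sum.elim 0 (fun a => (Λ a).eval φ)

namespace Theory

variable (T : Theory n N m c) (S : Region n)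

/-- `[δ_G, δ] χ_I^α|_{∂Σ} = 0` for all variations `δ` preserving the internal boundary conditions.
As `δχ_I^α` vanishes on `∂Σ` for all admissible histories, this says that `δ (δ_G χ_I^α) = 0`:
the induced transformation of the sources `ζ^α` depends on the sources only. -/
def SourceCompatible (Z : Fin N → LocalFn n N m) (Λ : Fin m → LocalFn n N m) : Prop :=
  ∀ φ ψ, T.Admissible S φ → T.InternalVariation S φ ψ → ∀ α (t : ℝ), ∀ x ∈ S.bdry,
    vary (fun φ' => vary (T.χI α).eval φ' (transf Z Λ φ')) φ ψ (t, x) = 0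

/-- `δG = ∫_Σ (δG/δz^A δz^A + ∑_l δG/δλ^(l)a δλ^(l)a)` for all variations `δ` preserving the
internal boundary conditions. -/
def Differentiable (G : Functional n N m) : Prop :=
  ∀ φ ψ, T.Admissible S φ → T.InternalVariation S φ ψ → ∀ t,
    G.var S φ ψ t = G.bulkVar S φ ψ t

/-- The boundary term `∮ V`. -/
def bdryTerm (V : Fin n → LocalFn n N m) (φ : Hist n N m) (t : ℝ) : ℝ :=
  S.bdryInt (fun i => (V i).eval φ) t

/-- `δ ∮ V = 0` for all variations `δ` preserving the internal boundary conditions. -/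
def InvariantBdryTerm (V : Fin n → LocalFn n N m) : Prop :=
  ∀ φ ψ, T.Admissible S φ → T.InternalVariation S φ ψ → ∀ t : ℝ,
    deriv (fun s : ℝ => bdryTerm S V (φ + s • ψ) t) 0 = 0

/-- The transformation is an external symmetry of the action, with
`δ_G S = ∫ dt (dU/dt + ∮ V)` on every time interval. (By Gauss' theorem, a boundary part
of `U` may be absorbed into its density.) -/
structure IsExternalSymmetryVia (Z : Fin N → LocalFn n N m) (Λ : Fin m → LocalFn n N m)
    (U : Functional n N m) (V : Fin n → LocalFn n N m) : Prop where
  external : ∀ φ, T.Admissible S φ → T.PreservesExternal S φ (transf Z Λ φ)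
  internal : T.SourceCompatible S Z Λ
  action : ∀ φ, T.Admissible S φ → ∀ t₀ t₁ : ℝ,
    HasDerivAt (fun s : ℝ => T.action S (φ + s • transf Z Λ φ) t₀ t₁)
      (U.val S φ t₁ - U.val S φ t₀ + ∫ t in t₀..t₁, bdryTerm S V φ t) 0
  invariant : T.InvariantBdryTerm S V

/-- The transformation is an external symmetry of the action. -/
def IsExternalSymmetry (Z : Fin N → LocalFn n N m) (Λ : Fin m → LocalFn n N m) : Prop :=
  ∃ U V, T.IsExternalSymmetryVia S Z Λ U V

/-- The transformation is an external symmetry of the action, and `G` is the generator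
`∫_Σ ½ σ_{AB} z^A Z^B - U` that belongs to it. -/
def IsExternalSymmetryOf (G : Functional n N m)
    (Z : Fin N → LocalFn n N m) (Λ : Fin m → LocalFn n N m) : Prop :=
  ∃ U V, T.IsExternalSymmetryVia S Z Λ U V ∧
    ∀ φ, T.Admissible S φ → ∀ t : ℝ,
      G.val S φ t = S.bulkInt (fun p => ∑ A, ∑ B,
        (1 / 2) * T.σ⁻¹ A B * φ (Sum.inl A) p * (Z B).eval φ p) t - U.val S φ t

/-- `Z^A = σ^{AB} δG/δz^B`, and there is a boundary term `∮ V` with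
`DG/Dt + {G, H}_ζ - δ^λ_G H = ∮ V`, invariant under all variations preserving the internal
boundary conditions. -/
def IsConservedGenerator (G : Functional n N m)
    (Z : Fin N → LocalFn n N m) (Λ : Fin m → LocalFn n N m) : Prop :=
  (∀ φ, T.Admissible S φ → ∀ (A : Fin N) (t : ℝ), ∀ x ∈ S.body,
    (Z A).eval φ (t, x) = ∑ B, T.σ A B * G.eulerZ φ B (t, x)) ∧
  ∃ V : Fin n → LocalFn n N m,
    (∀ φ, T.Admissible S φ → ∀ t,
      G.bigD S φ t + G.modBracket S T.ham T.σ φ t - T.ham.var S φ (transfLam Λ φ) t =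
        bdryTerm S V φ t) ∧
    T.InvariantBdryTerm S V

end Theory

end GaugeField

end

/-!
The first variation of the action along `Q = (Z, Λ)` is, up to the increment of `∫ ½ σ z Z`, the
time integral of `∫ σ_{AB} Z^A ż^B - δ_Q H` (`Theory.hasDerivAt_action`). The time derivative of
`G` along a history is `DG/Dt` plus the variation of `G` along `ż`, boundary terms included. On an
admissible history `ż - δ_H z` vanishes to infinite order on `∂Σ`, so that in the boundary part of
this variation `ż` may be replaced by `δ_H z`, and the bulk part pairs `δG/δz` with `ż`. If `Z = σ
δG/δz`, the two facts combine, at each time, to the identity `DG/Dt + {G, H}_ζ - δ^λ_G H = dG/dt +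
∫ σ_{AB} Z^A ż^B - δ_Q H` (`Theory.bigD_add_modBracket_sub`). The left-hand side is a boundary
term exactly if the action is invariant with `U = ∫ ½ σ z Z - G`: one direction integrates the
identity over a time interval, the other one differentiates in the end point of the interval. Only
functions that are flat on `∂Σ` are ever integrated by parts; they may be extended by zero outside
`Σ` (`Region.bulkInt_mul_dx`).

Two points remain. First, the symmetry has to give `Z = σ δG/δz`. Invariance of the action yields
the right-hand side of the identity above as a boundary term, on all admissible histories. At a
given time one may keep all fields and change only `ż`, in the interior of `Σ`; the expression is
affine in `ż`, with coefficient `δG/δz^B + Z^A σ_{AB}`, which therefore vanishes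
(`Theory.eval_eq_of_conservation`). Secondly, the conservation identity has to imply that the
external boundary conditions are preserved. Once the action is known to be invariant, this follows
from its second variation. Differentiating the invariance along variations that vanish near `∂Σ`
and near the ends of the time interval shows that the equations of motion linearized along `Q` are
minus the adjoint of the linearization of `Q` applied to the equations of motion. The latter
vanish to infinite order on `∂Σ`, and so do the linearized ones (`Theory.flatHist_linFieldEq`),
which is the claim (`Theory.preservesExternal_of_action`).

For the second part, a generator of a given external symmetry is `∫ ½ σ z Z - U`, a functional
because local functions are closed under products (`Theory.exists_kin_sub`).

The integrals over `∂Σ` may be differentiated in parameters because `∂Σ` has finite area: near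
each of its points an orthogonal projection onto a hyperplane is antilipschitz on it
(`Region.hausdorff_bdry_lt_top`).
-/

noncomputable section

namespace GaugeField

/-! ### Directional derivatives of smooth functions -/

section Directional

variable {E : Type*} [NormedAddCommGroup E] [NormedSpace ℝ E]

/-- The derivative of `f` in the constant direction `v`; both `dt` and `dx i` are of this form. -/
def dd (v : E) (f : E → ℝ) : E → ℝ := fun p => fderiv ℝ f p v

theorem contDiff_dd {f : E → ℝ} (hf : ContDiff ℝ ∞ f) (v : E) : ContDiff ℝ ∞ (dd v f) :=
  (hf.fderiv_right (m := ∞) (by simp)).clm_apply contDiff_const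

theorem differentiable_of_smooth {F : Type*} [NormedAddCommGroup F] [NormedSpace ℝ F]
    {f : E → F} (hf : ContDiff ℝ ∞ f) : Differentiable ℝ f :=
  hf.differentiable (by simp)

theorem dd_add {f g : E → ℝ} (hf : ContDiff ℝ ∞ f) (hg : ContDiff ℝ ∞ g) (v : E) :
    dd v (f + g) = dd v f + dd v g := by
  ext p
  simp [dd, fderiv_add (differentiable_of_smooth hf p) (differentiable_of_smooth hg p)]

theorem dd_const_smul {f : E → ℝ} (hf : ContDiff ℝ ∞ f) (a : ℝ) (v : E) :
    dd v (a • f) = a • dd v f := by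
  ext p
  simp [dd, fderiv_const_smul (differentiable_of_smooth hf p)]

theorem dd_mul {f g : E → ℝ} (hf : ContDiff ℝ ∞ f) (hg : ContDiff ℝ ∞ g) (v : E) :
    dd v (f * g) = dd v f * g + f * dd v g := by
  ext p
  simp [dd, fderiv_mul (differentiable_of_smooth hf p) (differentiable_of_smooth hg p)]
  ring

theorem dd_zero (v : E) : dd v (0 : E → ℝ) = 0 := by
  ext p
  simp [dd, Pi.zero_def]

theorem dd_comm {f : E → ℝ} (hf : ContDiff ℝ ∞ f) (v w : E) :
    dd v (dd w f) = dd w (dd v f) := by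
  ext p
  have hd : DifferentiableAt ℝ (fderiv ℝ f) p :=
    differentiable_of_smooth (hf.fderiv_right (m := ∞) (by simp)) p
  have key : ∀ a b : E, fderiv ℝ (fun q => fderiv ℝ f q a) p b = fderiv ℝ (fderiv ℝ f) p b a := by
    intro a b
    rw [fderiv_clm_apply hd (differentiableAt_const a)]
    simp
  have hs : IsSymmSndFDerivAt ℝ f p :=
    (hf.contDiffAt (x := p)).isSymmSndFDerivAt
      (by rw [minSmoothness_of_isRCLikeNormedField]
          exact WithTop.coe_le_coe.2 (le_top : (2 : ℕ∞) ≤ ⊤))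
  exact (key w v).trans ((hs v w).trans (key v w).symm)

theorem dd_congr {f g : E → ℝ} {p : E} (h : f =ᶠ[nhds p] g) (v : E) :
    dd v f =ᶠ[nhds p] dd v g := by
  filter_upwards [h.fderiv (𝕜 := ℝ)] with q hq
  simp [dd, hq]

end Directional

variable {n N m c : ℕ}

/-- The unit vector `∂/∂t` of space-time. -/
def vt (n : ℕ) : ST n := (1, 0)

/-- The unit vector `∂/∂x^i` of space-time. -/
def vx (i : Fin n) : ST n := (0, EuclideanSpace.single i 1)

theorem dt_eq_dd : (dt : (ST n → ℝ) → ST n → ℝ) = dd (vt n) := rfl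

theorem dx_eq_dd (i : Fin n) : dx i = dd (vx i) := rfl

/-- Iterated spatial derivatives in the directions listed. Unlike `dMulti` they allow induction on
the number of derivatives. -/
def dList (l : List (Fin n)) (f : ST n → ℝ) : ST n → ℝ := l.foldr (fun i g => dx i g) f

@[simp] theorem dList_nil (f : ST n → ℝ) : dList [] f = f := rfl

@[simp] theorem dList_cons (i : Fin n) (l : List (Fin n)) (f : ST n → ℝ) :
    dList (i :: l) f = dx i (dList l f) := rfl

theorem dList_append (l l' : List (Fin n)) (f : ST n → ℝ) :
    dList (l ++ l') f = dList l (dList l' f) := by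
  simp [dList]

theorem dList_replicate (k : ℕ) (i : Fin n) (f : ST n → ℝ) :
    dList (List.replicate k i) f = (dx i)^[k] f := by
  induction k with
  | zero => rfl
  | succ k ih => rw [List.replicate_succ, dList_cons, ih, Function.iterate_succ_apply']

/-- A spatial multi-index, written as a list of directions. -/
def miList (α : Fin n → ℕ) : List (Fin n) :=
  (List.finRange n).flatMap fun i => List.replicate (α i) i

theorem dMulti_eq_dList (α : Fin n → ℕ) (f : ST n → ℝ) : dMulti α f = dList (miList α) f := by
  unfold dMulti miList
  induction List.finRange n with
  | nil => rfl
  | cons i l ih => rw [List.foldr_cons, ih, List.flatMap_cons, dList_append, dList_replicate]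

theorem length_miList (α : Fin n → ℕ) : (miList α).length = ∑ i, α i := by
  simp [miList, List.length_flatMap, List.sum_ofFn, ← List.ofFn_eq_map]

@[simp] theorem dMulti_zero_index (f : ST n → ℝ) : dMulti 0 f = f := by
  have h : miList (0 : Fin n → ℕ) = [] := by
    rw [← List.length_eq_zero_iff, length_miList]
    simp
  rw [dMulti_eq_dList, h, dList_nil]

theorem contDiff_dx {f : ST n → ℝ} (hf : ContDiff ℝ ∞ f) (i : Fin n) : ContDiff ℝ ∞ (dx i f) :=
  contDiff_dd hf _

theorem contDiff_dt {f : ST n → ℝ} (hf : ContDiff ℝ ∞ f) : ContDiff ℝ ∞ (dt f) :=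
  contDiff_dd hf _

theorem contDiff_iterate_dt {f : ST n → ℝ} (hf : ContDiff ℝ ∞ f) (k : ℕ) :
    ContDiff ℝ ∞ (dt^[k] f) := by
  induction k with
  | zero => exact hf
  | succ k ih => rw [Function.iterate_succ_apply']; exact contDiff_dt ih

theorem contDiff_dList {f : ST n → ℝ} (hf : ContDiff ℝ ∞ f) (l : List (Fin n)) :
    ContDiff ℝ ∞ (dList l f) := by
  induction l with
  | nil => exact hf
  | cons i l ih => exact contDiff_dx ih i

theorem contDiff_dMulti {f : ST n → ℝ} (hf : ContDiff ℝ ∞ f) (α : Fin n → ℕ) :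
    ContDiff ℝ ∞ (dMulti α f) := by
  rw [dMulti_eq_dList]; exact contDiff_dList hf _

theorem dList_add {f g : ST n → ℝ} (hf : ContDiff ℝ ∞ f) (hg : ContDiff ℝ ∞ g)
    (l : List (Fin n)) : dList l (f + g) = dList l f + dList l g := by
  induction l with
  | nil => rfl
  | cons i l ih =>
    rw [dList_cons, ih, dx_eq_dd, dd_add (contDiff_dList hf l) (contDiff_dList hg l)]
    rfl

theorem dList_zero (l : List (Fin n)) : dList l (0 : ST n → ℝ) = 0 := by
  induction l with
  | nil => rfl
  | cons i l ih => rw [dList_cons, ih]; exact dd_zero _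

theorem dList_dd_comm {f : ST n → ℝ} (hf : ContDiff ℝ ∞ f) (v : ST n) (l : List (Fin n)) :
    dList l (dd v f) = dd v (dList l f) := by
  induction l with
  | nil => rfl
  | cons i l ih =>
    rw [dList_cons, ih, dList_cons, dx_eq_dd, dd_comm (contDiff_dList hf l)]

theorem dList_congr {f g : ST n → ℝ} {p : ST n} (h : f =ᶠ[nhds p] g) (l : List (Fin n)) :
    dList l f =ᶠ[nhds p] dList l g := by
  induction l with
  | nil => exact h
  | cons i l ih => exact dd_congr ih _

theorem iterate_dt_congr {f g : ST n → ℝ} {p : ST n} (h : f =ᶠ[nhds p] g) (k : ℕ) :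
    dt^[k] f =ᶠ[nhds p] dt^[k] g := by
  induction k with
  | zero => exact h
  | succ k ih => simp only [Function.iterate_succ_apply']; exact dd_congr ih _

theorem dMulti_congr {f g : ST n → ℝ} {p : ST n} (h : f =ᶠ[nhds p] g) (α : Fin n → ℕ) :
    dMulti α f =ᶠ[nhds p] dMulti α g := by
  rw [dMulti_eq_dList, dMulti_eq_dList]; exact dList_congr h _

theorem dMulti_add {f g : ST n → ℝ} (hf : ContDiff ℝ ∞ f) (hg : ContDiff ℝ ∞ g)
    (α : Fin n → ℕ) : dMulti α (f + g) = dMulti α f + dMulti α g := by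
  simp only [dMulti_eq_dList, dList_add hf hg]

@[simp] theorem dMulti_zero (α : Fin n → ℕ) : dMulti α (0 : ST n → ℝ) = 0 := by
  simp only [dMulti_eq_dList, dList_zero]

theorem dMulti_dt_comm {f : ST n → ℝ} (hf : ContDiff ℝ ∞ f) (α : Fin n → ℕ) :
    dMulti α (dt f) = dt (dMulti α f) := by
  simp only [dMulti_eq_dList, dt_eq_dd, dList_dd_comm hf]

theorem iterate_dt_add {f g : ST n → ℝ} (hf : ContDiff ℝ ∞ f) (hg : ContDiff ℝ ∞ g) (k : ℕ) :
    dt^[k] (f + g) = dt^[k] f + dt^[k] g := by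
  induction k with
  | zero => rfl
  | succ k ih =>
    simp only [Function.iterate_succ_apply', ih]
    exact dd_add (contDiff_iterate_dt hf k) (contDiff_iterate_dt hg k) _

@[simp] theorem iterate_dt_zero (k : ℕ) : dt^[k] (0 : ST n → ℝ) = 0 := by
  induction k with
  | zero => rfl
  | succ k ih =>
    simp only [Function.iterate_succ_apply', ih]
    exact dd_zero _

theorem iterate_dx_comm {f : ST n → ℝ} (hf : ContDiff ℝ ∞ f) (i j : Fin n) (k : ℕ) :
    (dx i) ((dx j)^[k] f) = (dx j)^[k] (dx i f) := by
  rw [← dList_replicate, ← dList_replicate, dx_eq_dd, dList_dd_comm hf]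

/-- A spatial derivative of `∂_(β) f` is again a derivative of the form `∂_(β') f`. -/
theorem dMulti_dx {f : ST n → ℝ} (hf : ContDiff ℝ ∞ f) (β : Fin n → ℕ) (i : Fin n) :
    dx i (dMulti β f) = dMulti (β + Pi.single i 1) f := by
  have key : ∀ L : List (Fin n), L.Nodup →
      (i ∉ L → (L.foldr (fun j g => (dx j)^[(β + Pi.single i 1 : Fin n → ℕ) j] g) f) =
        L.foldr (fun j g => (dx j)^[β j] g) f) ∧
      (i ∈ L → (L.foldr (fun j g => (dx j)^[(β + Pi.single i 1 : Fin n → ℕ) j] g) f) =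
        dx i (L.foldr (fun j g => (dx j)^[β j] g) f)) := by
    intro L hL
    have hsm : ∀ L : List (Fin n), ContDiff ℝ ∞ (L.foldr (fun j g => (dx j)^[β j] g) f) := by
      intro L
      induction L with
      | nil => exact hf
      | cons j L ih =>
        rw [List.foldr_cons, ← dList_replicate]
        exact contDiff_dList ih _
    induction L with
    | nil => simp
    | cons j L ih =>
      obtain ⟨hj, hL'⟩ := List.nodup_cons.1 hL
      obtain ⟨h1, h2⟩ := ih hL'
      constructor
      · intro hi
        have hij : j ≠ i := fun h => hi (by simp [h])
        have hi' : i ∉ L := fun h => hi (List.mem_cons_of_mem _ h)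
        rw [List.foldr_cons, List.foldr_cons, h1 hi']
        simp [Pi.single_eq_of_ne hij]
      · intro hi
        by_cases hij : i = j
        · subst hij
          rw [List.foldr_cons, List.foldr_cons, h1 hj]
          simp [Function.iterate_succ_apply']
        · have hi' : i ∈ L := by simpa [hij] using hi
          rw [List.foldr_cons, List.foldr_cons, h2 hi', iterate_dx_comm (hsm L)]
          simp [Pi.single_eq_of_ne (Ne.symm hij)]
  exact ((key _ (List.nodup_finRange n)).2 (List.mem_finRange i)).symm

theorem exists_dMulti_eq_dList (l : List (Fin n)) :
    ∃ β : Fin n → ℕ, ∀ f : ST n → ℝ, ContDiff ℝ ∞ f → dList l f = dMulti β f := by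
  induction l with
  | nil => exact ⟨0, fun f _ => by simp⟩
  | cons i l ih =>
    obtain ⟨β, h⟩ := ih
    exact ⟨β + Pi.single i 1, fun f hf => by rw [dList_cons, h f hf, dMulti_dx hf]⟩

/-! ### Functions that vanish to infinite order on the boundary -/

/-- Smooth functions of `(t, x)` all of whose spatial derivatives vanish on `∂Σ` at all times. -/
def Flat (S : Region n) (f : ST n → ℝ) : Prop :=
  ContDiff ℝ ∞ f ∧ ∀ (β : Fin n → ℕ) (t : ℝ), ∀ x ∈ S.bdry, dMulti β f (t, x) = 0

namespace Flat

variable {S : Region n} {f g : ST n → ℝ}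

theorem dList_eq_zero (hf : Flat S f) (l : List (Fin n)) (t : ℝ) {x : Space n}
    (hx : x ∈ S.bdry) : dList l f (t, x) = 0 := by
  obtain ⟨β, h⟩ := exists_dMulti_eq_dList l
  rw [h f hf.1]
  exact hf.2 β t x hx

theorem of_dList (hf : ContDiff ℝ ∞ f)
    (h : ∀ (l : List (Fin n)) (t : ℝ), ∀ x ∈ S.bdry, dList l f (t, x) = 0) : Flat S f :=
  ⟨hf, fun β t x hx => by rw [dMulti_eq_dList]; exact h _ t x hx⟩

theorem apply_eq_zero (hf : Flat S f) (t : ℝ) {x : Space n} (hx : x ∈ S.bdry) :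
    f (t, x) = 0 := hf.dList_eq_zero [] t hx

theorem dx (hf : Flat S f) (i : Fin n) : Flat S (dx i f) :=
  of_dList (contDiff_dx hf.1 i) fun l t x hx => by
    have h := hf.dList_eq_zero (l ++ [i]) t hx
    rwa [dList_append] at h

theorem dList (hf : Flat S f) (l : List (Fin n)) : Flat S (dList l f) := by
  induction l with
  | nil => exact hf
  | cons i l ih => exact ih.dx i

theorem dMulti (hf : Flat S f) (α : Fin n → ℕ) : Flat S (dMulti α f) := by
  rw [dMulti_eq_dList]; exact hf.dList _

theorem add (hf : Flat S f) (hg : Flat S g) : Flat S (f + g) :=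
  ⟨hf.1.add hg.1, fun β t x hx => by
    rw [dMulti_add hf.1 hg.1, Pi.add_apply, hf.2 β t x hx, hg.2 β t x hx, add_zero]⟩

theorem zero : Flat S (0 : ST n → ℝ) := ⟨contDiff_const, fun β t x _ => by simp⟩

theorem sum {ι : Type*} (s : Finset ι) {f : ι → ST n → ℝ} (hf : ∀ i, Flat S (f i)) :
    Flat S (∑ i ∈ s, f i) := by
  classical
  induction s using Finset.induction_on with
  | empty => simpa using zero
  | insert a s ha ih => rw [Finset.sum_insert ha]; exact (hf a).add ih

theorem mul_left (hf : Flat S f) (hg : ContDiff ℝ ∞ g) : Flat S (g * f) := by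
  refine of_dList (hg.mul hf.1) fun l => ?_
  -- the derivative on the far right of the list is moved onto the factors
  induction l using List.reverseRecOn generalizing f g with
  | nil => intro t x hx; simp [hf.apply_eq_zero t hx]
  | append_singleton l i ih =>
    intro t x hx
    have h1 : GaugeField.dList [i] (g * f) = GaugeField.dx i g * f + g * GaugeField.dx i f :=
      dd_mul hg hf.1 _
    have h2 : GaugeField.dList l (GaugeField.dx i g * f + g * GaugeField.dx i f) =
        GaugeField.dList l (GaugeField.dx i g * f) + GaugeField.dList l (g * GaugeField.dx i f) :=
      dList_add ((contDiff_dx hg i).mul hf.1) (hg.mul (contDiff_dx hf.1 i)) l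
    rw [dList_append, h1, h2, Pi.add_apply, ih hf (contDiff_dx hg i) t x hx,
      ih (hf.dx i) hg t x hx, add_zero]

theorem const_smul (hf : Flat S f) (a : ℝ) : Flat S (a • f) :=
  hf.mul_left (g := fun _ => a) contDiff_const

theorem neg (hf : Flat S f) : Flat S (-f) := by
  have h := hf.const_smul (-1)
  rwa [neg_one_smul] at h

/-- The condition holds at all times, so it may be differentiated along the boundary. -/
theorem dt (hf : Flat S f) : Flat S (dt f) :=
  ⟨contDiff_dt hf.1, fun β t x hx => by
    rw [dMulti_dt_comm hf.1]
    have hd : HasFDerivAt (GaugeField.dMulti β f) (fderiv ℝ (GaugeField.dMulti β f) (t, x)) (t, x) :=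
      (differentiable_of_smooth (contDiff_dMulti hf.1 β) _).hasFDerivAt
    have hc : HasDerivAt (fun s : ℝ => ((s, x) : ST n)) (1, 0) t :=
      (hasDerivAt_id t).prodMk (hasDerivAt_const t x)
    have h1 := hd.comp_hasDerivAt t hc
    have h2 : (GaugeField.dMulti β f ∘ fun s : ℝ => ((s, x) : ST n)) = fun _ => 0 := by
      ext s; exact hf.2 β s x hx
    rw [h2] at h1
    exact h1.unique (hasDerivAt_const t (0 : ℝ))⟩

theorem iterate_dt (hf : Flat S f) (k : ℕ) : Flat S (GaugeField.dt^[k] f) := by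
  induction k with
  | zero => exact hf
  | succ k ih => rw [Function.iterate_succ_apply']; exact ih.dt

end Flat

/-! ### Smooth one-parameter families of functions -/

/-- Families `Φ s` of functions of `(t, x)` that are jointly smooth in `s` and `(t, x)`. -/
def SF (Φ : ℝ → ST n → ℝ) : Prop := ContDiff ℝ ∞ (fun q : ℝ × ST n => Φ q.1 q.2)

/-- The derivative of a family with respect to its parameter. -/
def ds (Φ : ℝ → ST n → ℝ) (s : ℝ) : ST n → ℝ := fun p => deriv (fun s => Φ s p) s

namespace SF

variable {Φ Ψ : ℝ → ST n → ℝ}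

theorem slice (h : SF Φ) (s : ℝ) : ContDiff ℝ ∞ (Φ s) :=
  ContDiff.comp (g := fun q : ℝ × ST n => Φ q.1 q.2) h (contDiff_const.prodMk contDiff_id)

theorem hasDerivAt_dd (h : SF Φ) (s : ℝ) (p : ST n) :
    HasDerivAt (fun s => Φ s p) (dd ((1, 0) : ℝ × ST n) (fun q => Φ q.1 q.2) (s, p)) s :=
  HasFDerivAt.comp_hasDerivAt (f := fun s : ℝ => ((s, p) : ℝ × ST n))
    (l := fun q : ℝ × ST n => Φ q.1 q.2) s
    (differentiable_of_smooth h (s, p)).hasFDerivAt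
    ((hasDerivAt_id s).prodMk (hasDerivAt_const s p))

theorem ds_eq (h : SF Φ) (s : ℝ) (p : ST n) :
    ds Φ s p = dd ((1, 0) : ℝ × ST n) (fun q => Φ q.1 q.2) (s, p) :=
  (h.hasDerivAt_dd s p).deriv

theorem hasDerivAt (h : SF Φ) (s : ℝ) (p : ST n) : HasDerivAt (fun s => Φ s p) (ds Φ s p) s := by
  rw [h.ds_eq]; exact h.hasDerivAt_dd s p

theorem dd_eq (h : SF Φ) (v : ST n) (s : ℝ) (p : ST n) :
    dd v (Φ s) p = dd ((0, v) : ℝ × ST n) (fun q => Φ q.1 q.2) (s, p) := by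
  have h1 : HasFDerivAt (fun p : ST n => ((s, p) : ℝ × ST n))
      ((0 : ST n →L[ℝ] ℝ).prod (ContinuousLinearMap.id ℝ (ST n))) p :=
    (hasFDerivAt_const s p).prodMk (hasFDerivAt_id p)
  have h2 := HasFDerivAt.comp (g := fun q : ℝ × ST n => Φ q.1 q.2) p
    (differentiable_of_smooth h (s, p)).hasFDerivAt h1
  have h3 : fderiv ℝ (Φ s) p = _ := h2.fderiv
  simp only [dd]
  rw [h3]
  rfl

theorem ds (h : SF Φ) : SF (ds Φ) := by
  have h1 := contDiff_dd h ((1, 0) : ℝ × ST n)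
  have h2 : (fun q : ℝ × ST n => GaugeField.ds Φ q.1 q.2) =
      GaugeField.dd ((1, 0) : ℝ × ST n) (fun q => Φ q.1 q.2) := by
    ext q; exact h.ds_eq q.1 q.2
  unfold SF
  rwa [h2]

theorem dd (h : SF Φ) (v : ST n) : SF (fun s => dd v (Φ s)) := by
  have h1 := contDiff_dd h ((0, v) : ℝ × ST n)
  have h2 : (fun q : ℝ × ST n => GaugeField.dd v (Φ q.1) q.2) =
      GaugeField.dd ((0, v) : ℝ × ST n) (fun q => Φ q.1 q.2) := by
    ext q; exact h.dd_eq v q.1 q.2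
  unfold SF
  rwa [h2]

/-- Derivatives with respect to the parameter and with respect to `(t, x)` commute. -/
theorem ds_dd (h : SF Φ) (v : ST n) (s : ℝ) :
    GaugeField.ds (fun s => GaugeField.dd v (Φ s)) s = GaugeField.dd v (GaugeField.ds Φ s) := by
  ext p
  rw [(h.dd v).ds_eq, h.ds.dd_eq]
  have h1 : (fun q : ℝ × ST n => GaugeField.dd v (Φ q.1) q.2) =
      GaugeField.dd ((0, v) : ℝ × ST n) (fun q => Φ q.1 q.2) := by
    ext q; exact h.dd_eq v q.1 q.2
  have h2 : (fun q : ℝ × ST n => GaugeField.ds Φ q.1 q.2) =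
      GaugeField.dd ((1, 0) : ℝ × ST n) (fun q => Φ q.1 q.2) := by
    ext q; exact h.ds_eq q.1 q.2
  rw [h1, h2, dd_comm h]

theorem dList (h : SF Φ) (l : List (Fin n)) : SF (fun s => dList l (Φ s)) := by
  induction l with
  | nil => exact h
  | cons i l ih => exact ih.dd _

theorem ds_dList (h : SF Φ) (l : List (Fin n)) (s : ℝ) :
    GaugeField.ds (fun s => GaugeField.dList l (Φ s)) s =
      GaugeField.dList l (GaugeField.ds Φ s) := by
  induction l with
  | nil => rfl
  | cons i l ih =>
    have h1 := (h.dList l).ds_dd (vx i) s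
    rw [ih] at h1
    exact h1

theorem dMulti (h : SF Φ) (α : Fin n → ℕ) : SF (fun s => dMulti α (Φ s)) := by
  simp only [dMulti_eq_dList]; exact h.dList _

theorem ds_dMulti (h : SF Φ) (α : Fin n → ℕ) (s : ℝ) :
    GaugeField.ds (fun s => GaugeField.dMulti α (Φ s)) s =
      GaugeField.dMulti α (GaugeField.ds Φ s) := by
  simp only [dMulti_eq_dList, h.ds_dList]

theorem iterate_dt (h : SF Φ) (k : ℕ) : SF (fun s => dt^[k] (Φ s)) := by
  induction k with
  | zero => exact h
  | succ k ih => simp only [Function.iterate_succ_apply']; exact ih.dd _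

theorem ds_iterate_dt (h : SF Φ) (k : ℕ) (s : ℝ) :
    GaugeField.ds (fun s => dt^[k] (Φ s)) s = dt^[k] (GaugeField.ds Φ s) := by
  induction k with
  | zero => rfl
  | succ k ih =>
    simp only [Function.iterate_succ_apply']
    have h1 := (h.iterate_dt k).ds_dd (vt n) s
    rw [ih] at h1
    exact h1

theorem const {f : ST n → ℝ} (hf : ContDiff ℝ ∞ f) : SF (fun _ => f) :=
  hf.comp contDiff_snd

theorem sub (h : SF Φ) (h' : SF Ψ) : SF (fun s => Φ s - Ψ s) := ContDiff.sub h h'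

theorem mul (h : SF Φ) (h' : SF Ψ) : SF (fun s => Φ s * Ψ s) := ContDiff.mul h h'

theorem sum {ι : Type*} (u : Finset ι) {Φ : ι → ℝ → ST n → ℝ} (h : ∀ i, SF (Φ i)) :
    SF (fun s p => ∑ i ∈ u, Φ i s p) :=
  ContDiff.sum (f := fun i (q : ℝ × ST n) => Φ i q.1 q.2) fun i _ => h i

theorem affine {f g : ST n → ℝ} (hf : ContDiff ℝ ∞ f) (hg : ContDiff ℝ ∞ g) :
    SF (fun s => f + s • g) :=
  ContDiff.add (hf.comp contDiff_snd) (contDiff_fst.smul (hg.comp contDiff_snd))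

end SF

theorem ds_affine (f g : ST n → ℝ) (s : ℝ) : ds (fun s => f + s • g) s = g := by
  ext p
  have h : HasDerivAt (fun s : ℝ => f p + s * g p) (1 * g p) s :=
    ((hasDerivAt_id s).mul_const (g p)).const_add (f p)
  rw [one_mul] at h
  exact h.deriv

/-! ### Linearization of local functions -/

namespace JetFn

variable {r : ℕ} {J K : Type} [Fintype J] [Fintype K]

theorem contDiff_jet {u : J → ST n → ℝ} (hu : ∀ j, ContDiff ℝ ∞ (u j)) (r : ℕ) :
    ContDiff ℝ ∞ (jet r u) :=
  contDiff_pi.2 fun q => contDiff_dMulti (hu q.1) _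

theorem contDiff_eval (f : JetFn n J r) {u : J → ST n → ℝ} (hu : ∀ j, ContDiff ℝ ∞ (u j)) :
    ContDiff ℝ ∞ (f.eval u) :=
  f.smooth.comp (contDiff_id.prodMk (contDiff_jet hu r))

theorem sf_eval (f : JetFn n J r) {u : ℝ → J → ST n → ℝ} (hu : ∀ j, SF fun s => u s j) :
    SF fun s => f.eval (u s) := by
  refine f.smooth.comp (contDiff_snd.prodMk (contDiff_pi.2 fun q => ?_))
  exact (hu q.1).dMulti _

/-- The linearization of `f` at `u`, applied to `v`. -/
def lin (f : JetFn n J r) (u v : J → ST n → ℝ) : ST n → ℝ :=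
  fun p => fderiv ℝ f.toFun (p, jet r u p) (0, jet r v p)

theorem contDiff_lin (f : JetFn n J r) {u v : J → ST n → ℝ} (hu : ∀ j, ContDiff ℝ ∞ (u j))
    (hv : ∀ j, ContDiff ℝ ∞ (v j)) : ContDiff ℝ ∞ (f.lin u v) :=
  ((f.smooth.fderiv_right (m := ∞) (by simp)).comp
    (contDiff_id.prodMk (contDiff_jet hu r))).clm_apply
      (contDiff_const.prodMk (contDiff_jet hv r))

theorem hasDerivAt_eval (f : JetFn n J r) {u : ℝ → J → ST n → ℝ} (hu : ∀ j, SF fun s => u s j)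
    (s : ℝ) (p : ST n) :
    HasDerivAt (fun s => f.eval (u s) p)
      (f.lin (u s) (fun j => ds (fun s => u s j) s) p) s := by
  have h1 : HasDerivAt (fun s => jet r (u s) p) (jet r (fun j => ds (fun s => u s j) s) p) s := by
    refine hasDerivAt_pi.2 fun q => ?_
    have h2 := ((hu q.1).dMulti q.2.toNat).hasDerivAt s p
    rwa [(hu q.1).ds_dMulti] at h2
  exact HasFDerivAt.comp_hasDerivAt (f := fun s => (p, jet r (u s) p)) s
    (differentiable_of_smooth f.smooth _).hasFDerivAt ((hasDerivAt_const s p).prodMk h1)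

theorem lin_eq_sum (f : JetFn n J r) (u v : J → ST n → ℝ) (p : ST n) :
    f.lin u v p = ∑ j, ∑ α : MI n r, f.jetDeriv u j α p * dMulti α.toNat (v j) p := by
  classical
  have h : ((0, jet r v p) : ST n × (J × MI n r → ℝ)) =
      ∑ q : J × MI n r, (dMulti q.2.toNat (v q.1) p) •
        ((0, Pi.single q 1) : ST n × (J × MI n r → ℝ)) := by
    refine Prod.ext ?_ ?_
    · simp [Prod.fst_sum]
    · ext q
      simp [Prod.snd_sum, jet, Finset.sum_apply, Pi.single_apply]
  unfold lin
  rw [h, map_sum, Fintype.sum_prod_type]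
  refine Finset.sum_congr rfl fun j _ => Finset.sum_congr rfl fun α _ => ?_
  rw [map_smul, smul_eq_mul, mul_comm]
  simp only [jetDeriv]

/-- The local function `∂f/∂u_{j,(α)}`. -/
def partialFn (f : JetFn n J r) (j : J) (α : MI n r) : JetFn n J r where
  toFun q := by
    classical
    exact fderiv ℝ f.toFun q (0, Pi.single (j, α) 1)
  smooth := (f.smooth.fderiv_right (m := ∞) (by simp)).clm_apply contDiff_const

theorem contDiff_jetDeriv (f : JetFn n J r) {u : J → ST n → ℝ} (hu : ∀ j, ContDiff ℝ ∞ (u j))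
    (j : J) (α : MI n r) : ContDiff ℝ ∞ (f.jetDeriv u j α) :=
  (f.partialFn j α).contDiff_eval hu

theorem contDiff_euler (f : JetFn n J r) {u : J → ST n → ℝ} (hu : ∀ j, ContDiff ℝ ∞ (u j))
    (j : J) : ContDiff ℝ ∞ (f.euler u j) :=
  ContDiff.sum fun _ _ => contDiff_const.mul (contDiff_dMulti (f.contDiff_jetDeriv hu _ _) _)

theorem sf_euler (f : JetFn n J r) {u : ℝ → J → ST n → ℝ} (hu : ∀ j, SF fun s => u s j)
    (j : J) : SF fun s => f.euler (u s) j := by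
  refine SF.sum _ fun α => ?_
  exact ContDiff.mul contDiff_const (((f.partialFn j α).sf_eval hu).dMulti α.toNat)

theorem jet_congr {u v : J → ST n → ℝ} {p : ST n} (h : ∀ j, u j =ᶠ[nhds p] v j) (r : ℕ) :
    jet r u =ᶠ[nhds p] jet r v := by
  have h1 : ∀ᶠ q in nhds p, ∀ a : J × MI n r, dMulti a.2.toNat (u a.1) q =
      dMulti a.2.toNat (v a.1) q :=
    Filter.eventually_all.2 fun a => dMulti_congr (h a.1) _
  filter_upwards [h1] with q hq
  ext a
  exact hq a

theorem eval_congr (f : JetFn n J r) {u v : J → ST n → ℝ} {p : ST n}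
    (h : ∀ j, u j =ᶠ[nhds p] v j) : f.eval u =ᶠ[nhds p] f.eval v := by
  filter_upwards [jet_congr h r] with q hq
  simp [eval, hq]

theorem euler_congr (f : JetFn n J r) {u v : J → ST n → ℝ} {p : ST n}
    (h : ∀ j, u j =ᶠ[nhds p] v j) (j : J) : f.euler u j =ᶠ[nhds p] f.euler v j := by
  have h1 : ∀ᶠ q in nhds p, ∀ α : MI n r, dMulti α.toNat (f.jetDeriv u j α) q =
      dMulti α.toNat (f.jetDeriv v j α) q :=
    Filter.eventually_all.2 fun α => dMulti_congr ((f.partialFn j α).eval_congr h) _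
  filter_upwards [h1] with q hq
  simp [euler, hq]

theorem jet_add {I : Type} {u v : I → ST n → ℝ} (hu : ∀ j, ContDiff ℝ ∞ (u j))
    (hv : ∀ j, ContDiff ℝ ∞ (v j)) (r : ℕ) (p : ST n) :
    jet r (u + v) p = jet r u p + jet r v p := by
  ext q
  simp only [jet, Pi.add_apply]
  rw [dMulti_add (hu q.1) (hv q.1)]
  rfl

theorem lin_add (f : JetFn n J r) (u : J → ST n → ℝ) {v w : J → ST n → ℝ}
    (hv : ∀ j, ContDiff ℝ ∞ (v j)) (hw : ∀ j, ContDiff ℝ ∞ (w j)) :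
    f.lin u (v + w) = f.lin u v + f.lin u w := by
  ext p
  simp only [lin, jet_add hv hw, Pi.add_apply]
  rw [← map_add]
  simp

/-- The time derivative of a local function along a history: the explicit one, and the one that
comes from the time dependence of the fields. -/
theorem dt_eval (f : JetFn n J r) {u : J → ST n → ℝ} (hu : ∀ j, ContDiff ℝ ∞ (u j)) (p : ST n) :
    dt (f.eval u) p =
      fderiv ℝ f.toFun (p, jet r u p) ((1, 0), jet r (fun j => dt (u j)) p) := by
  have h1 : HasFDerivAt (fun p => (p, jet r u p))
      ((ContinuousLinearMap.id ℝ (ST n)).prod (fderiv ℝ (jet r u) p)) p :=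
    (hasFDerivAt_id p).prodMk (differentiable_of_smooth (contDiff_jet hu r) p).hasFDerivAt
  have h2 := HasFDerivAt.comp p (differentiable_of_smooth f.smooth (p, jet r u p)).hasFDerivAt h1
  have h3 : fderiv ℝ (jet r u) p (1, 0) = jet r (fun j => dt (u j)) p := by
    ext q
    have h4 : jet r (fun j => dt (u j)) p q = dt (dMulti q.2.toNat (u q.1)) p := by
      simp only [jet]
      rw [dMulti_dt_comm (hu q.1)]
    have h5 : fderiv ℝ (jet r u) p = _ :=
      fderiv_pi fun q => differentiable_of_smooth (contDiff_dMulti (hu q.1) q.2.toNat) p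
    rw [h4, h5]
    rfl
  have h4 : fderiv ℝ (f.eval u) p = _ := h2.fderiv
  rw [← h3]
  simp only [dt]
  rw [h4]
  rfl

end JetFn

/-! ### Fields and the columns of their time derivatives -/

theorem Smooth.add {φ ψ : Hist n N m} (hφ : Smooth φ) (hψ : Smooth ψ) : Smooth (φ + ψ) :=
  fun j => (hφ j).add (hψ j)

theorem Smooth.smul {φ : Hist n N m} (hφ : Smooth φ) (a : ℝ) : Smooth (a • φ) :=
  fun j => contDiff_const.mul (hφ j)

theorem contDiff_columns {φ : Hist n N m} (hφ : Smooth φ) (k : ℕ) :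
    ∀ j, ContDiff ℝ ∞ (columns k φ j) := by
  rintro (A | q)
  · exact hφ _
  · exact contDiff_iterate_dt (hφ _) _

theorem columns_add {φ ψ : Hist n N m} (hφ : Smooth φ) (hψ : Smooth ψ) (k : ℕ) :
    columns k (φ + ψ) = columns k φ + columns k ψ := by
  ext j p
  rcases j with A | q
  · rfl
  · exact congrFun (iterate_dt_add (hφ _) (hψ _) _) p

theorem sf_columns {φ : ℝ → Hist n N m} (hφ : ∀ j, SF fun s => φ s j) (k : ℕ) :
    ∀ j, SF fun s => columns k (φ s) j := by
  rintro (A | q)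
  · exact hφ _
  · exact (hφ _).iterate_dt _

theorem ds_columns {φ : ℝ → Hist n N m} (hφ : ∀ j, SF fun s => φ s j) (k : ℕ) (s : ℝ) :
    (fun j => ds (fun s => columns k (φ s) j) s) =
      columns k (fun j => ds (fun s => φ s j) s) := by
  funext j
  rcases j with A | q
  · rfl
  · exact (hφ _).ds_iterate_dt _ _

theorem columns_congr {φ ψ : Hist n N m} {p : ST n} (h : ∀ j, φ j =ᶠ[nhds p] ψ j) (k : ℕ) :
    ∀ j, columns k φ j =ᶠ[nhds p] columns k ψ j := by
  rintro (A | q)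
  · exact h _
  · exact iterate_dt_congr (h _) _

theorem sf_affine {φ ψ : Hist n N m} (hφ : Smooth φ) (hψ : Smooth ψ) :
    ∀ j, SF fun s => (φ + s • ψ) j :=
  fun j => SF.affine (hφ j) (hψ j)

theorem ds_hist_affine (φ ψ : Hist n N m) (s : ℝ) :
    (fun j => ds (fun s => (φ + s • ψ) j) s) = ψ := by
  funext j
  exact ds_affine (φ j) (ψ j) s

namespace LocalFn

/-- The variation of `f` at `φ` along `ψ`. -/
def lin (f : LocalFn n N m) (φ ψ : Hist n N m) : ST n → ℝ :=
  f.fn.lin (columns f.timeOrder φ) (columns f.timeOrder ψ)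

variable (f : LocalFn n N m)

theorem contDiff_eval {φ : Hist n N m} (hφ : Smooth φ) : ContDiff ℝ ∞ (f.eval φ) :=
  f.fn.contDiff_eval (contDiff_columns hφ _)

theorem contDiff_lin {φ ψ : Hist n N m} (hφ : Smooth φ) (hψ : Smooth ψ) :
    ContDiff ℝ ∞ (f.lin φ ψ) :=
  f.fn.contDiff_lin (contDiff_columns hφ _) (contDiff_columns hψ _)

theorem sf_eval {φ : ℝ → Hist n N m} (hφ : ∀ j, SF fun s => φ s j) :
    SF fun s => f.eval (φ s) :=
  f.fn.sf_eval (sf_columns hφ _)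

theorem ds_eval {φ : ℝ → Hist n N m} (hφ : ∀ j, SF fun s => φ s j) (s : ℝ) :
    ds (fun s => f.eval (φ s)) s = f.lin (φ s) (fun j => ds (fun s => φ s j) s) := by
  ext p
  have h := f.fn.hasDerivAt_eval (sf_columns hφ f.timeOrder) s p
  rw [ds_columns hφ] at h
  exact h.deriv

theorem lin_add {φ ψ χ : Hist n N m} (hψ : Smooth ψ) (hχ : Smooth χ) :
    f.lin φ (ψ + χ) = f.lin φ ψ + f.lin φ χ := by
  unfold lin
  rw [columns_add hψ hχ,
    f.fn.lin_add _ (contDiff_columns hψ _) (contDiff_columns hχ _)]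

theorem eval_congr {φ ψ : Hist n N m} {p : ST n} (h : ∀ j, φ j =ᶠ[nhds p] ψ j) :
    f.eval φ =ᶠ[nhds p] f.eval ψ :=
  f.fn.eval_congr (columns_congr h _)

theorem contDiff_bigD {φ : Hist n N m} (hφ : Smooth φ) : ContDiff ℝ ∞ (f.bigD φ) := by
  have h : Smooth (Sum.elim 0 (fun a => dt (φ (Sum.inr a))) : Hist n N m) := by
    rintro (A | a)
    · exact contDiff_const
    · exact contDiff_dt (hφ _)
  exact ((f.fn.smooth.fderiv_right (m := ∞) (by simp)).comp
    (contDiff_id.prodMk (JetFn.contDiff_jet (contDiff_columns hφ _) _))).clm_apply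
      (contDiff_const.prodMk (JetFn.contDiff_jet (contDiff_columns h _) _))

end LocalFn

/-- The variation along the motion of the canonical fields: `δz = ż`, `δλ = 0`. -/
def zdot (φ : Hist n N m) : Hist n N m := Sum.elim (fun A => dt (φ (Sum.inl A))) 0

theorem smooth_zdot {φ : Hist n N m} (hφ : Smooth φ) : Smooth (zdot φ) := by
  rintro (A | a)
  · exact contDiff_dt (hφ _)
  · exact contDiff_const

theorem zdot_add_smul {φ Q : Hist n N m} (hφ : Smooth φ) (hQ : Smooth Q) (s : ℝ) :
    zdot (φ + s • Q) = zdot φ + s • zdot Q := by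
  funext j
  rcases j with A | a
  · have h2 := dd_add (hφ (Sum.inl A)) (hQ.smul s (Sum.inl A)) (vt n)
    have h3 := dd_const_smul (hQ (Sum.inl A)) s (vt n)
    exact h2.trans (by rw [← dt_eq_dd]; exact congrArg _ h3)
  · simp [zdot]

/-- The time derivative of a local function: `Df/Dt`, and the variation along `ż`. -/
theorem LocalFn.dt_eval (f : LocalFn n N m) {φ : Hist n N m} (hφ : Smooth φ) :
    dt (f.eval φ) = f.bigD φ + f.lin φ (zdot φ) := by
  ext p
  have hl : Smooth (Sum.elim 0 (fun a => dt (φ (Sum.inr a))) : Hist n N m) := by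
    rintro (A | a)
    · exact contDiff_const
    · exact contDiff_dt (hφ _)
  have h1 : (fun j => dt (columns f.timeOrder φ j)) =
      columns f.timeOrder (Sum.elim 0 (fun a => dt (φ (Sum.inr a))) : Hist n N m) +
        columns f.timeOrder (zdot φ) := by
    rw [← columns_add hl (smooth_zdot hφ)]
    ext j p
    rcases j with A | q
    · simp [columns, zdot]
    · simp only [columns, zdot, Sum.elim_inr, Pi.add_apply, Pi.zero_apply, add_zero]
      exact congrFun ((Function.iterate_succ_apply' dt _ _).symm.trans
        (Function.iterate_succ_apply dt _ _)) p
  have h2 := f.fn.dt_eval (contDiff_columns hφ f.timeOrder) p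
  rw [h1, JetFn.jet_add (contDiff_columns hl _) (contDiff_columns (smooth_zdot hφ) _)] at h2
  refine h2.trans ?_
  simp only [LocalFn.bigD, LocalFn.lin, JetFn.lin, Pi.add_apply]
  rw [← map_add]
  simp

/-! ### Integrals depending on a parameter -/

section Parametric

open MeasureTheory

variable {X : Type*} [TopologicalSpace X] [MeasurableSpace X] [OpensMeasurableSpace X]

/-- A finite measure carried by a compact set, together with a bounded weight. Integrals over the
region, flux integrals over its boundary and integrals over time intervals are of this kind. -/
structure CompactWeight (μ : Measure X) (w : X → ℝ) : Prop where
  finite : IsFiniteMeasure μ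
  carrier : ∃ K : Set X, IsCompact K ∧ ∀ᵐ x ∂μ, x ∈ K
  measurable : Measurable w
  bound : ∀ x, |w x| ≤ 1

namespace CompactWeight

variable {μ : Measure X} {w : X → ℝ}

theorem restrict {Y : Type*} [TopologicalSpace Y] [MeasurableSpace Y] {w : Y → ℝ}
    {ν : Measure Y} {K : Set Y} (hK : IsCompact K) (hKm : MeasurableSet K)
    (hfin : ν K ≠ ⊤) (hw : Measurable w) (hb : ∀ x, |w x| ≤ 1) :
    CompactWeight (ν.restrict K) w where
  finite := ⟨by rw [Measure.restrict_apply_univ]; exact hfin.lt_top⟩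
  carrier := ⟨K, hK, ae_restrict_mem hKm⟩
  measurable := hw
  bound := hb

theorem integrable (h : CompactWeight μ w) {f : X → ℝ} (hf : Continuous f) :
    Integrable (fun x => f x * w x) μ := by
  obtain ⟨K, hK, hae⟩ := h.carrier
  obtain ⟨C, hC⟩ := hK.exists_bound_of_continuousOn hf.continuousOn
  have := h.finite
  refine Integrable.of_bound
    (hf.aestronglyMeasurable.mul h.measurable.aestronglyMeasurable) C ?_
  filter_upwards [hae] with x hx
  rw [Real.norm_eq_abs, abs_mul]
  calc |f x| * |w x| ≤ |f x| * 1 := mul_le_mul_of_nonneg_left (h.bound x) (abs_nonneg _)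
    _ ≤ C := by rw [mul_one]; exact hC x hx

theorem continuous {P : Type*} [TopologicalSpace P] [FirstCountableTopology P]
    [LocallyCompactSpace P] (h : CompactWeight μ w) {F : P → X → ℝ}
    (hF : Continuous fun q : P × X => F q.1 q.2) :
    Continuous fun p => ∫ x, F p x * w x ∂μ := by
  obtain ⟨K, hK, hae⟩ := h.carrier
  have := h.finite
  rw [continuous_iff_continuousAt]
  intro p
  obtain ⟨U, hU, hUn⟩ := exists_compact_mem_nhds p
  obtain ⟨C, hC⟩ := (hU.prod hK).exists_bound_of_continuousOn hF.continuousOn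
  have hs : ∀ p, Continuous (F p) := fun p => hF.comp (continuous_const.prodMk continuous_id)
  refine continuousAt_of_dominated (bound := fun _ => C) ?_ ?_ (integrable_const C) ?_
  · filter_upwards with q
    exact (hs q).aestronglyMeasurable.mul h.measurable.aestronglyMeasurable
  · filter_upwards [hUn] with q hq
    filter_upwards [hae] with x hx
    rw [Real.norm_eq_abs, abs_mul]
    calc |F q x| * |w x| ≤ |F q x| * 1 := mul_le_mul_of_nonneg_left (h.bound x) (abs_nonneg _)
      _ ≤ C := by rw [mul_one]; exact hC (q, x) ⟨hq, hx⟩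
  · filter_upwards with x
    have h1 : Continuous fun q => F q x := hF.comp (continuous_id.prodMk continuous_const)
    exact (h1.mul continuous_const).continuousAt

theorem hasDerivAt (h : CompactWeight μ w) {F F' : ℝ → X → ℝ}
    (hF : Continuous fun q : ℝ × X => F q.1 q.2) (hF' : Continuous fun q : ℝ × X => F' q.1 q.2)
    (hd : ∀ s x, HasDerivAt (fun s => F s x) (F' s x) s) (s : ℝ) :
    HasDerivAt (fun s => ∫ x, F s x * w x ∂μ) (∫ x, F' s x * w x ∂μ) s := by
  obtain ⟨K, hK, hae⟩ := h.carrier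
  have := h.finite
  obtain ⟨C, hC⟩ := ((isCompact_closedBall s 1).prod hK).exists_bound_of_continuousOn
    hF'.continuousOn
  have hs : ∀ p, Continuous (F p) := fun p => hF.comp (continuous_const.prodMk continuous_id)
  have hs' : ∀ p, Continuous (F' p) := fun p => hF'.comp (continuous_const.prodMk continuous_id)
  refine (hasDerivAt_integral_of_dominated_loc_of_deriv_le (bound := fun _ => C)
    (F := fun s x => F s x * w x) (F' := fun s x => F' s x * w x)
    (Metric.ball_mem_nhds s one_pos) ?_ (h.integrable (hs s)) ?_ ?_ (integrable_const C) ?_).2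
  · filter_upwards with q
    exact (hs q).aestronglyMeasurable.mul h.measurable.aestronglyMeasurable
  · exact (hs' s).aestronglyMeasurable.mul h.measurable.aestronglyMeasurable
  · filter_upwards [hae] with x hx q hq
    rw [Real.norm_eq_abs, abs_mul]
    calc |F' q x| * |w x| ≤ |F' q x| * 1 :=
          mul_le_mul_of_nonneg_left (h.bound x) (abs_nonneg _)
      _ ≤ C := by rw [mul_one]; exact hC (q, x) ⟨Metric.ball_subset_closedBall hq, hx⟩
  · filter_upwards with x q _
    exact (hd q x).mul_const _

end CompactWeight

theorem hasDerivAt_intervalIntegral_param {F F' : ℝ → ℝ → ℝ}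
    (hF : Continuous fun q : ℝ × ℝ => F q.1 q.2) (hF' : Continuous fun q : ℝ × ℝ => F' q.1 q.2)
    (hd : ∀ s t, HasDerivAt (fun s => F s t) (F' s t) s) (a b s : ℝ) :
    HasDerivAt (fun s => ∫ t in a..b, F s t) (∫ t in a..b, F' s t) s := by
  have key : ∀ a b : ℝ, HasDerivAt (fun s => ∫ t in Set.Ioc a b, F s t)
      (∫ t in Set.Ioc a b, F' s t) s := by
    intro a b
    have hw : CompactWeight (volume.restrict (Set.Icc a b)) (fun _ : ℝ => (1 : ℝ)) :=
      CompactWeight.restrict isCompact_Icc measurableSet_Icc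
        isCompact_Icc.measure_lt_top.ne measurable_const (by simp)
    have h := hw.hasDerivAt hF hF' hd s
    simpa only [mul_one, integral_Icc_eq_integral_Ioc] using h
  exact (key a b).sub (key b a)

end Parametric

/-- `∫ f(t, x) w(x) dμ(x)`. -/
def wInt (μ : MeasureTheory.Measure (Space n)) (w : Space n → ℝ) (f : ST n → ℝ) (t : ℝ) : ℝ :=
  ∫ x, f (t, x) * w x ∂μ

section WInt

variable {μ : MeasureTheory.Measure (Space n)} {w : Space n → ℝ}

theorem wInt_add (h : CompactWeight μ w) {f g : ST n → ℝ} (hf : Continuous f)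
    (hg : Continuous g) (t : ℝ) : wInt μ w (f + g) t = wInt μ w f t + wInt μ w g t := by
  unfold wInt
  rw [← MeasureTheory.integral_add (h.integrable (f := fun x => f (t, x)) (by fun_prop))
    (h.integrable (f := fun x => g (t, x)) (by fun_prop))]
  simp only [Pi.add_apply, add_mul]

theorem wInt_smul (a : ℝ) (f : ST n → ℝ) (t : ℝ) :
    wInt μ w (a • f) t = a * wInt μ w f t := by
  unfold wInt
  rw [← MeasureTheory.integral_const_mul]
  simp only [Pi.smul_apply, smul_eq_mul, mul_assoc]

theorem continuous_wInt (h : CompactWeight μ w) {f : ST n → ℝ} (hf : Continuous f) :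
    Continuous (wInt μ w f) :=
  h.continuous (F := fun t x => f (t, x)) hf

theorem continuous_wInt_family (h : CompactWeight μ w) {Φ : ℝ → ST n → ℝ} (hΦ : SF Φ) :
    Continuous fun q : ℝ × ℝ => wInt μ w (Φ q.1) q.2 := by
  have h1 : Continuous fun q : (ℝ × ℝ) × Space n => Φ q.1.1 (q.1.2, q.2) :=
    (ContDiff.continuous hΦ).comp (by fun_prop :
      Continuous fun q : (ℝ × ℝ) × Space n => ((q.1.1, (q.1.2, q.2)) : ℝ × ST n))
  exact h.continuous (F := fun (q : ℝ × ℝ) x => Φ q.1 (q.2, x)) h1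

theorem hasDerivAt_wInt_param (h : CompactWeight μ w) {Φ : ℝ → ST n → ℝ} (hΦ : SF Φ) (s t : ℝ) :
    HasDerivAt (fun s => wInt μ w (Φ s) t) (wInt μ w (ds Φ s) t) s := by
  have hc : Continuous fun q : ℝ × Space n => ((q.1, (t, q.2)) : ℝ × ST n) := by fun_prop
  exact h.hasDerivAt (F := fun s x => Φ s (t, x)) (F' := fun s x => ds Φ s (t, x))
    ((ContDiff.continuous hΦ).comp hc) ((ContDiff.continuous hΦ.ds).comp hc)
    (fun s x => hΦ.hasDerivAt s (t, x)) s

theorem hasDerivAt_wInt_time (h : CompactWeight μ w) {f : ST n → ℝ} (hf : ContDiff ℝ ∞ f)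
    (t : ℝ) : HasDerivAt (wInt μ w f) (wInt μ w (dt f) t) t := by
  refine h.hasDerivAt (F := fun t x => f (t, x)) (F' := fun t x => dt f (t, x))
    hf.continuous (contDiff_dt hf).continuous (fun t x => ?_) t
  exact HasFDerivAt.comp_hasDerivAt (f := fun t : ℝ => ((t, x) : ST n)) t
    (differentiable_of_smooth hf (t, x)).hasFDerivAt
    ((hasDerivAt_id t).prodMk (hasDerivAt_const t x))

end WInt

/-! ### The region and its boundary -/

namespace Region

variable (S : Region n)

/-- The open part `{ρ < 0}` of the region. -/
def core : Set (Space n) := {x | S.ρ x < 0}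

theorem isOpen_core : IsOpen S.core := isOpen_lt S.smooth.continuous continuous_const

theorem core_subset_body : S.core ⊆ S.body := fun _ hx => le_of_lt (Set.mem_ofPred_eq ▸ hx)

theorem bdry_subset_body : S.bdry ⊆ S.body := fun _ hx => le_of_eq (Set.mem_ofPred_eq ▸ hx)

theorem isCompact_body : IsCompact S.body := S.compact

theorem isClosed_bdry : IsClosed S.bdry := isClosed_eq S.smooth.continuous continuous_const

theorem isCompact_bdry : IsCompact S.bdry :=
  S.isCompact_body.of_isClosed_subset S.isClosed_bdry S.bdry_subset_body

theorem measurableSet_body : MeasurableSet S.body := S.isCompact_body.isClosed.measurableSet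

theorem hasGradientAt (x : Space n) : HasGradientAt S.ρ (gradient S.ρ x) x :=
  ((differentiable_of_smooth S.smooth) x).hasGradientAt

theorem body_subset_closure_core : S.body ⊆ closure S.core := by
  intro x hx
  rcases lt_or_eq_of_le (show S.ρ x ≤ 0 from hx) with h | h
  · exact subset_closure h
  · -- moving against the gradient decreases `ρ` at a boundary point
    set g := gradient S.ρ x with hg
    have hg0 : 0 < ‖g‖ := norm_pos_iff.2 (S.regular x h)
    have hl : HasDerivAt (fun s : ℝ => x + s • (-g)) (-g) 0 := by
      have := ((hasDerivAt_id (0 : ℝ)).smul_const (-g)).const_add x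
      simpa using this
    have hf : HasFDerivAt S.ρ (InnerProductSpace.toDual ℝ _ g) (x + (0 : ℝ) • (-g)) := by
      rw [zero_smul, add_zero]
      exact (S.hasGradientAt x).hasFDerivAt
    have hd : HasDerivAt (fun s : ℝ => S.ρ (x + s • (-g))) (-(‖g‖ ^ 2)) 0 := by
      have h1 := hf.comp_hasDerivAt (0 : ℝ) hl
      have h2 : (InnerProductSpace.toDual ℝ (Space n) g) (-g) = -(‖g‖ ^ 2) := by
        rw [InnerProductSpace.toDual_apply_apply, inner_neg_right, real_inner_self_eq_norm_sq]
      rw [h2] at h1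
      exact h1
    have hneg : -(‖g‖ ^ 2) < 0 := by have := pow_pos hg0 2; linarith
    have hev : ∀ᶠ s in nhdsWithin (0 : ℝ) (Set.Ioi 0), S.ρ (x + s • (-g)) < 0 := by
      have h1 := hd.hasDerivWithinAt (s := Set.Ioi (0 : ℝ))
      rw [hasDerivWithinAt_iff_tendsto_slope' (by simp)] at h1
      filter_upwards [h1.eventually (gt_mem_nhds hneg), self_mem_nhdsWithin] with s hs hs0
      have hs0' : (0 : ℝ) < s := hs0
      simp only [slope_def_field, zero_smul, add_zero, h, sub_zero] at hs
      exact (div_neg_iff.1 hs).elim (fun h => absurd hs0' (not_lt.2 h.2.le)) fun h => h.1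
    have ht : Filter.Tendsto (fun s : ℝ => x + s • (-g)) (nhdsWithin (0 : ℝ) (Set.Ioi 0))
        (nhds x) := by
      have h1 := hl.continuousAt.tendsto
      simp only [zero_smul, add_zero] at h1
      exact h1.mono_left nhdsWithin_le_nhds
    exact mem_closure_of_tendsto ht hev

/-- Near a boundary point the orthogonal projection along the gradient embeds the boundary into a
hyperplane, by an antilipschitz map; so the boundary has locally finite area. -/
theorem exists_nhds_hausdorff_lt_top {x : Space n} (hx : x ∈ S.bdry) :
    ∃ U ∈ nhds x, μHE[n - 1] (S.bdry ∩ U) < ⊤ := by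
  set g := gradient S.ρ x with hg
  have hg0 : g ≠ 0 := S.regular x hx
  have hgn : 0 < ‖g‖ := norm_pos_iff.2 hg0
  obtain ⟨k, rfl⟩ : ∃ k, n = k + 1 := by
    cases n with
    | zero => exact absurd (Subsingleton.elim _ _) hg0
    | succ k => exact ⟨k, rfl⟩
  have hfact : Fact (Module.finrank ℝ (Space (k + 1)) = k + 1) := ⟨by simp⟩
  let K : Submodule ℝ (Space (k + 1)) := (Submodule.span ℝ {g})ᗮ
  have hK : Module.finrank ℝ K = k := Submodule.finrank_orthogonal_span_singleton hg0
  have hstrict : HasStrictFDerivAt S.ρ (InnerProductSpace.toDual ℝ _ g) x := by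
    have h1 := (S.smooth.contDiffAt (x := x)).hasStrictFDerivAt (by simp)
    rwa [show fderiv ℝ S.ρ x = InnerProductSpace.toDual ℝ _ g from
      ((S.hasGradientAt x).hasFDerivAt).fderiv] at h1
  obtain ⟨V, hV, happ⟩ := hstrict.approximates_deriv_on_nhds
    (c := (⟨‖g‖ / 2, by positivity⟩ : NNReal)) (Or.inr (NNReal.coe_pos.1 (half_pos hgn)))
  -- with error constant `‖g‖ / 2`, at most half of the difference of two boundary points of `V` is
  -- parallel to `g`, which gives the antilipschitz constant `2`
  let U := V ∩ Metric.closedBall x 1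
  refine ⟨U, Filter.inter_mem hV (Metric.closedBall_mem_nhds x one_pos), ?_⟩
  let s : Set (Space (k + 1)) := S.bdry ∩ U
  let f : s → K := fun y => K.orthogonalProjectionOnto (y : Space (k + 1))
  have hanti : AntilipschitzWith 2 f := by
    refine AntilipschitzWith.of_le_mul_dist fun y z => ?_
    have hy : S.ρ y = 0 := y.2.1
    have hz : S.ρ z = 0 := z.2.1
    have h1 := happ y y.2.2.1 z z.2.2.1
    set v : Space (k + 1) := (y : Space (k + 1)) - z with hv
    rw [hy, hz, sub_zero, zero_sub, norm_neg, InnerProductSpace.toDual_apply_apply] at h1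
    change ‖inner ℝ g v‖ ≤ ‖g‖ / 2 * ‖v‖ at h1
    have h2 : ‖(Submodule.span ℝ {g}).starProjection v‖ ≤ ‖v‖ / 2 := by
      rw [Submodule.starProjection_singleton, norm_smul, norm_div]
      simp only [RCLike.ofReal_real_eq_id, id_eq, norm_pow, norm_norm]
      rw [div_mul_eq_mul_div, div_le_iff₀ (by positivity)]
      nlinarith [norm_nonneg v]
    have h3 : ‖v‖ ≤ ‖(Submodule.span ℝ {g}).starProjection v‖ + ‖K.starProjection v‖ := by
      conv_lhs => rw [← (Submodule.span ℝ {g}).starProjection_add_starProjection_orthogonal v]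
      exact norm_add_le _ _
    have h4 : dist (f y) (f z) = ‖K.starProjection v‖ := by
      rw [dist_eq_norm, ← map_sub]
      rfl
    rw [h4, Subtype.dist_eq, dist_eq_norm, ← hv, NNReal.coe_ofNat]
    linarith
  have h1 : μHE[k] (Set.univ : Set s) ≤
      (2 : ENNReal) ^ (k : ℝ) * μHE[k] (f '' (Set.univ : Set s)) := by
    simp only [MeasureTheory.Measure.euclideanHausdorffMeasure_def,
      MeasureTheory.Measure.smul_apply, ENNReal.smul_def, smul_eq_mul]
    rw [mul_left_comm]
    refine mul_le_mul_right ?_ _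
    exact hanti.le_hausdorffMeasure_image (Nat.cast_nonneg k) _
  have h2 : f '' (Set.univ : Set s) ⊆ K.orthogonalProjectionOnto '' Metric.closedBall x 1 := by
    rintro _ ⟨y, -, rfl⟩
    exact ⟨y, y.2.2.2, rfl⟩
  have h3 : μHE[k] (f '' (Set.univ : Set s)) < ⊤ := by
    refine lt_of_le_of_lt (MeasureTheory.measure_mono h2) ?_
    have h4 : (μHE[k] : MeasureTheory.Measure K).IsAddHaarMeasure := by
      have h5 := MeasureTheory.isAddHaarMeasure_euclideanHausdorffMeasure (E := K)
      rwa [hK] at h5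
    exact ((isCompact_closedBall x 1).image
      K.orthogonalProjectionOnto.continuous).measure_lt_top
  have h4 : μHE[k] s = μHE[k] (Set.univ : Set s) := by
    rw [← (isometry_subtype_coe (s := s)).euclideanHausdorffMeasure_image]
    simp
  rw [Nat.add_sub_cancel]
  change μHE[k] s < ⊤
  rw [h4]
  exact lt_of_le_of_lt h1 (ENNReal.mul_lt_top (by simp) h3)

theorem hausdorff_bdry_lt_top : μHE[n - 1] S.bdry < ⊤ := by
  refine S.isCompact_bdry.induction_on (p := fun s => μHE[n - 1] (s ∩ S.bdry) < ⊤) (by simp)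
    (fun s t hst ht => lt_of_le_of_lt (MeasureTheory.measure_mono
      (Set.inter_subset_inter_left _ hst)) ht) (fun s t hs ht => ?_) (fun x hx => ?_) |> fun h => by
        simpa using h
  · rw [Set.union_inter_distrib_right]
    exact lt_of_le_of_lt (MeasureTheory.measure_union_le _ _) (ENNReal.add_lt_top.2 ⟨hs, ht⟩)
  · obtain ⟨U, hU, h⟩ := S.exists_nhds_hausdorff_lt_top hx
    exact ⟨U, mem_nhdsWithin_of_mem_nhds hU, by rwa [Set.inter_comm]⟩

theorem continuous_gradient : Continuous (gradient S.ρ) :=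
  (InnerProductSpace.toDual ℝ (Space n)).symm.continuous.comp
    (S.smooth.continuous_fderiv (by simp))

theorem compactWeight_bulk :
    CompactWeight (MeasureTheory.volume.restrict S.body) (fun _ => (1 : ℝ)) :=
  CompactWeight.restrict S.isCompact_body S.measurableSet_body
    S.isCompact_body.measure_lt_top.ne measurable_const (by simp)

theorem compactWeight_bdry (i : Fin n) :
    CompactWeight ((μHE[n - 1] : MeasureTheory.Measure (Space n)).restrict S.bdry)
      (fun x => S.normal x i) := by
  refine CompactWeight.restrict S.isCompact_bdry S.isClosed_bdry.measurableSet
    S.hausdorff_bdry_lt_top.ne ?_ fun x => ?_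
  · have h1 : Measurable fun x => gradient S.ρ x i := by
      have := S.continuous_gradient
      exact (by fun_prop : Continuous fun x => gradient S.ρ x i).measurable
    have h2 : Measurable fun x => (‖gradient S.ρ x‖)⁻¹ :=
      S.continuous_gradient.norm.measurable.inv
    exact h2.mul h1
  · have h1 : ‖S.normal x i‖ ≤ ‖S.normal x‖ := PiLp.norm_apply_le _ _
    refine h1.trans ?_
    unfold normal
    rw [norm_smul, norm_inv, norm_norm]
    exact inv_mul_le_one

theorem bulkInt_eq_wInt (f : ST n → ℝ) (t : ℝ) :
    S.bulkInt f t = wInt (MeasureTheory.volume.restrict S.body) (fun _ => (1 : ℝ)) f t := by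
  simp [bulkInt, wInt]

theorem bdryInt_eq_sum {b : Fin n → ST n → ℝ} (hb : ∀ i, Continuous (b i)) (t : ℝ) :
    S.bdryInt b t = ∑ i, wInt ((μHE[n - 1] : MeasureTheory.Measure (Space n)).restrict S.bdry)
      (fun x => S.normal x i) (b i) t := by
  unfold bdryInt wInt
  refine MeasureTheory.integral_finsetSum _ fun i _ => ?_
  have := hb i
  exact (S.compactWeight_bdry i).integrable (f := fun x => b i (t, x)) (by fun_prop)

theorem bulkInt_congr {f g : ST n → ℝ} {t : ℝ} (h : ∀ x ∈ S.body, f (t, x) = g (t, x)) :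
    S.bulkInt f t = S.bulkInt g t :=
  MeasureTheory.setIntegral_congr_fun S.measurableSet_body h

theorem bdryInt_congr {b c : Fin n → ST n → ℝ} {t : ℝ}
    (h : ∀ i, ∀ x ∈ S.bdry, b i (t, x) = c i (t, x)) : S.bdryInt b t = S.bdryInt c t :=
  MeasureTheory.setIntegral_congr_fun S.isClosed_bdry.measurableSet fun x hx => by
    simp only [h _ x hx]

theorem bulkInt_add {f g : ST n → ℝ} (hf : Continuous f) (hg : Continuous g) (t : ℝ) :
    S.bulkInt (f + g) t = S.bulkInt f t + S.bulkInt g t := by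
  simp only [bulkInt_eq_wInt, wInt_add S.compactWeight_bulk hf hg]

theorem bulkInt_smul (a : ℝ) (f : ST n → ℝ) (t : ℝ) :
    S.bulkInt (a • f) t = a * S.bulkInt f t := by
  simp only [bulkInt_eq_wInt, wInt_smul]

theorem bulkInt_sub {f g : ST n → ℝ} (hf : Continuous f) (hg : Continuous g) (t : ℝ) :
    S.bulkInt (f - g) t = S.bulkInt f t - S.bulkInt g t := by
  have h : f - g = f + (-1 : ℝ) • g := by rw [neg_one_smul, sub_eq_add_neg]
  rw [h, S.bulkInt_add hf (hg.const_smul (-1 : ℝ)), bulkInt_smul]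
  ring

theorem bdryInt_add {b c : Fin n → ST n → ℝ} (hb : ∀ i, Continuous (b i))
    (hc : ∀ i, Continuous (c i)) (t : ℝ) :
    S.bdryInt (b + c) t = S.bdryInt b t + S.bdryInt c t := by
  rw [S.bdryInt_eq_sum (b := b + c) (fun i => (hb i).add (hc i)), S.bdryInt_eq_sum hb,
    S.bdryInt_eq_sum hc, ← Finset.sum_add_distrib]
  exact Finset.sum_congr rfl fun i _ => wInt_add (S.compactWeight_bdry i) (hb i) (hc i) t

theorem bdryInt_neg (b : Fin n → ST n → ℝ) (t : ℝ) :
    S.bdryInt (fun i => -b i) t = -S.bdryInt b t := by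
  unfold bdryInt
  rw [← MeasureTheory.integral_neg]
  simp

theorem continuous_bulkInt {f : ST n → ℝ} (hf : Continuous f) : Continuous (S.bulkInt f) := by
  have h : S.bulkInt f = wInt _ _ f := funext fun t => S.bulkInt_eq_wInt f t
  rw [h]; exact continuous_wInt S.compactWeight_bulk hf

theorem continuous_bdryInt {b : Fin n → ST n → ℝ} (hb : ∀ i, Continuous (b i)) :
    Continuous (S.bdryInt b) := by
  rw [show S.bdryInt b = fun t => _ from funext fun t => S.bdryInt_eq_sum hb t]
  exact continuous_finsetSum _ fun i _ => continuous_wInt (S.compactWeight_bdry i) (hb i)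

theorem continuous_bulkInt_family {Φ : ℝ → ST n → ℝ} (hΦ : SF Φ) :
    Continuous fun q : ℝ × ℝ => S.bulkInt (Φ q.1) q.2 := by
  simp only [bulkInt_eq_wInt]
  exact continuous_wInt_family S.compactWeight_bulk hΦ

theorem continuous_bdryInt_family {Φ : Fin n → ℝ → ST n → ℝ} (hΦ : ∀ i, SF (Φ i)) :
    Continuous fun q : ℝ × ℝ => S.bdryInt (fun i => Φ i q.1) q.2 := by
  rw [show (fun q : ℝ × ℝ => S.bdryInt (fun i => Φ i q.1) q.2) = fun q => _ from
    funext fun q => S.bdryInt_eq_sum (fun i => ((hΦ i).slice q.1).continuous) q.2]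
  exact continuous_finsetSum _ fun i _ =>
    continuous_wInt_family (S.compactWeight_bdry i) (hΦ i)

theorem hasDerivAt_bulkInt_param {Φ : ℝ → ST n → ℝ} (hΦ : SF Φ) (s t : ℝ) :
    HasDerivAt (fun s => S.bulkInt (Φ s) t) (S.bulkInt (ds Φ s) t) s := by
  simp only [bulkInt_eq_wInt]
  exact hasDerivAt_wInt_param S.compactWeight_bulk hΦ s t

theorem hasDerivAt_bdryInt_param {Φ : Fin n → ℝ → ST n → ℝ} (hΦ : ∀ i, SF (Φ i)) (s t : ℝ) :
    HasDerivAt (fun s => S.bdryInt (fun i => Φ i s) t)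
      (S.bdryInt (fun i => ds (Φ i) s) t) s := by
  rw [S.bdryInt_eq_sum fun i => ((hΦ i).ds.slice s).continuous,
    show (fun s => S.bdryInt (fun i => Φ i s) t) = fun s => _ from
      funext fun s => S.bdryInt_eq_sum (fun i => ((hΦ i).slice s).continuous) t]
  exact HasDerivAt.fun_sum fun i _ => hasDerivAt_wInt_param (S.compactWeight_bdry i) (hΦ i) s t

theorem hasDerivAt_bulkInt_time {f : ST n → ℝ} (hf : ContDiff ℝ ∞ f) (t : ℝ) :
    HasDerivAt (S.bulkInt f) (S.bulkInt (dt f) t) t := by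
  rw [show S.bulkInt f = wInt _ _ f from funext fun t => S.bulkInt_eq_wInt f t,
    bulkInt_eq_wInt]
  exact hasDerivAt_wInt_time S.compactWeight_bulk hf t

theorem hasDerivAt_bdryInt_time {b : Fin n → ST n → ℝ} (hb : ∀ i, ContDiff ℝ ∞ (b i)) (t : ℝ) :
    HasDerivAt (S.bdryInt b) (S.bdryInt (fun i => dt (b i)) t) t := by
  rw [S.bdryInt_eq_sum fun i => (contDiff_dt (hb i)).continuous,
    show S.bdryInt b = fun t => _ from
      funext fun t => S.bdryInt_eq_sum (fun i => (hb i).continuous) t]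
  exact HasDerivAt.fun_sum fun i _ => hasDerivAt_wInt_time (S.compactWeight_bdry i) (hb i) t

end Region

/-! ### Variations of functionals -/

namespace Functional

variable (S : Region n) (F : Functional n N m)

/-- The variation of `F` at `φ` along `ψ`, as the integral of the linearized densities. -/
def lin (φ ψ : Hist n N m) (t : ℝ) : ℝ :=
  S.bulkInt (F.bulk.lin φ ψ) t + S.bdryInt (fun i => (F.bdry i).lin φ ψ) t

theorem hasDerivAt_val {φ : ℝ → Hist n N m} (hφ : ∀ j, SF fun s => φ s j) (s t : ℝ) :
    HasDerivAt (fun s => F.val S (φ s) t)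
      (F.lin S (φ s) (fun j => ds (fun s => φ s j) s) t) s := by
  have h1 := S.hasDerivAt_bulkInt_param (F.bulk.sf_eval hφ) s t
  have h2 := S.hasDerivAt_bdryInt_param (fun i => (F.bdry i).sf_eval hφ) s t
  simp only [LocalFn.ds_eval _ hφ] at h1 h2
  exact h1.add h2

theorem hasDerivAt_val_affine {φ ψ : Hist n N m} (hφ : Smooth φ) (hψ : Smooth ψ) (s t : ℝ) :
    HasDerivAt (fun s : ℝ => F.val S (φ + s • ψ) t) (F.lin S (φ + s • ψ) ψ t) s := by
  have h := F.hasDerivAt_val S (sf_affine hφ hψ) s t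
  rwa [ds_hist_affine] at h

theorem var_eq_lin {φ ψ : Hist n N m} (hφ : Smooth φ) (hψ : Smooth ψ) (t : ℝ) :
    F.var S φ ψ t = F.lin S φ ψ t := by
  have h := (F.hasDerivAt_val_affine S hφ hψ 0 t).deriv
  rw [zero_smul, add_zero] at h
  exact h

theorem lin_add {φ ψ χ : Hist n N m} (hφ : Smooth φ) (hψ : Smooth ψ) (hχ : Smooth χ) (t : ℝ) :
    F.lin S φ (ψ + χ) t = F.lin S φ ψ t + F.lin S φ χ t := by
  have h1 := S.bdryInt_add (fun i => ((F.bdry i).contDiff_lin hφ hψ).continuous)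
    (fun i => ((F.bdry i).contDiff_lin hφ hχ).continuous) t
  unfold lin
  simp only [LocalFn.lin_add _ hψ hχ]
  rw [S.bulkInt_add (F.bulk.contDiff_lin hφ hψ).continuous
    (F.bulk.contDiff_lin hφ hχ).continuous]
  have h2 : (fun i => (F.bdry i).lin φ ψ + (F.bdry i).lin φ χ) =
    (fun i => (F.bdry i).lin φ ψ) + fun i => (F.bdry i).lin φ χ := rfl
  rw [h2, h1]
  ring

theorem hasDerivAt_val_time {φ : Hist n N m} (hφ : Smooth φ) (t : ℝ) :
    HasDerivAt (F.val S φ) (F.bigD S φ t + F.lin S φ (zdot φ) t) t := by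
  have h1 := S.hasDerivAt_bulkInt_time (F.bulk.contDiff_eval hφ) t
  have h2 := S.hasDerivAt_bdryInt_time (fun i => (F.bdry i).contDiff_eval hφ) t
  rw [LocalFn.dt_eval _ hφ] at h1
  rw [show (fun i => dt ((F.bdry i).eval φ)) = fun i => _ from
    funext fun i => (F.bdry i).dt_eval hφ] at h2
  have h3 : (fun i => (F.bdry i).bigD φ + (F.bdry i).lin φ (zdot φ)) =
    (fun i => (F.bdry i).bigD φ) + fun i => (F.bdry i).lin φ (zdot φ) := rfl
  have hz := smooth_zdot hφ
  rw [S.bulkInt_add (F.bulk.contDiff_bigD hφ).continuous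
    (F.bulk.contDiff_lin hφ hz).continuous] at h1
  rw [h3, S.bdryInt_add (fun i => ((F.bdry i).contDiff_bigD hφ).continuous)
    (fun i => ((F.bdry i).contDiff_lin hφ hz).continuous)] at h2
  exact (h1.add h2).congr_deriv (by simp only [bigD, lin]; ring)

theorem continuous_lin {φ ψ : Hist n N m} (hφ : Smooth φ) (hψ : Smooth ψ) :
    Continuous (F.lin S φ ψ) :=
  (S.continuous_bulkInt (F.bulk.contDiff_lin hφ hψ).continuous).add
    (S.continuous_bdryInt fun i => ((F.bdry i).contDiff_lin hφ hψ).continuous)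

theorem continuous_val_family {φ : ℝ → Hist n N m} (hφ : ∀ j, SF fun s => φ s j) :
    Continuous fun q : ℝ × ℝ => F.val S (φ q.1) q.2 :=
  (S.continuous_bulkInt_family (F.bulk.sf_eval hφ)).add
    (S.continuous_bdryInt_family fun i => (F.bdry i).sf_eval hφ)

theorem continuous_lin_family {φ : ℝ → Hist n N m} (hφ : ∀ j, SF fun s => φ s j) :
    Continuous fun q : ℝ × ℝ =>
      F.lin S (φ q.1) (fun j => ds (fun s => φ s j) q.1) q.2 := by
  have h1 := S.continuous_bulkInt_family (F.bulk.sf_eval hφ).ds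
  have h2 := S.continuous_bdryInt_family fun i => ((F.bdry i).sf_eval hφ).ds
  rw [show ds (fun s => F.bulk.eval (φ s)) = fun s => _ from
    funext fun s => F.bulk.ds_eval hφ s] at h1
  have h3 : ∀ i, ds (fun s => (F.bdry i).eval (φ s)) = fun s => _ :=
    fun i => funext fun s => (F.bdry i).ds_eval hφ s
  simp only [h3] at h2
  exact h1.add h2

end Functional

/-! ### Integration by parts -/

theorem contDiff_sum' {E ι : Type*} [NormedAddCommGroup E] [NormedSpace ℝ E] {s : Finset ι}
    {f : ι → E → ℝ} (hf : ∀ i, ContDiff ℝ ∞ (f i)) : ContDiff ℝ ∞ (∑ i ∈ s, f i) := by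
  have h := ContDiff.sum (s := s) fun i _ => hf i
  convert h using 1
  ext p
  simp

theorem contDiff_mul' {E : Type*} [NormedAddCommGroup E] [NormedSpace ℝ E] {f g : E → ℝ}
    (hf : ContDiff ℝ ∞ f) (hg : ContDiff ℝ ∞ g) : ContDiff ℝ ∞ (f * g) := hf.mul hg

theorem hasFDerivAt_slice {f : ST n → ℝ} (hf : ContDiff ℝ ∞ f) (t : ℝ) (x : Space n) :
    HasFDerivAt (fun x => f (t, x))
      ((fderiv ℝ f (t, x)).comp (ContinuousLinearMap.inr ℝ ℝ (Space n))) x :=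
  HasFDerivAt.comp (g := f) x (differentiable_of_smooth hf (t, x)).hasFDerivAt
    ((hasFDerivAt_const t x).prodMk (hasFDerivAt_id x))

namespace Region

variable (S : Region n)

theorem bulkInt_sum {ι : Type*} (s : Finset ι) {f : ι → ST n → ℝ}
    (hf : ∀ i, ContDiff ℝ ∞ (f i)) (t : ℝ) :
    S.bulkInt (∑ i ∈ s, f i) t = ∑ i ∈ s, S.bulkInt (f i) t := by
  classical
  induction s using Finset.induction_on with
  | empty => simp [bulkInt]
  | insert a s ha ih =>
    rw [Finset.sum_insert ha, Finset.sum_insert ha,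
      S.bulkInt_add (hf a).continuous (contDiff_sum' hf).continuous, ih]

/-- A function that vanishes to infinite order on `∂Σ` stays differentiable when it is replaced by
zero outside `Σ`. -/
theorem hasFDerivAt_indicator {v : ST n → ℝ} (hv : Flat S v) (t : ℝ) (x : Space n) :
    HasFDerivAt (S.body.indicator fun x => v (t, x))
      (S.body.indicator (fun x =>
        (fderiv ℝ v (t, x)).comp (ContinuousLinearMap.inr ℝ ℝ (Space n))) x) x := by
  have hs := hasFDerivAt_slice hv.1 t x
  rcases lt_trichotomy (S.ρ x) 0 with h | h | h
  · rw [Set.indicator_of_mem (S.core_subset_body h)]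
    refine hs.congr_of_eventuallyEq ?_
    filter_upwards [S.isOpen_core.mem_nhds h] with y hy
    rw [Set.indicator_of_mem (S.core_subset_body hy)]
  · rw [Set.indicator_of_mem (S.bdry_subset_body h)]
    have h0 : (fderiv ℝ v (t, x)).comp (ContinuousLinearMap.inr ℝ ℝ (Space n)) = 0 := by
      refine ContinuousLinearMap.coe_injective ((EuclideanSpace.basisFun (Fin n) ℝ).toBasis.ext
        fun i => ?_)
      have := (hv.dx i).apply_eq_zero t h
      simpa [dx] using this
    rw [h0] at hs ⊢
    have hv0 : v (t, x) = 0 := hv.apply_eq_zero t h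
    rw [hasFDerivAt_iff_isLittleO_nhds_zero] at hs ⊢
    refine (Asymptotics.IsBigO.of_bound 1 (Filter.Eventually.of_forall fun y => ?_)).trans_isLittleO
      hs
    by_cases hy : x + y ∈ S.body
    · simp [Set.indicator_of_mem hy, Set.indicator_of_mem (S.bdry_subset_body h)]
    · simp [Set.indicator_of_notMem hy, Set.indicator_of_mem (S.bdry_subset_body h), hv0]
  · have hx : x ∉ S.body := fun hx => absurd h (not_lt.2 hx)
    rw [Set.indicator_of_notMem hx]
    refine (hasFDerivAt_const (0 : ℝ) x).congr_of_eventuallyEq ?_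
    filter_upwards [(isOpen_lt continuous_const S.smooth.continuous).mem_nhds h] with y hy
    have hy' : y ∉ S.body := fun hy' => absurd hy (not_lt.2 hy')
    exact Set.indicator_of_notMem hy' _

/-- Integration by parts over `Σ`. As `v` is flat on the boundary it may be extended by zero, and no
Gauss theorem for `Σ` is needed. -/
theorem bulkInt_mul_dx {g v : ST n → ℝ} (hg : ContDiff ℝ ∞ g) (hv : Flat S v) (i : Fin n)
    (t : ℝ) : S.bulkInt (g * dx i v) t = -S.bulkInt (dx i g * v) t := by
  set e : Space n := EuclideanSpace.single i 1 with he
  set V : Space n → ℝ := S.body.indicator fun x => v (t, x) with hV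
  have hVd : ∀ x, fderiv ℝ V x e = S.body.indicator (fun x => dx i v (t, x)) x := by
    intro x
    rw [(S.hasFDerivAt_indicator hv t x).fderiv]
    by_cases hx : x ∈ S.body
    · simp [Set.indicator_of_mem hx, dx, he]
    · simp [Set.indicator_of_notMem hx]
  have hgd : ∀ x, fderiv ℝ (fun x => g (t, x)) x e = dx i g (t, x) := by
    intro x
    rw [(hasFDerivAt_slice hg t x).fderiv]
    simp [dx, he]
  have hint : ∀ {a b : ST n → ℝ}, Continuous a → Continuous b → MeasureTheory.Integrable
      (fun x => a (t, x) * S.body.indicator (fun x => b (t, x)) x) := by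
    intro a b ha hb
    have h1 : (fun x => a (t, x) * S.body.indicator (fun x => b (t, x)) x) =
        S.body.indicator fun x => a (t, x) * b (t, x) := by
      ext x
      by_cases hx : x ∈ S.body
      · simp [Set.indicator_of_mem hx]
      · simp [Set.indicator_of_notMem hx]
    rw [h1, MeasureTheory.integrable_indicator_iff S.measurableSet_body]
    exact ContinuousOn.integrableOn_compact S.isCompact_body (by fun_prop)
  have key := integral_mul_fderiv_eq_neg_fderiv_mul_of_integrable
    (μ := MeasureTheory.volume) (f := fun x => g (t, x)) (g := V) (v := e)
    (by simp only [hgd]; exact hint (contDiff_dx hg i).continuous hv.1.continuous)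
    (by simp only [hVd]; exact hint hg.continuous (contDiff_dx hv.1 i).continuous)
    (hint hg.continuous hv.1.continuous)
    (fun x _ => (hasFDerivAt_slice hg t x).differentiableAt)
    (fun x _ => (S.hasFDerivAt_indicator hv t x).differentiableAt)
  simp only [hgd, hVd] at key
  have hred : ∀ a b : ST n → ℝ, ∫ x, a (t, x) * S.body.indicator (fun x => b (t, x)) x =
      S.bulkInt (a * b) t := by
    intro a b
    unfold bulkInt
    rw [← MeasureTheory.integral_indicator S.measurableSet_body]
    refine MeasureTheory.integral_congr_ae (Filter.Eventually.of_forall fun x => ?_)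
    by_cases hx : x ∈ S.body
    · simp [Set.indicator_of_mem hx]
    · simp [Set.indicator_of_notMem hx]
  rwa [hV, hred, hred] at key

theorem bulkInt_mul_dList {g v : ST n → ℝ} (hg : ContDiff ℝ ∞ g) (hv : Flat S v)
    (l : List (Fin n)) (t : ℝ) :
    S.bulkInt (g * dList l v) t = (-1) ^ l.length * S.bulkInt (dList l g * v) t := by
  induction l generalizing g with
  | nil => simp
  | cons i l ih =>
    rw [dList_cons, S.bulkInt_mul_dx hg (hv.dList l), ih (contDiff_dx hg i), dx_eq_dd,
      dList_dd_comm hg, List.length_cons, pow_succ, dList_cons, dx_eq_dd]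
    ring

theorem bulkInt_mul_dMulti {g v : ST n → ℝ} (hg : ContDiff ℝ ∞ g) (hv : Flat S v)
    (α : Fin n → ℕ) (t : ℝ) :
    S.bulkInt (g * dMulti α v) t = (-1) ^ (∑ i, α i) * S.bulkInt (dMulti α g * v) t := by
  rw [dMulti_eq_dList, dMulti_eq_dList, S.bulkInt_mul_dList hg hv, length_miList]

end Region

/-- The linearization of a local function is dual to its Euler-Lagrange derivative, up to boundary
terms that vanish for flat arguments. -/
theorem JetFn.bulkInt_lin (S : Region n) {J : Type} [Fintype J] {r : ℕ} (f : JetFn n J r)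
    {u v : J → ST n → ℝ} (hu : ∀ j, ContDiff ℝ ∞ (u j)) (hv : ∀ j, Flat S (v j)) (t : ℝ) :
    S.bulkInt (f.lin u v) t = S.bulkInt (fun p => ∑ j, f.euler u j p * v j p) t := by
  have h1 : f.lin u v = ∑ j, ∑ α : MI n r, f.jetDeriv u j α * dMulti α.toNat (v j) := by
    ext p; simp [f.lin_eq_sum]
  have h2 : (fun p => ∑ j, f.euler u j p * v j p) =
      ∑ j, ∑ α : MI n r, ((-1 : ℝ) ^ (∑ i, α.toNat i)) •
        (dMulti α.toNat (f.jetDeriv u j α) * v j) := by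
    ext p
    simp [euler, Finset.sum_mul, mul_assoc]
  have hj := fun j α => f.contDiff_jetDeriv hu j α
  have hs1 : ∀ j, ∀ α : MI n r, ContDiff ℝ ∞ (f.jetDeriv u j α * dMulti α.toNat (v j)) :=
    fun j α => contDiff_mul' (hj j α) (contDiff_dMulti (hv j).1 _)
  have hs2 : ∀ j, ∀ α : MI n r, ContDiff ℝ ∞ (((-1 : ℝ) ^ (∑ i, α.toNat i)) •
      (dMulti α.toNat (f.jetDeriv u j α) * v j)) :=
    fun j α => contDiff_const.mul ((contDiff_dMulti (hj j α) _).mul (hv j).1)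
  rw [h1, h2, S.bulkInt_sum _ fun j => contDiff_sum' (hs1 j),
    S.bulkInt_sum _ fun j => contDiff_sum' (hs2 j)]
  refine Finset.sum_congr rfl fun j _ => ?_
  rw [S.bulkInt_sum _ (hs1 j), S.bulkInt_sum _ (hs2 j)]
  refine Finset.sum_congr rfl fun α _ => ?_
  rw [S.bulkInt_mul_dMulti (hj j α) (hv j), S.bulkInt_smul]

/-- Histories and variations all of whose components are flat on the boundary. -/
def FlatHist (S : Region n) (ψ : Hist n N m) : Prop := ∀ j, Flat S (ψ j)

theorem FlatHist.smooth {S : Region n} {ψ : Hist n N m} (h : FlatHist S ψ) : Smooth ψ :=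
  fun j => (h j).1

theorem FlatHist.columns {S : Region n} {ψ : Hist n N m} (h : FlatHist S ψ) (k : ℕ) :
    ∀ j, Flat S (columns k ψ j) := by
  rintro (A | q)
  · exact h _
  · exact (h _).iterate_dt _

theorem LocalFn.lin_eq_zero_of_flat {S : Region n} (f : LocalFn n N m) (φ : Hist n N m)
    {ψ : Hist n N m} (hψ : FlatHist S ψ) (t : ℝ) {x : Space n} (hx : x ∈ S.bdry) :
    f.lin φ ψ (t, x) = 0 := by
  have h : JetFn.jet f.order (GaugeField.columns f.timeOrder ψ) (t, x) = 0 := by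
    ext q
    exact (hψ.columns f.timeOrder q.1).2 _ t x hx
  simp only [LocalFn.lin, JetFn.lin, h]
  rw [← Prod.zero_eq_mk, map_zero]

/-- Flat variations contribute no boundary terms. -/
theorem Functional.lin_eq_bulkVar {S : Region n} (F : Functional n N m) {φ ψ : Hist n N m}
    (hφ : Smooth φ) (hψ : FlatHist S ψ) (t : ℝ) : F.lin S φ ψ t = F.bulkVar S φ ψ t := by
  have h1 : S.bdryInt (fun i => (F.bdry i).lin φ ψ) t = 0 := by
    rw [S.bdryInt_congr (c := fun _ _ => 0)
      fun i x hx => (F.bdry i).lin_eq_zero_of_flat φ hψ t hx]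
    simp [Region.bdryInt]
  unfold lin bulkVar
  rw [h1, add_zero]
  exact F.bulk.fn.bulkInt_lin S (contDiff_columns hφ _) (hψ.columns _) t

/-! ### Integration over a time interval -/

namespace Region

variable (S : Region n)

/-- The integral over `Σ` and over a time interval. -/
def timeInt (t₀ t₁ : ℝ) (f : ST n → ℝ) : ℝ := ∫ t in t₀..t₁, S.bulkInt f t

variable (t₀ t₁ : ℝ)

theorem timeInt_add {f g : ST n → ℝ} (hf : Continuous f) (hg : Continuous g) :
    S.timeInt t₀ t₁ (f + g) = S.timeInt t₀ t₁ f + S.timeInt t₀ t₁ g := by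
  unfold timeInt
  simp only [S.bulkInt_add hf hg]
  exact intervalIntegral.integral_add ((S.continuous_bulkInt hf).intervalIntegrable _ _)
    ((S.continuous_bulkInt hg).intervalIntegrable _ _)

theorem timeInt_smul (a : ℝ) (f : ST n → ℝ) :
    S.timeInt t₀ t₁ (a • f) = a * S.timeInt t₀ t₁ f := by
  unfold timeInt
  simp only [S.bulkInt_smul]
  exact intervalIntegral.integral_const_mul _ _

theorem timeInt_sum {ι : Type*} (s : Finset ι) {f : ι → ST n → ℝ}
    (hf : ∀ i, ContDiff ℝ ∞ (f i)) :
    S.timeInt t₀ t₁ (∑ i ∈ s, f i) = ∑ i ∈ s, S.timeInt t₀ t₁ (f i) := by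
  classical
  induction s using Finset.induction_on with
  | empty => simp [timeInt, bulkInt]
  | insert a s ha ih =>
    rw [Finset.sum_insert ha, Finset.sum_insert ha,
      S.timeInt_add _ _ (hf a).continuous (contDiff_sum' hf).continuous, ih]

/-- Functions that vanish near the times `t₀` and `t₁`. -/
def EndsVanish (t₀ t₁ : ℝ) (v : ST n → ℝ) : Prop :=
  ∀ x, v =ᶠ[nhds (t₀, x)] 0 ∧ v =ᶠ[nhds (t₁, x)] 0

variable {t₀ t₁}

theorem EndsVanish.dt {v : ST n → ℝ} (hv : EndsVanish t₀ t₁ v) : EndsVanish t₀ t₁ (dt v) := by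
  have key : ∀ p : ST n, v =ᶠ[nhds p] 0 → GaugeField.dt v =ᶠ[nhds p] 0 := by
    intro p h
    have h1 := dd_congr h (vt n)
    rwa [dd_zero] at h1
  exact fun x => ⟨key _ (hv x).1, key _ (hv x).2⟩

theorem timeInt_mul_dt {g v : ST n → ℝ} (hg : ContDiff ℝ ∞ g) (hv : ContDiff ℝ ∞ v)
    (h : EndsVanish t₀ t₁ v) :
    S.timeInt t₀ t₁ (g * dt v) = -S.timeInt t₀ t₁ (dt g * v) := by
  have h1 : S.timeInt t₀ t₁ (dt (g * v)) = 0 := by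
    have hz : ∀ t, (∀ x, v (t, x) = 0) → S.bulkInt (g * v) t = 0 := by
      intro t ht
      simp [bulkInt, ht]
    unfold timeInt
    rw [intervalIntegral.integral_eq_sub_of_hasDerivAt
      (fun t _ => S.hasDerivAt_bulkInt_time (contDiff_mul' hg hv) t)
      ((S.continuous_bulkInt (contDiff_dt (contDiff_mul' hg hv)).continuous).intervalIntegrable _ _),
      hz _ fun x => (h x).2.eq_of_nhds, hz _ fun x => (h x).1.eq_of_nhds, sub_zero]
  have h2 : dt (g * v) = dt g * v + g * dt v := dd_mul hg hv _
  rw [h2, S.timeInt_add _ _ (contDiff_mul' (contDiff_dt hg) hv).continuous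
    (contDiff_mul' hg (contDiff_dt hv)).continuous] at h1
  linarith

theorem timeInt_mul_iterate_dt {g v : ST n → ℝ} (hg : ContDiff ℝ ∞ g) (hv : ContDiff ℝ ∞ v)
    (h : EndsVanish t₀ t₁ v) (k : ℕ) :
    S.timeInt t₀ t₁ (g * dt^[k] v) = (-1) ^ k * S.timeInt t₀ t₁ (dt^[k] g * v) := by
  induction k generalizing v with
  | zero => simp
  | succ k ih =>
    rw [Function.iterate_succ_apply, ih (contDiff_dt hv) h.dt,
      S.timeInt_mul_dt (contDiff_iterate_dt hg k) hv h, Function.iterate_succ_apply', pow_succ]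
    ring

end Region

/-- The formal adjoint of the linearization of a local function, applied to a function that is flat
on the boundary, is again flat on the boundary. -/
theorem LocalFn.exists_flat_adjoint (S : Region n) (f : LocalFn n N m) {φ : Hist n N m}
    (hφ : Smooth φ) {E : ST n → ℝ} (hE : Flat S E) :
    ∃ P : Hist n N m, FlatHist S P ∧ ∀ (t₀ t₁ : ℝ) (ψ : Hist n N m), Smooth ψ →
      (∀ j, Region.EndsVanish t₀ t₁ (ψ j)) →
      S.timeInt t₀ t₁ (E * f.lin φ ψ) = S.timeInt t₀ t₁ (∑ j, P j * ψ j) := by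
  have hu := contDiff_columns hφ f.timeOrder
  have hj := fun j α => f.fn.contDiff_jetDeriv hu j α
  have hjE : ∀ j α, Flat S (f.fn.jetDeriv (GaugeField.columns f.timeOrder φ) j α * E) :=
    fun j α => hE.mul_left (hj j α)
  -- the adjoint in the space directions, one function for each column
  let R : Fin N ⊕ Fin m × Fin (f.timeOrder + 1) → ST n → ℝ := fun j =>
    ∑ α : MI n f.order, ((-1 : ℝ) ^ (∑ i, α.toNat i)) •
      dMulti α.toNat (f.fn.jetDeriv (GaugeField.columns f.timeOrder φ) j α * E)
  have hR : ∀ j, Flat S (R j) := fun j =>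
    Flat.sum _ fun α => ((hjE j α).dMulti _).const_smul _
  have hspace : ∀ (ψ : Hist n N m) (t : ℝ), Smooth ψ →
      S.bulkInt (E * f.lin φ ψ) t =
        S.bulkInt (∑ j, R j * GaugeField.columns f.timeOrder ψ j) t := by
    intro ψ t hψ
    have hc := contDiff_columns hψ f.timeOrder
    have h1 : E * f.lin φ ψ = ∑ j, ∑ α : MI n f.order,
        (f.fn.jetDeriv (GaugeField.columns f.timeOrder φ) j α * E) *
          dMulti α.toNat (GaugeField.columns f.timeOrder ψ j) := by
      ext p
      simp only [LocalFn.lin, f.fn.lin_eq_sum, Pi.mul_apply, Finset.sum_apply, Finset.mul_sum]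
      exact Finset.sum_congr rfl fun j _ => Finset.sum_congr rfl fun α _ => by ring
    have hs : ∀ j, ∀ α : MI n f.order, ContDiff ℝ ∞
        ((f.fn.jetDeriv (GaugeField.columns f.timeOrder φ) j α * E) *
          dMulti α.toNat (GaugeField.columns f.timeOrder ψ j)) :=
      fun j α => contDiff_mul' (hjE j α).1 (contDiff_dMulti (hc j) _)
    rw [h1, S.bulkInt_sum _ fun j => contDiff_sum' (hs j),
      S.bulkInt_sum _ fun j => contDiff_mul' (hR j).1 (hc j)]
    refine Finset.sum_congr rfl fun j _ => ?_
    have hs' : ∀ α : MI n f.order, ContDiff ℝ ∞ ((((-1 : ℝ) ^ (∑ i, α.toNat i)) •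
        dMulti α.toNat (f.fn.jetDeriv (GaugeField.columns f.timeOrder φ) j α * E)) *
          GaugeField.columns f.timeOrder ψ j) :=
      fun α => contDiff_mul' (((hjE j α).dMulti _).const_smul _).1 (hc j)
    simp only [R, Finset.sum_mul]
    rw [S.bulkInt_sum _ (hs j), S.bulkInt_sum _ hs']
    refine Finset.sum_congr rfl fun α _ => ?_
    -- here the flat factor is the one that is not differentiated
    have h2 := S.bulkInt_mul_dMulti (hc j) (hjE j α) α.toNat t
    rw [mul_comm (dMulti α.toNat (GaugeField.columns f.timeOrder ψ j))] at h2
    rw [smul_mul_assoc, S.bulkInt_smul, mul_comm (dMulti α.toNat _), h2, ← mul_assoc, ← mul_pow]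
    simp
  refine ⟨Sum.elim (fun A => R (Sum.inl A)) fun a =>
    ∑ l : Fin (f.timeOrder + 1), ((-1 : ℝ) ^ (l : ℕ)) • dt^[(l : ℕ)] (R (Sum.inr (a, l))), ?_, ?_⟩
  · rintro (A | a)
    · exact hR _
    · exact Flat.sum _ fun l => ((hR _).iterate_dt _).const_smul _
  · intro t₀ t₁ ψ hψ hends
    have hc := contDiff_columns hψ f.timeOrder
    have h1 : S.timeInt t₀ t₁ (E * f.lin φ ψ) =
        S.timeInt t₀ t₁ (∑ j, R j * GaugeField.columns f.timeOrder ψ j) := by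
      unfold Region.timeInt
      simp only [hspace ψ _ hψ]
    rw [h1, S.timeInt_sum _ _ _ fun j => contDiff_mul' (hR j).1 (hc j), S.timeInt_sum]
    · rw [Fintype.sum_sum_type, Fintype.sum_sum_type, Fintype.sum_prod_type]
      refine congrArg₂ (· + ·) rfl (Finset.sum_congr rfl fun a _ => ?_)
      simp only [Sum.elim_inr, Finset.sum_mul]
      rw [S.timeInt_sum _ _ _ fun l =>
        contDiff_mul' (((hR (Sum.inr (a, l))).iterate_dt l).const_smul _).1 (hψ (Sum.inr a))]
      refine Finset.sum_congr rfl fun l _ => ?_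
      rw [smul_mul_assoc, S.timeInt_smul,
        ← S.timeInt_mul_iterate_dt (hR _).1 (hψ _) (hends _)]
      rfl
    · rintro (A | a)
      · exact (hR _).1.mul (hψ _)
      · exact (Flat.sum (S := S) _ fun l => ((hR _).iterate_dt _).const_smul _).1.mul (hψ _)

/-! ### Functions that vanish on the region -/

/-- A smooth function that vanishes on `Σ` at all times has the same property for its derivatives,
as `Σ` is the closure of its open part. -/
theorem dd_eq_zero_on_body {S : Region n} {f : ST n → ℝ} (hf : ContDiff ℝ ∞ f)
    (h : ∀ t, ∀ x ∈ S.body, f (t, x) = 0) (v : ST n) :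
    ∀ t, ∀ x ∈ S.body, dd v f (t, x) = 0 := by
  intro t x hx
  have hcore : ∀ y ∈ S.core, dd v f (t, y) = 0 := by
    intro y hy
    have h1 : f =ᶠ[nhds (t, y)] 0 := by
      have h2 : Prod.snd ⁻¹' S.core ∈ nhds ((t, y) : ST n) :=
        continuous_snd.continuousAt.preimage_mem_nhds (S.isOpen_core.mem_nhds hy)
      filter_upwards [h2] with q hq
      exact h q.1 q.2 (S.core_subset_body hq)
    have h3 := (dd_congr h1 v).eq_of_nhds
    rwa [dd_zero] at h3
  have hcl : IsClosed {y | dd v f (t, y) = 0} :=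
    isClosed_eq ((contDiff_dd hf v).continuous.comp (by fun_prop)) continuous_const
  exact hcl.closure_subset_iff.2 hcore (S.body_subset_closure_core hx)

theorem dMulti_eq_zero_on_body {S : Region n} {f : ST n → ℝ} (hf : ContDiff ℝ ∞ f)
    (h : ∀ t, ∀ x ∈ S.body, f (t, x) = 0) (α : Fin n → ℕ) :
    ∀ t, ∀ x ∈ S.body, dMulti α f (t, x) = 0 := by
  rw [dMulti_eq_dList]
  induction miList α with
  | nil => exact h
  | cons i l ih => exact dd_eq_zero_on_body (contDiff_dList hf l) ih _

theorem columns_eq_zero_on_body {S : Region n} {ψ : Hist n N m} (hψ : Smooth ψ)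
    (h : ∀ j t, ∀ x ∈ S.body, ψ j (t, x) = 0) (k : ℕ) :
    ∀ j t, ∀ x ∈ S.body, columns k ψ j (t, x) = 0 := by
  rintro (A | ⟨a, l⟩)
  · exact h _
  · simp only [columns, Sum.elim_inr]
    induction (l : ℕ) with
    | zero => exact h _
    | succ l ih =>
      rw [Function.iterate_succ_apply']
      exact dd_eq_zero_on_body (contDiff_iterate_dt (hψ _) l) ih _

theorem LocalFn.lin_eq_zero_on_body {S : Region n} (f : LocalFn n N m) (φ : Hist n N m)
    {ψ : Hist n N m} (hψ : Smooth ψ) (h : ∀ j t, ∀ x ∈ S.body, ψ j (t, x) = 0) (t : ℝ)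
    {x : Space n} (hx : x ∈ S.body) : f.lin φ ψ (t, x) = 0 := by
  have h1 : JetFn.jet f.order (columns f.timeOrder ψ) (t, x) = 0 := by
    ext q
    exact dMulti_eq_zero_on_body (contDiff_columns hψ _ q.1)
      (columns_eq_zero_on_body hψ h _ q.1) _ t x hx
  simp only [LocalFn.lin, JetFn.lin, h1]
  rw [← Prod.zero_eq_mk, map_zero]

namespace Functional

variable (S : Region n) (F G : Functional n N m)

/-- The variation of a functional depends only on the restriction of the variation to `Σ`. -/
theorem lin_congr {φ ψ χ : Hist n N m} (hφ : Smooth φ) (hψ : Smooth ψ) (hχ : Smooth χ)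
    (h : ∀ j t, ∀ x ∈ S.body, ψ j (t, x) = χ j (t, x)) (t : ℝ) :
    F.lin S φ ψ t = F.lin S φ χ t := by
  have hd : Smooth (ψ - χ) := fun j => (hψ j).sub (hχ j)
  have h0 : ∀ j t, ∀ x ∈ S.body, (ψ - χ) j (t, x) = 0 := fun j t x hx => by
    simp [h j t x hx]
  have h1 : F.lin S φ (ψ - χ) t = 0 := by
    unfold lin
    rw [S.bulkInt_congr (g := 0) fun x hx => F.bulk.lin_eq_zero_on_body φ hd h0 t hx,
      S.bdryInt_congr (c := fun _ _ => 0) fun i x hx =>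
        (F.bdry i).lin_eq_zero_on_body φ hd h0 t (S.bdry_subset_body hx)]
    simp [Region.bulkInt, Region.bdryInt]
  have h2 := F.lin_add S hφ hd hχ t
  rw [sub_add_cancel, h1, zero_add] at h2
  exact h2

theorem contDiff_eulerZ {φ : Hist n N m} (hφ : Smooth φ) (A : Fin N) :
    ContDiff ℝ ∞ (F.eulerZ φ A) :=
  F.bulk.fn.contDiff_euler (contDiff_columns hφ _) _

theorem smooth_hamZ (σ : Matrix (Fin N) (Fin N) ℝ) {φ : Hist n N m} (hφ : Smooth φ) :
    Smooth (F.hamZ σ φ) := by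
  rintro (A | a)
  · exact (ContDiff.sum fun B _ => contDiff_const.mul (F.contDiff_eulerZ hφ B) :
      ContDiff ℝ ∞ fun p => ∑ B, σ A B * F.eulerZ φ B p)
  · exact contDiff_const

/-- The bulk part of a variation of the canonical fields alone. -/
theorem bulkVar_elim (φ : Hist n N m) (u : Fin N → ST n → ℝ) (t : ℝ) :
    F.bulkVar S φ (Sum.elim u 0) t =
      S.bulkInt (fun p => ∑ A, F.eulerZ φ A p * u A p) t := by
  unfold bulkVar
  congr 1
  ext p
  rw [Fintype.sum_sum_type]
  simp [columns, eulerZ]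

theorem bulkVar_add {φ ψ χ : Hist n N m} (hφ : Smooth φ) (hψ : Smooth ψ) (hχ : Smooth χ)
    (t : ℝ) : F.bulkVar S φ (ψ + χ) t = F.bulkVar S φ ψ t + F.bulkVar S φ χ t := by
  have hs : ∀ {ψ : Hist n N m}, Smooth ψ → ContDiff ℝ ∞ (fun p =>
      ∑ j, F.bulk.fn.euler (columns F.bulk.timeOrder φ) j p * columns F.bulk.timeOrder ψ j p) :=
    fun hψ => ContDiff.sum fun j _ =>
      (F.bulk.fn.contDiff_euler (contDiff_columns hφ _) j).mul (contDiff_columns hψ _ j)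
  unfold bulkVar
  rw [← S.bulkInt_add (hs hψ).continuous (hs hχ).continuous]
  congr 1
  ext p
  rw [columns_add hψ hχ]
  simp [mul_add, Finset.sum_add_distrib]

/-- The boundary part of the variation of a functional is the same for two variations that differ
by one that is flat on the boundary. -/
theorem lin_sub_bulkVar_congr {φ ψ χ : Hist n N m} (hφ : Smooth φ) (hχ : Smooth χ)
    (h : FlatHist S (ψ - χ)) (t : ℝ) :
    F.lin S φ ψ t - F.bulkVar S φ ψ t = F.lin S φ χ t - F.bulkVar S φ χ t := by
  have h1 := F.lin_add S hφ h.smooth hχ t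
  have h2 := F.bulkVar_add S hφ h.smooth hχ t
  have h3 := F.lin_eq_bulkVar hφ h t
  rw [sub_add_cancel] at h1 h2
  rw [h1, h2, h3]
  ring

end Functional

/-! ### The Hamiltonian and the action -/

theorem JetFn.jetDeriv_apply {J : Type} [Fintype J] {r : ℕ} [DecidableEq (J × MI n r)]
    (f : JetFn n J r) (u : J → ST n → ℝ) (j : J) (α : MI n r) (p : ST n) :
    f.jetDeriv u j α p = fderiv ℝ f.toFun (p, jet r u p) (0, Pi.single (j, α) 1) := by
  simp only [jetDeriv]
  congr!

namespace Theory

variable (T : Theory n N m c) (S : Region n)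

/-- `δH/δλ^a = φ_a`, as the density of `H` is affine in `λ` and contains no derivatives of `λ`. -/
theorem ham_euler_multiplier (φ : Hist n N m) (a : Fin m) :
    T.ham.bulk.fn.euler (columns T.ham.bulk.timeOrder φ) (Sum.inr (a, 0)) =
      T.constrVal a φ := by
  classical
  have hj : ∀ α : MI n T.order,
      T.ham.bulk.fn.jetDeriv (columns T.ham.bulk.timeOrder φ) (Sum.inr (a, 0)) α =
        if α = 0 then T.constrVal a φ else 0 := by
    intro α
    ext p
    set q : ST n × ((Fin N ⊕ Fin m × Fin (0 + 1)) × MI n T.order → ℝ) :=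
      (p, JetFn.jet T.order (columns 0 φ) p) with hq
    set v : ST n × ((Fin N ⊕ Fin m × Fin (0 + 1)) × MI n T.order → ℝ) :=
      (0, Pi.single (Sum.inr (a, 0), α) 1) with hv
    have h1 : T.ham.bulk.fn.jetDeriv (columns T.ham.bulk.timeOrder φ) (Sum.inr (a, 0)) α p =
        fderiv ℝ T.ham.bulk.fn.toFun q v :=
      JetFn.jetDeriv_apply (J := Fin N ⊕ Fin m × Fin (0 + 1)) (r := T.order)
        T.ham.bulk.fn (columns 0 φ) (Sum.inr (a, 0)) α p
    -- along the line `q + s v` the density is affine in `s`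
    have hline : ∀ s : ℝ, T.ham.bulk.fn.toFun (q + s • v) =
        T.ham.bulk.fn.toFun q + s * (if α = 0 then T.constrVal a φ p else 0) := by
      intro s
      have hrel : ∀ f : JetFn n (Fin N) T.order,
          (f.relabel (Sum.inl : Fin N → Fin N ⊕ Fin m × Fin (0 + 1))).toFun (q + s • v) =
            f.eval (fun A => φ (Sum.inl A)) p := by
        intro f
        have h2 : (q + s • v).1 = p := by simp [hq, hv]
        have h3 : ∀ A (β : MI n T.order), (q + s • v).2 (Sum.inl A, β) =
            dMulti β.toNat (φ (Sum.inl A)) p := by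
          intro A β
          simp [hq, hv, JetFn.jet, columns]
        simp only [JetFn.relabel, JetFn.eval, h2, h3]
        rfl
      have hrel0 : ∀ f : JetFn n (Fin N) T.order,
          (f.relabel (Sum.inl : Fin N → Fin N ⊕ Fin m × Fin (0 + 1))).toFun q =
            f.eval (fun A => φ (Sum.inl A)) p := fun f => rfl
      have hval : ∀ b : Fin m, (q + s • v).2 (Sum.inr (b, 0), 0) =
          q.2 (Sum.inr (b, 0), 0) + s * (if b = a ∧ α = 0 then 1 else 0) := by
        intro b
        simp only [hv, Prod.snd_add, Prod.smul_snd, Pi.add_apply, Pi.smul_apply, smul_eq_mul,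
          Pi.single_apply, Prod.mk.injEq, Sum.inr.injEq, and_true, eq_comm (a := (0 : MI n T.order))]
      simp only [ham, hrel, hrel0, hval, add_mul, Finset.sum_add_distrib]
      rw [add_assoc]
      congr 2
      by_cases h0 : α = 0
      · simp [h0, constrVal]
      · simp [h0]
    have hl : HasDerivAt (fun s : ℝ => q + s • v) v 0 := by
      have := ((hasDerivAt_id (0 : ℝ)).smul_const v).const_add q
      simpa using this
    have hd : HasFDerivAt T.ham.bulk.fn.toFun (fderiv ℝ T.ham.bulk.fn.toFun q)
        (q + (0 : ℝ) • v) := by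
      rw [zero_smul, add_zero]
      exact (differentiable_of_smooth T.ham.bulk.fn.smooth q).hasFDerivAt
    have h2 := hd.comp_hasDerivAt (0 : ℝ) hl
    have h3 : HasDerivAt (fun s : ℝ => T.ham.bulk.fn.toFun (q + s • v))
        (1 * (if α = 0 then T.constrVal a φ p else 0)) 0 := by
      simp only [hline]
      exact ((hasDerivAt_id (0 : ℝ)).mul_const _).const_add _
    refine h1.trans ((h2.unique h3).trans ?_)
    rw [one_mul]
    split_ifs <;> rfl
  ext p
  have h0 : ∀ α : MI n T.order, α ≠ 0 → dMulti α.toNat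
      (T.ham.bulk.fn.jetDeriv (columns T.ham.bulk.timeOrder φ) (Sum.inr (a, 0)) α) p = 0 := by
    intro α hα
    rw [hj, if_neg hα]
    simp
  have hz : MI.toNat (0 : MI n T.order) = 0 := rfl
  have h1 : T.ham.bulk.fn.euler (columns T.ham.bulk.timeOrder φ) (Sum.inr (a, 0)) p =
      ∑ α : MI n T.order, (-1 : ℝ) ^ (∑ i, α.toNat i) * dMulti α.toNat
        (T.ham.bulk.fn.jetDeriv (columns T.ham.bulk.timeOrder φ) (Sum.inr (a, 0)) α) p := rfl
  rw [h1, Finset.sum_eq_single 0 (fun α _ hα => by rw [h0 α hα, mul_zero]) (by simp), hj, if_pos rfl,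
    hz]
  simp

theorem contDiff_constrVal {φ : Hist n N m} (hφ : Smooth φ) (a : Fin m) :
    ContDiff ℝ ∞ (T.constrVal a φ) :=
  (T.constr a).contDiff_eval fun _ => hφ _

theorem contDiff_eom {φ : Hist n N m} (hφ : Smooth φ) (A : Fin N) :
    ContDiff ℝ ∞ (T.eom A φ) :=
  (contDiff_dt (hφ _)).sub (ContDiff.sum fun B _ =>
    contDiff_const.mul (T.ham.contDiff_eulerZ hφ B))

theorem ham_bulkVar (φ ψ : Hist n N m) (t : ℝ) : T.ham.bulkVar S φ ψ t =
    S.bulkInt (fun p => ∑ A, T.ham.eulerZ φ A p * ψ (Sum.inl A) p +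
      ∑ a, T.constrVal a φ p * ψ (Sum.inr a) p) t := by
  unfold Functional.bulkVar
  congr 1
  ext p
  rw [Fintype.sum_sum_type, Fintype.sum_prod_type]
  refine congrArg₂ (· + ·) rfl (Finset.sum_congr rfl fun a _ => ?_)
  rw [← ham_euler_multiplier]
  exact Fin.sum_univ_one _

/-- The kinetic form `σ_{AB} u^A v^B`. -/
def kin (u v : Hist n N m) : ST n → ℝ :=
  fun p => ∑ A, ∑ B, T.σ⁻¹ A B * u (Sum.inl A) p * v (Sum.inl B) p

variable {T S}

theorem contDiff_kin {u v : Hist n N m} (hu : Smooth u) (hv : Smooth v) :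
    ContDiff ℝ ∞ (T.kin u v) :=
  ContDiff.sum fun _ _ => ContDiff.sum fun _ _ =>
    (contDiff_const.mul (hu _)).mul (hv _)

theorem inv_antisymm (A B : Fin N) : T.σ⁻¹ A B = -T.σ⁻¹ B A := by
  have h1 : (T.σ⁻¹).transpose = -T.σ⁻¹ := by
    rw [Matrix.transpose_nonsing_inv, T.antisymm]
    refine Matrix.inv_eq_left_inv ?_
    rw [neg_mul_neg, Matrix.nonsing_inv_mul _ T.invertible]
  have h2 := congrFun (congrFun h1 B) A
  simpa using h2

theorem antisymm_apply (A B : Fin N) : T.σ A B = -T.σ B A := by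
  have h2 := congrFun (congrFun T.antisymm B) A
  simpa using h2

theorem sum_inv_mul_apply (A C : Fin N) :
    ∑ B, T.σ⁻¹ A B * T.σ B C = if A = C then 1 else 0 := by
  have h := congrFun (congrFun (Matrix.nonsing_inv_mul T.σ T.invertible) A) C
  rwa [Matrix.mul_apply, Matrix.one_apply] at h

theorem sum_mul_inv_apply (A C : Fin N) :
    ∑ B, T.σ A B * T.σ⁻¹ B C = if A = C then 1 else 0 := by
  have h := congrFun (congrFun (Matrix.mul_nonsing_inv T.σ T.invertible) A) C
  rwa [Matrix.mul_apply, Matrix.one_apply] at h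

theorem kin_antisymm (u v : Hist n N m) : T.kin u v = -T.kin v u := by
  ext p
  simp only [kin, Pi.neg_apply]
  rw [Finset.sum_comm, ← Finset.sum_neg_distrib]
  refine Finset.sum_congr rfl fun A _ => ?_
  rw [← Finset.sum_neg_distrib]
  refine Finset.sum_congr rfl fun B _ => ?_
  rw [inv_antisymm B A]
  ring

theorem sf_kin {u v : ℝ → Hist n N m} (hu : ∀ j, SF fun s => u s j)
    (hv : ∀ j, SF fun s => v s j) : SF fun s => T.kin (u s) (v s) :=
  SF.sum _ fun A => SF.sum _ fun B =>
    ContDiff.mul (ContDiff.mul contDiff_const (hu (Sum.inl A))) (hv (Sum.inl B))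

theorem ds_kin {u v : ℝ → Hist n N m} (hu : ∀ j, SF fun s => u s j)
    (hv : ∀ j, SF fun s => v s j) (s : ℝ) :
    ds (fun s => T.kin (u s) (v s)) s =
      T.kin (fun j => ds (fun s => u s j) s) (v s) +
        T.kin (u s) (fun j => ds (fun s => v s j) s) := by
  ext p
  refine HasDerivAt.deriv ?_
  simp only [kin, Pi.add_apply, ← Finset.sum_add_distrib]
  refine HasDerivAt.fun_sum fun A _ => HasDerivAt.fun_sum fun B _ => ?_
  refine ((((hu (Sum.inl A)).hasDerivAt s p).const_mul (T.σ⁻¹ A B)).mul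
    ((hv (Sum.inl B)).hasDerivAt s p)).congr_deriv ?_
  ring

theorem dt_kin {u v : Hist n N m} (hu : Smooth u) (hv : Smooth v) :
    dt (T.kin u v) = T.kin (zdot u) v + T.kin u (zdot v) := by
  have h1 : T.kin u v = ∑ A, ∑ B, T.σ⁻¹ A B • (u (Sum.inl A) * v (Sum.inl B)) := by
    ext p; simp [kin, mul_assoc]
  have hd : ∀ f : ST n → ℝ, ContDiff ℝ ∞ f → ∀ p, HasFDerivAt f (fderiv ℝ f p) p :=
    fun f hf p => (differentiable_of_smooth hf p).hasFDerivAt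
  ext p
  have h2 : HasFDerivAt (T.kin u v) (∑ A, ∑ B, T.σ⁻¹ A B •
      (u (Sum.inl A) p • fderiv ℝ (v (Sum.inl B)) p +
        v (Sum.inl B) p • fderiv ℝ (u (Sum.inl A)) p)) p := by
    rw [h1]
    exact HasFDerivAt.sum fun A _ => HasFDerivAt.sum fun B _ =>
      ((hd _ (hu _) p).mul (hd _ (hv _) p)).const_smul _
  simp only [dt]
  rw [h2.fderiv]
  simp only [kin, zdot, dt, Pi.add_apply, Sum.elim_inl, _root_.sum_apply,
    ← Finset.sum_add_distrib]
  refine Finset.sum_congr rfl fun A _ => Finset.sum_congr rfl fun B _ => ?_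
  simp
  ring

theorem action_eq (φ : Hist n N m) (t₀ t₁ : ℝ) : T.action S φ t₀ t₁ =
    ∫ t in t₀..t₁, (S.bulkInt ((1 / 2 : ℝ) • T.kin φ (zdot φ)) t - T.ham.val S φ t) := by
  unfold action
  refine intervalIntegral.integral_congr fun t _ => ?_
  refine congrArg (fun f => S.bulkInt f t - T.ham.val S φ t) ?_
  ext p
  simp only [kin, zdot, Pi.smul_apply, smul_eq_mul, Finset.mul_sum, Sum.elim_inl]
  refine Finset.sum_congr rfl fun A _ => Finset.sum_congr rfl fun B _ => ?_
  ring

/-- The first variation of the action: a total time derivative, the symplectic pairing of the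
variation with the velocity, and the variation of the Hamiltonian. -/
theorem hasDerivAt_action {φ Q : Hist n N m} (hφ : Smooth φ) (hQ : Smooth Q) (t₀ t₁ : ℝ) :
    HasDerivAt (fun s : ℝ => T.action S (φ + s • Q) t₀ t₁)
      (S.bulkInt ((1 / 2 : ℝ) • T.kin φ Q) t₁ - S.bulkInt ((1 / 2 : ℝ) • T.kin φ Q) t₀ +
        ∫ t in t₀..t₁, (S.bulkInt (T.kin Q (zdot φ)) t - T.ham.lin S φ Q t)) 0 := by
  have hz := zdot_add_smul hφ hQ
  have hsf1 := sf_affine hφ hQ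
  have hsf2 : ∀ j, SF fun s : ℝ => zdot (φ + s • Q) j := by
    simp only [hz]
    exact sf_affine (smooth_zdot hφ) (smooth_zdot hQ)
  have hk : SF fun s : ℝ => (1 / 2 : ℝ) • T.kin (φ + s • Q) (zdot (φ + s • Q)) :=
    ContDiff.mul contDiff_const (sf_kin hsf1 hsf2)
  have hkd : ∀ s : ℝ, ds (fun s : ℝ => (1 / 2 : ℝ) • T.kin (φ + s • Q) (zdot (φ + s • Q))) s =
      (1 / 2 : ℝ) • (T.kin Q (zdot (φ + s • Q)) + T.kin (φ + s • Q) (zdot Q)) := by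
    intro s
    have h1 := ds_kin (T := T) hsf1 hsf2 s
    rw [ds_hist_affine] at h1
    simp only [hz] at h1
    rw [ds_hist_affine] at h1
    simp only [← hz] at h1
    rw [← h1]
    ext p
    exact (((sf_kin hsf1 hsf2).hasDerivAt s p).const_mul (1 / 2 : ℝ)).deriv
  have hFc : Continuous fun q : ℝ × ℝ =>
      S.bulkInt ((1 / 2 : ℝ) • T.kin (φ + q.1 • Q) (zdot (φ + q.1 • Q))) q.2 -
        T.ham.val S (φ + q.1 • Q) q.2 :=
    (S.continuous_bulkInt_family hk).sub (T.ham.continuous_val_family S hsf1)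
  have hlin := T.ham.continuous_lin_family S hsf1
  simp only [ds_hist_affine] at hlin
  have hF'c := (S.continuous_bulkInt_family hk.ds).sub hlin
  have hmain := hasDerivAt_intervalIntegral_param hFc hF'c (fun s t =>
    (S.hasDerivAt_bulkInt_param hk s t).sub (T.ham.hasDerivAt_val_affine S hφ hQ s t)) t₀ t₁ 0
  simp only [action_eq]
  refine hmain.congr_deriv ?_
  have hM : ContDiff ℝ ∞ ((1 / 2 : ℝ) • T.kin φ Q) :=
    contDiff_const.mul (contDiff_kin hφ hQ)
  have hR : Continuous fun t => S.bulkInt (T.kin Q (zdot φ)) t - T.ham.lin S φ Q t :=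
    (S.continuous_bulkInt (contDiff_kin hQ (smooth_zdot hφ)).continuous).sub
      (T.ham.continuous_lin S hφ hQ)
  rw [← intervalIntegral.integral_eq_sub_of_hasDerivAt
    (fun t _ => S.hasDerivAt_bulkInt_time hM t)
    ((S.continuous_bulkInt (contDiff_dt hM).continuous).intervalIntegrable _ _),
    ← intervalIntegral.integral_add
      ((S.continuous_bulkInt (contDiff_dt hM).continuous).intervalIntegrable _ _)
      (hR.intervalIntegrable _ _)]
  refine intervalIntegral.integral_congr fun t _ => ?_
  have hdM : dt ((1 / 2 : ℝ) • T.kin φ Q) =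
      (1 / 2 : ℝ) • (T.kin (zdot φ) Q + T.kin φ (zdot Q)) := by
    rw [← dt_kin hφ hQ]
    exact dd_const_smul (contDiff_kin hφ hQ) _ _
  have hsplit : (1 / 2 : ℝ) • (T.kin Q (zdot φ) + T.kin φ (zdot Q)) =
      (1 / 2 : ℝ) • (T.kin (zdot φ) Q + T.kin φ (zdot Q)) + T.kin Q (zdot φ) := by
    rw [kin_antisymm (zdot φ) Q]
    ext p
    simp
    ring
  simp only [hkd, zero_smul, add_zero, hdM]
  rw [hsplit, S.bulkInt_add (by
      exact (contDiff_const.mul ((contDiff_kin (smooth_zdot hφ) hQ).add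
        (contDiff_kin hφ (smooth_zdot hQ)))).continuous)
    (contDiff_kin hQ (smooth_zdot hφ)).continuous]
  ring

end Theory

/-! ### The time derivative of a generator -/

theorem smooth_transf (Z : Fin N → LocalFn n N m) (Λ : Fin m → LocalFn n N m) {φ : Hist n N m}
    (hφ : Smooth φ) : Smooth (transf Z Λ φ) := by
  rintro (A | a)
  · exact (Z A).contDiff_eval hφ
  · exact (Λ a).contDiff_eval hφ

theorem smooth_transfLam (Λ : Fin m → LocalFn n N m) {φ : Hist n N m}
    (hφ : Smooth φ) : Smooth (transfLam Λ φ) := by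
  rintro (A | a)
  · exact contDiff_const
  · exact (Λ a).contDiff_eval hφ

namespace Theory

variable {T : Theory n N m c} {S : Region n}

/-- On admissible histories `ż` and `δ_H z` have the same derivatives on the boundary. -/
theorem Admissible.flatHist_zdot_sub {φ : Hist n N m} (hφ : T.Admissible S φ) :
    FlatHist S (zdot φ - T.ham.hamZ T.σ φ) := by
  rintro (A | a)
  · exact ⟨T.contDiff_eom hφ.1 A, fun β t x hx => (hφ.2 β t x hx).2 A⟩
  · have h : (zdot φ - T.ham.hamZ T.σ φ) (Sum.inr a) = 0 := by
      ext p; simp [zdot, Functional.hamZ]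
    rw [h]
    exact Flat.zero

/-- If `Z = σ δG/δz` on `Σ`, the combination `DG/Dt + {G, H}_ζ - δ^λ_G H` is the time derivative
of `G` plus the contribution of the transformation to the first variation of the action. The
boundary term `∮ Θ_G[δ_H z]` of the bracket is `∮ Θ_G[ż]`, as `ż - δ_H z` is flat on the boundary. -/
theorem bigD_add_modBracket_sub {G : Functional n N m} {Z : Fin N → LocalFn n N m}
    {Λ : Fin m → LocalFn n N m} {φ : Hist n N m} (hφ : T.Admissible S φ)
    (hZ : ∀ (A : Fin N) (t : ℝ), ∀ x ∈ S.body,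
      (Z A).eval φ (t, x) = ∑ B, T.σ A B * G.eulerZ φ B (t, x)) (t : ℝ) :
    G.bigD S φ t + G.modBracket S T.ham T.σ φ t - T.ham.var S φ (transfLam Λ φ) t =
      G.bigD S φ t + G.lin S φ (zdot φ) t +
        (S.bulkInt (T.kin (transf Z Λ φ) (zdot φ)) t - T.ham.lin S φ (transf Z Λ φ) t) := by
  have hs := hφ.1
  have hHs := T.ham.smooth_hamZ T.σ hs
  have hGs := G.smooth_hamZ T.σ hs
  have hLs := smooth_transfLam Λ hs
  have hbdry := G.lin_sub_bulkVar_congr S hs hHs hφ.flatHist_zdot_sub t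
  have h1 : G.bulkVar S φ (T.ham.hamZ T.σ φ) t = G.bracket S T.ham T.σ φ t := by
    unfold Functional.hamZ Functional.bracket
    rw [Functional.bulkVar_elim]
    simp only [Finset.mul_sum, mul_assoc]
  have h2 : T.ham.bulkVar S φ (G.hamZ T.σ φ) t = -G.bracket S T.ham T.σ φ t := by
    unfold Functional.hamZ Functional.bracket Region.bulkInt
    rw [Functional.bulkVar_elim, ← MeasureTheory.integral_neg]
    unfold Region.bulkInt
    congr 1
    ext x
    simp only [Finset.mul_sum]
    rw [Finset.sum_comm, ← Finset.sum_neg_distrib]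
    refine Finset.sum_congr rfl fun A _ => ?_
    rw [← Finset.sum_neg_distrib]
    refine Finset.sum_congr rfl fun B _ => ?_
    rw [antisymm_apply B A]
    ring
  have h3 : G.bulkVar S φ (zdot φ) t = -S.bulkInt (T.kin (transf Z Λ φ) (zdot φ)) t := by
    unfold zdot
    rw [Functional.bulkVar_elim]
    unfold Region.bulkInt
    rw [← MeasureTheory.integral_neg]
    refine MeasureTheory.setIntegral_congr_fun S.measurableSet_body fun x hx => ?_
    simp only [kin, transf, Sum.elim_inl]
    rw [Finset.sum_comm, ← Finset.sum_neg_distrib]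
    refine Finset.sum_congr rfl fun B _ => ?_
    rw [← Finset.sum_mul, ← neg_mul]
    congr 1
    have h4 := sum_inv_mul_apply (T := T) B
    calc G.eulerZ φ B (t, x) = ∑ C, (∑ A, T.σ⁻¹ B A * T.σ A C) * G.eulerZ φ C (t, x) := by
          simp [h4]
      _ = ∑ A, T.σ⁻¹ B A * ∑ C, T.σ A C * G.eulerZ φ C (t, x) := by
          simp only [Finset.sum_mul, Finset.mul_sum, mul_assoc]
          rw [Finset.sum_comm]
      _ = -∑ A, T.σ⁻¹ A B * (Z A).eval φ (t, x) := by
          rw [← Finset.sum_neg_distrib]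
          refine Finset.sum_congr rfl fun A _ => ?_
          rw [hZ A t x hx, inv_antisymm A B]
          ring
  have h6 : T.ham.lin S φ (transf Z Λ φ) t =
      T.ham.lin S φ (G.hamZ T.σ φ) t + T.ham.lin S φ (transfLam Λ φ) t := by
    rw [← T.ham.lin_add S hs hGs hLs]
    refine T.ham.lin_congr S hs (smooth_transf Z Λ hs) (hGs.add hLs) ?_ t
    rintro (A | a) t x hx
    · simp [transf, transfLam, Functional.hamZ, hZ A t x hx]
    · simp [transf, transfLam, Functional.hamZ]
  unfold Functional.modBracket Functional.bdryVar
  rw [G.var_eq_lin S hs hHs, T.ham.var_eq_lin S hs hGs, T.ham.var_eq_lin S hs hLs, h2, h6]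
  rw [h1] at hbdry
  rw [h1]
  linarith

/-! ### Changing a history away from the boundary -/

/-- Variations that vanish in a neighbourhood of every boundary point. -/
def AwayFromBdry (S : Region n) (ψ : Hist n N m) : Prop :=
  ∀ j t, ∀ x ∈ S.bdry, ψ j =ᶠ[nhds (t, x)] 0

theorem _root_.GaugeField.flat_of_eventuallyEq_zero {f : ST n → ℝ} (hf : ContDiff ℝ ∞ f)
    (h : ∀ t, ∀ x ∈ S.bdry, f =ᶠ[nhds (t, x)] 0) : Flat S f :=
  ⟨hf, fun β t x hx => by
    have h1 := (dMulti_congr (h t x hx) β).eq_of_nhds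
    rwa [dMulti_zero] at h1⟩

theorem AwayFromBdry.flatHist {ψ : Hist n N m} (h : AwayFromBdry S ψ) (hψ : Smooth ψ) :
    FlatHist S ψ := fun j => flat_of_eventuallyEq_zero (hψ j) (h j)

theorem constrVal_congr {φ ψ : Hist n N m} {p : ST n} (h : ∀ j, φ j =ᶠ[nhds p] ψ j)
    (a : Fin m) : T.constrVal a φ =ᶠ[nhds p] T.constrVal a ψ :=
  (T.constr a).eval_congr fun _ => h _

theorem eom_congr {φ ψ : Hist n N m} {p : ST n} (h : ∀ j, φ j =ᶠ[nhds p] ψ j)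
    (A : Fin N) : T.eom A φ =ᶠ[nhds p] T.eom A ψ := by
  have h1 : ∀ᶠ q in nhds p, ∀ B, T.ham.eulerZ φ B q = T.ham.eulerZ ψ B q :=
    Filter.eventually_all.2 fun B => T.ham.bulk.fn.euler_congr (columns_congr h _) _
  filter_upwards [h1, dd_congr (h (Sum.inl A)) (vt n)] with q hq hd
  rw [← dt_eq_dd] at hd
  simp only [eom, hq, hd]

theorem Admissible.add {φ ψ : Hist n N m} (hφ : T.Admissible S φ) (hψ : Smooth ψ)
    (h : AwayFromBdry S ψ) : T.Admissible S (φ + ψ) := by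
  refine ⟨hφ.1.add hψ, fun β t x hx => ?_⟩
  have hj : ∀ j, (φ + ψ) j =ᶠ[nhds (t, x)] φ j := by
    intro j
    filter_upwards [h j t x hx] with q hq
    simp [hq]
  refine ⟨fun a => ?_, fun A => ?_⟩
  · rw [(dMulti_congr (constrVal_congr hj a) β).eq_of_nhds]
    exact (hφ.2 β t x hx).1 a
  · rw [(dMulti_congr (eom_congr hj A) β).eq_of_nhds]
    exact (hφ.2 β t x hx).2 A

end Theory

/-- A bump function around an interior point that vanishes near the boundary. -/
theorem Region.exists_bump (S : Region n) {x₀ : Space n} (hx₀ : x₀ ∈ S.core) :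
    ∃ η : Space n → ℝ, ContDiff ℝ ∞ η ∧ (∀ x, 0 ≤ η x) ∧ η x₀ = 1 ∧
      ∀ x ∈ S.bdry, η =ᶠ[nhds x] 0 := by
  obtain ⟨ε, hε, hball⟩ := Metric.isOpen_iff.1 S.isOpen_core x₀ hx₀
  let b : ContDiffBump x₀ := ⟨ε / 4, ε / 2, by positivity, by linarith⟩
  refine ⟨b, b.contDiff, fun x => b.nonneg, b.one_of_mem_closedBall (by simp [b.rIn_pos.le]), ?_⟩
  intro x hx
  refine notMem_tsupport_iff_eventuallyEq.1 fun hxs => ?_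
  rw [b.tsupport_eq] at hxs
  have h1 : S.ρ x < 0 := hball (Metric.closedBall_subset_ball (by
    change ε / 2 < ε; linarith) hxs)
  have h2 : S.ρ x = 0 := hx
  linarith

theorem Region.eq_zero_of_bulkInt_eq_zero (S : Region n) {f : ST n → ℝ} (hf : Continuous f)
    {t : ℝ} (h0 : ∀ x, 0 ≤ f (t, x)) (h : S.bulkInt f t = 0) :
    ∀ x ∈ S.core, f (t, x) = 0 := by
  have hc : Continuous fun x => f (t, x) := by fun_prop
  have hi : MeasureTheory.IntegrableOn (fun x => f (t, x)) S.body :=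
    hc.continuousOn.integrableOn_compact S.isCompact_body
  have h1 := (MeasureTheory.setIntegral_eq_zero_iff_of_nonneg_ae
    (Filter.Eventually.of_forall h0) hi).1 h
  have h2 := MeasureTheory.ae_restrict_of_ae_restrict_of_subset S.core_subset_body h1
  exact MeasureTheory.Measure.eqOn_open_of_ae_eq (μ := MeasureTheory.volume)
    (f := fun x => f (t, x)) (g := fun _ => 0) h2 S.isOpen_core
    hc.continuousOn continuousOn_const

/-- Spatial derivatives at time `t` depend only on the values at time `t`. -/
theorem dMulti_eq_zero_of_slice {f : ST n → ℝ} (hf : ContDiff ℝ ∞ f) {t : ℝ}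
    (h : ∀ x, f (t, x) = 0) (α : Fin n → ℕ) : ∀ x, dMulti α f (t, x) = 0 := by
  rw [dMulti_eq_dList]
  induction miList α with
  | nil => exact h
  | cons i l ih =>
    intro x
    have h1 := hasFDerivAt_slice (contDiff_dList hf l) t x
    have h2 : (fun x => dList l f (t, x)) = fun _ => 0 := funext ih
    rw [h2] at h1
    have h3 := h1.unique (hasFDerivAt_const (0 : ℝ) x)
    have h4 := congrArg (fun L => L (EuclideanSpace.single i 1)) h3
    simpa [dx] using h4

theorem jet_eq_of_slice {J : Type} {u v : J → ST n → ℝ} (hu : ∀ j, ContDiff ℝ ∞ (u j))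
    (hv : ∀ j, ContDiff ℝ ∞ (v j)) {t : ℝ} (h : ∀ j x, u j (t, x) = v j (t, x)) (r : ℕ)
    (x : Space n) : JetFn.jet r u (t, x) = JetFn.jet r v (t, x) := by
  have hd : ∀ j, ContDiff ℝ ∞ ((u - v) j) := fun j => (hu j).sub (hv j)
  have h1 : u = (u - v) + v := (sub_add_cancel u v).symm
  have h2 : JetFn.jet r (u - v) (t, x) = 0 := by
    ext q
    exact dMulti_eq_zero_of_slice (hd q.1) (fun x => by simp [h]) _ x
  rw [h1, JetFn.jet_add hd hv, h2, zero_add]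

namespace Theory

variable {T : Theory n N m c} {S : Region n}

/-- If the conservation identity holds on all admissible histories, the transformation of the
canonical fields is the one generated by `G`: at a given time `z` may be kept fixed while `ż` is
changed in the interior, and the identity is affine in `ż` with coefficient
`δG/δz^B + Z^A σ_{AB}`. -/
theorem eval_eq_of_conservation {G : Functional n N m} {Z : Fin N → LocalFn n N m}
    {Λ : Fin m → LocalFn n N m} {V : Fin n → LocalFn n N m}
    (hcons : ∀ φ, T.Admissible S φ → ∀ t, G.bigD S φ t + G.lin S φ (zdot φ) t +
      (S.bulkInt (T.kin (transf Z Λ φ) (zdot φ)) t - T.ham.lin S φ (transf Z Λ φ) t) =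
        bdryTerm S V φ t)
    {φ : Hist n N m} (hφ : T.Admissible S φ) (A : Fin N) (t : ℝ) {x : Space n}
    (hx : x ∈ S.body) : (Z A).eval φ (t, x) = ∑ B, T.σ A B * G.eulerZ φ B (t, x) := by
  have hs := hφ.1
  set Q := transf Z Λ φ with hQ
  have hQs : Smooth Q := smooth_transf Z Λ hs
  let W : Fin N → ST n → ℝ := fun B p =>
    G.eulerZ φ B p + ∑ A, T.σ⁻¹ A B * Q (Sum.inl A) p
  have hW : ∀ B, ContDiff ℝ ∞ (W B) := fun B =>
    (G.contDiff_eulerZ hs B).add (ContDiff.sum fun A _ => contDiff_const.mul (hQs _))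
  have hcore : ∀ x₀ ∈ S.core, ∀ B, W B (t, x₀) = 0 := by
    intro x₀ hx₀
    obtain ⟨η, hη, hη0, hη1, hηb⟩ := S.exists_bump hx₀
    -- adding `ψ = (t' - t) η W` to `z` leaves the fields at time `t` unchanged and adds `η W` to `ż`;
    -- the multipliers and their time derivatives are not changed at all
    let τ : ST n → ℝ := fun p => p.1 - t
    have hτ : ContDiff ℝ ∞ τ := contDiff_fst.sub contDiff_const
    have hηW : ∀ B, ContDiff ℝ ∞ fun p : ST n => η p.2 * W B p := fun B =>
      (hη.comp contDiff_snd).mul (hW B)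
    let ψ : Hist n N m := Sum.elim (fun B => τ * fun p => η p.2 * W B p) 0
    have hψ : Smooth ψ := by
      rintro (B | a)
      · exact hτ.mul (hηW B)
      · exact contDiff_const
    have hψb : AwayFromBdry S ψ := by
      rintro (B | a) t' y hy
      · have h1 : Filter.Tendsto Prod.snd (nhds ((t', y) : ST n)) (nhds y) :=
          continuous_snd.continuousAt
        filter_upwards [h1.eventually (hηb y hy)] with q hq
        simp [ψ, hq]
      · rfl
    -- `ψ` vanishes at time `t`, where its velocity is `η W`
    have hψt : ∀ j y, ψ j (t, y) = 0 := by
      rintro (B | a) y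
      · simp [ψ, τ]
      · rfl
    have hdτ : ∀ p, dt τ p = 1 := by
      intro p
      have h1 : HasFDerivAt τ (ContinuousLinearMap.fst ℝ ℝ (Space n)) p :=
        hasFDerivAt_fst.sub_const t
      simp [dt, h1.fderiv]
    have hvel : ∀ B y, zdot ψ (Sum.inl B) (t, y) = η y * W B (t, y) := by
      intro B y
      have h1 : dt (τ * fun p => η p.2 * W B p) = _ := dd_mul hτ (hηW B) (vt n)
      have h2 : zdot ψ (Sum.inl B) = dt (τ * fun p => η p.2 * W B p) := rfl
      rw [h2, h1, ← dt_eq_dd]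
      simp only [Pi.add_apply, Pi.mul_apply, hdτ]
      simp [τ]
    have hs' : Smooth (φ + ψ) := hs.add hψ
    have hcol : ∀ k j y, columns k (φ + ψ) j (t, y) = columns k φ j (t, y) := by
      rintro k (B | q) y
      · have := hψt (Sum.inl B) y
        simp [columns, this]
      · simp [columns, ψ]
    have hjet : ∀ k r y, JetFn.jet r (columns k (φ + ψ)) (t, y) =
        JetFn.jet r (columns k φ) (t, y) := fun k r y =>
      jet_eq_of_slice (contDiff_columns hs' k) (contDiff_columns hs k) (hcol k) r y
    have heval : ∀ (f : LocalFn n N m) y, f.eval (φ + ψ) (t, y) = f.eval φ (t, y) := by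
      intro f y
      simp only [LocalFn.eval, JetFn.eval, hjet]
    have hlin : ∀ (f : LocalFn n N m) (χ : Hist n N m) y,
        f.lin (φ + ψ) χ (t, y) = f.lin φ χ (t, y) := by
      intro f χ y
      simp only [LocalFn.lin, JetFn.lin, hjet]
    have hbigD : ∀ (f : LocalFn n N m) y, f.bigD (φ + ψ) (t, y) = f.bigD φ (t, y) := by
      intro f y
      simp only [LocalFn.bigD, hjet]
      simp [ψ]
    have hFlin : ∀ (F : Functional n N m) (χ : Hist n N m),
        F.lin S (φ + ψ) χ t = F.lin S φ χ t := by
      intro F χ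
      unfold Functional.lin
      rw [S.bulkInt_congr fun y _ => hlin F.bulk χ y,
        S.bdryInt_congr fun i y _ => hlin (F.bdry i) χ y]
    have hFbigD : G.bigD S (φ + ψ) t = G.bigD S φ t := by
      unfold Functional.bigD
      rw [S.bulkInt_congr fun y _ => hbigD G.bulk y,
        S.bdryInt_congr fun i y _ => hbigD (G.bdry i) y]
    have hV : bdryTerm S V (φ + ψ) t = bdryTerm S V φ t :=
      S.bdryInt_congr fun i y _ => heval (V i) y
    set Q' := transf Z Λ (φ + ψ) with hQ'
    have hQs' : Smooth Q' := smooth_transf Z Λ hs'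
    have hQQ : ∀ j y, Q' j (t, y) = Q j (t, y) := by
      rintro (B | a) y
      · exact heval (Z B) y
      · exact heval (Λ a) y
    have hQcol : ∀ j y, columns 0 Q' j (t, y) = columns 0 Q j (t, y) := by
      rintro (B | ⟨a, l⟩) y
      · exact hQQ (Sum.inl B) y
      · have hl : (l : ℕ) = 0 := by omega
        simp only [columns, Sum.elim_inr, hl]
        exact hQQ _ y
    have hQjet : ∀ r y, JetFn.jet r (columns 0 Q') (t, y) = JetFn.jet r (columns 0 Q) (t, y) :=
      fun r y => jet_eq_of_slice (contDiff_columns hQs' 0) (contDiff_columns hQs 0) hQcol r y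
    have hH : T.ham.lin S φ Q' t = T.ham.lin S φ Q t := by
      unfold Functional.lin
      have h1 : ∀ y, T.ham.bulk.lin φ Q' (t, y) = T.ham.bulk.lin φ Q (t, y) := fun y =>
        congrArg (fun J => fderiv ℝ T.ham.bulk.fn.toFun
          ((t, y), JetFn.jet T.order (columns 0 φ) (t, y)) (0, J)) (hQjet T.order y)
      have h2 : ∀ i y, (T.ham.bdry i).lin φ Q' (t, y) = (T.ham.bdry i).lin φ Q (t, y) :=
        fun i y => congrArg (fun J => fderiv ℝ (T.ham.bdry i).fn.toFun
          ((t, y), JetFn.jet T.order (columns 0 φ) (t, y)) (0, J)) (hQjet T.order y)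
      rw [S.bulkInt_congr fun y _ => h1 y, S.bdryInt_congr fun i y _ => h2 i y]
    have hzadd : zdot (φ + ψ) = zdot φ + zdot ψ := by
      funext j
      rcases j with B | a
      · exact dd_add (hs _) (hψ _) _
      · simp [zdot]
    have hzflat : FlatHist S (zdot ψ) := by
      rintro (B | a)
      · exact (hψb.flatHist hψ _).dt
      · exact Flat.zero
    have hzs := smooth_zdot hs
    have hzψ := smooth_zdot hψ
    have hkin : S.bulkInt (T.kin Q' (zdot φ + zdot ψ)) t =
        S.bulkInt (T.kin Q (zdot φ)) t + S.bulkInt (T.kin Q (zdot ψ)) t := by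
      rw [← S.bulkInt_add (contDiff_kin hQs hzs).continuous (contDiff_kin hQs hzψ).continuous]
      refine S.bulkInt_congr fun y _ => ?_
      simp only [kin, hQQ, Pi.add_apply, mul_add, Finset.sum_add_distrib]
    have hGv : G.lin S φ (zdot ψ) t =
        S.bulkInt (fun p => ∑ B, G.eulerZ φ B p * zdot ψ (Sum.inl B) p) t := by
      rw [G.lin_eq_bulkVar hs hzflat, ← G.bulkVar_elim S φ (fun B => zdot ψ (Sum.inl B))]
      rfl
    have e1 := hcons φ hφ t
    have e2 := hcons (φ + ψ) (hφ.add hψ hψb) t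
    rw [← hQ] at e1
    rw [← hQ', hFbigD, hFlin, hFlin, hH, hV, hzadd, G.lin_add S hs hzs hzψ, hkin] at e2
    have e3 : S.bulkInt (fun p => η p.2 * ∑ B, W B p ^ 2) t = 0 := by
      have e4 : S.bulkInt (fun p => η p.2 * ∑ B, W B p ^ 2) t =
          G.lin S φ (zdot ψ) t + S.bulkInt (T.kin Q (zdot ψ)) t := by
        have e5 : Continuous fun p => ∑ B, G.eulerZ φ B p * zdot ψ (Sum.inl B) p :=
          (ContDiff.sum fun B _ => (G.contDiff_eulerZ hs B).mul (hzψ _) : ContDiff ℝ ∞ _).continuous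
        rw [hGv, ← S.bulkInt_add e5 (contDiff_kin hQs hzψ).continuous]
        refine S.bulkInt_congr fun y _ => ?_
        simp only [Pi.add_apply, kin, hvel]
        rw [Finset.sum_comm, ← Finset.sum_add_distrib, Finset.mul_sum]
        refine Finset.sum_congr rfl fun B _ => ?_
        rw [← Finset.sum_mul, ← add_mul]
        change η y * W B (t, y) ^ 2 = W B (t, y) * (η y * W B (t, y))
        ring
      rw [e4]
      linarith
    have hcont : Continuous fun p : ST n => η p.2 * ∑ B, W B p ^ 2 :=
      ((hη.comp contDiff_snd).mul (ContDiff.sum fun B _ => (hW B).pow 2) :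
        ContDiff ℝ ∞ fun p : ST n => η p.2 * ∑ B, W B p ^ 2).continuous
    have e6 := S.eq_zero_of_bulkInt_eq_zero hcont
      (fun y => mul_nonneg (hη0 y) (Finset.sum_nonneg fun B _ => sq_nonneg _)) e3 x₀ hx₀
    simp only [hη1, one_mul] at e6
    intro B
    have e7 := (Finset.sum_eq_zero_iff_of_nonneg fun B _ => sq_nonneg _).1 e6 B (Finset.mem_univ B)
    exact pow_eq_zero_iff two_ne_zero |>.1 e7
  have hWb : ∀ B, W B (t, x) = 0 := by
    intro B
    have hcl : IsClosed {y | W B (t, y) = 0} :=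
      isClosed_eq ((hW B).continuous.comp (by fun_prop)) continuous_const
    exact hcl.closure_subset_iff.2 (fun y hy => hcore y hy B) (S.body_subset_closure_core hx)
  have h4 := sum_mul_inv_apply (T := T) A
  calc (Z A).eval φ (t, x) = ∑ C, (∑ B, T.σ A B * T.σ⁻¹ B C) * Q (Sum.inl C) (t, x) := by
        simp [h4, hQ, transf]
    _ = ∑ B, T.σ A B * ∑ C, T.σ⁻¹ B C * Q (Sum.inl C) (t, x) := by
        simp only [Finset.sum_mul, Finset.mul_sum, mul_assoc]
        rw [Finset.sum_comm]
    _ = ∑ B, T.σ A B * G.eulerZ φ B (t, x) := by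
        refine Finset.sum_congr rfl fun B _ => ?_
        have h6 : G.eulerZ φ B (t, x) = -∑ C, T.σ⁻¹ C B * Q (Sum.inl C) (t, x) :=
          eq_neg_of_add_eq_zero_left (hWb B)
        rw [h6, ← Finset.sum_neg_distrib]
        congr 1
        refine Finset.sum_congr rfl fun C _ => ?_
        rw [inv_antisymm B C]
        ring

end Theory

/-! ### Second variations -/

namespace JetFn

variable {r : ℕ} {J : Type} [Fintype J]

/-- The second derivative of a local function at `u`, applied to `v` and `w`. -/
def hess (f : JetFn n J r) (u v w : J → ST n → ℝ) : ST n → ℝ := fun p =>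
  fderiv ℝ (fderiv ℝ f.toFun) (p, jet r u p) (0, jet r v p) (0, jet r w p)

theorem hess_symm (f : JetFn n J r) (u v w : J → ST n → ℝ) : f.hess u v w = f.hess u w v := by
  ext p
  exact (f.smooth.contDiffAt.isSymmSndFDerivAt
    (by rw [minSmoothness_of_isRCLikeNormedField]
        exact WithTop.coe_le_coe.2 (le_top : (2 : ℕ∞) ≤ ⊤))) _ _

theorem sf_lin (f : JetFn n J r) {u w : ℝ → J → ST n → ℝ} (hu : ∀ j, SF fun s => u s j)
    (hw : ∀ j, SF fun s => w s j) : SF fun s => f.lin (u s) (w s) := by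
  have hJ : ∀ {u : ℝ → J → ST n → ℝ}, (∀ j, SF fun s => u s j) →
      ContDiff ℝ ∞ fun q : ℝ × ST n => jet r (u q.1) q.2 := fun hu =>
    contDiff_pi.2 fun q => (hu q.1).dMulti _
  exact ((f.smooth.fderiv_right (m := ∞) (by simp)).comp
    (contDiff_snd.prodMk (hJ hu))).clm_apply (contDiff_const.prodMk (hJ hw))

theorem ds_lin (f : JetFn n J r) {u w : ℝ → J → ST n → ℝ} (hu : ∀ j, SF fun s => u s j)
    (hw : ∀ j, SF fun s => w s j) (s : ℝ) :
    ds (fun s => f.lin (u s) (w s)) s =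
      f.hess (u s) (fun j => ds (fun s => u s j) s) (w s) +
        f.lin (u s) (fun j => ds (fun s => w s j) s) := by
  ext p
  have hJ : ∀ {u : ℝ → J → ST n → ℝ}, (∀ j, SF fun s => u s j) →
      HasDerivAt (fun s => jet r (u s) p) (jet r (fun j => ds (fun s => u s j) s) p) s := by
    intro u hu
    refine hasDerivAt_pi.2 fun q => ?_
    have h2 := ((hu q.1).dMulti q.2.toNat).hasDerivAt s p
    rwa [(hu q.1).ds_dMulti] at h2
  have h1 : HasDerivAt (fun s => fderiv ℝ f.toFun (p, jet r (u s) p))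
      (fderiv ℝ (fderiv ℝ f.toFun) (p, jet r (u s) p)
        (0, jet r (fun j => ds (fun s => u s j) s) p)) s :=
    HasFDerivAt.comp_hasDerivAt (f := fun s => (p, jet r (u s) p)) s
      (differentiable_of_smooth (f.smooth.fderiv_right (m := ∞) (by simp)) _).hasFDerivAt
      ((hasDerivAt_const s p).prodMk (hJ hu))
  exact (h1.clm_apply ((hasDerivAt_const s (0 : ST n)).prodMk (hJ hw))).deriv

theorem lin_congr (f : JetFn n J r) {u u' v v' : J → ST n → ℝ} {p : ST n}
    (hu : ∀ j, u j =ᶠ[nhds p] u' j) (hv : ∀ j, v j =ᶠ[nhds p] v' j) :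
    f.lin u v =ᶠ[nhds p] f.lin u' v' := by
  filter_upwards [jet_congr hu r, jet_congr hv r] with q h1 h2
  simp [lin, h1, h2]

end JetFn

theorem LocalFn.lin_congr (f : LocalFn n N m) {φ φ' ψ ψ' : Hist n N m} {p : ST n}
    (hφ : ∀ j, φ j =ᶠ[nhds p] φ' j) (hψ : ∀ j, ψ j =ᶠ[nhds p] ψ' j) :
    f.lin φ ψ =ᶠ[nhds p] f.lin φ' ψ' :=
  f.fn.lin_congr (columns_congr hφ _) (columns_congr hψ _)

@[simp] theorem LocalFn.lin_zero (f : LocalFn n N m) (φ : Hist n N m) : f.lin φ 0 = 0 := by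
  have h0 : columns f.timeOrder (0 : Hist n N m) = 0 := by
    funext j
    rcases j with A | q
    · rfl
    · exact iterate_dt_zero _
  ext p
  have h1 : JetFn.jet f.order (0 : Fin N ⊕ Fin m × Fin (f.timeOrder + 1) → ST n → ℝ) p = 0 := by
    ext q
    simp [JetFn.jet]
  simp only [LocalFn.lin, JetFn.lin, h0, h1, Pi.zero_apply]
  rw [← Prod.zero_eq_mk, map_zero]

/-- The second variation of a local function. -/
def LocalFn.hess (f : LocalFn n N m) (φ ψ χ : Hist n N m) : ST n → ℝ :=
  f.fn.hess (columns f.timeOrder φ) (columns f.timeOrder ψ) (columns f.timeOrder χ)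

theorem LocalFn.ds_lin (f : LocalFn n N m) {φ χ : ℝ → Hist n N m} (hφ : ∀ j, SF fun s => φ s j)
    (hχ : ∀ j, SF fun s => χ s j) (s : ℝ) :
    ds (fun s => f.lin (φ s) (χ s)) s =
      f.hess (φ s) (fun j => ds (fun s => φ s j) s) (χ s) +
        f.lin (φ s) (fun j => ds (fun s => χ s j) s) := by
  have h := f.fn.ds_lin (sf_columns hφ f.timeOrder) (sf_columns hχ f.timeOrder) s
  rw [ds_columns hφ, ds_columns hχ] at h
  exact h

/-- The transformation along a family of histories. -/
theorem sf_transf (Z : Fin N → LocalFn n N m) (Λ : Fin m → LocalFn n N m)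
    {φ : ℝ → Hist n N m} (hφ : ∀ j, SF fun s => φ s j) :
    ∀ j, SF fun s => transf Z Λ (φ s) j := by
  rintro (A | a)
  · exact (Z A).sf_eval hφ
  · exact (Λ a).sf_eval hφ

/-- The components of a transformation, labelled like the fields. -/
def transfFn (Z : Fin N → LocalFn n N m) (Λ : Fin m → LocalFn n N m) :
    Fin N ⊕ Fin m → LocalFn n N m := Sum.elim Z Λ

theorem transf_apply (Z : Fin N → LocalFn n N m) (Λ : Fin m → LocalFn n N m) (φ : Hist n N m)
    (j : Fin N ⊕ Fin m) : transf Z Λ φ j = (transfFn Z Λ j).eval φ := by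
  rcases j with A | a <;> rfl

namespace Theory

variable (T : Theory n N m c) {S : Region n}

/-! ### The equations of motion of the action -/

/-- The Euler-Lagrange derivatives of the action: `σ_{AB} (ż^B - σ^{BC} δH/δz^C)` and `-φ_a`. -/
def fieldEq (φ : Hist n N m) : Hist n N m :=
  Sum.elim (fun A => ∑ B, T.σ⁻¹ A B • T.eom B φ) fun a => -T.constrVal a φ

variable {T}

theorem Admissible.flatHist_fieldEq {φ : Hist n N m} (hφ : T.Admissible S φ) :
    FlatHist S (T.fieldEq φ) := by
  rintro (A | a)
  · change Flat S (∑ B, T.σ⁻¹ A B • T.eom B φ)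
    refine Flat.sum _ fun B => Flat.const_smul ?_ _
    exact ⟨T.contDiff_eom hφ.1 B, fun β t x hx => (hφ.2 β t x hx).2 B⟩
  · refine Flat.neg ?_
    exact ⟨T.contDiff_constrVal hφ.1 a, fun β t x hx => (hφ.2 β t x hx).1 a⟩

theorem sum_inv_eom (φ : Hist n N m) (A : Fin N) (p : ST n) :
    ∑ B, T.σ⁻¹ A B * T.eom B φ p =
      ∑ B, T.σ⁻¹ A B * dt (φ (Sum.inl B)) p - T.ham.eulerZ φ A p := by
  have h4 := sum_inv_mul_apply (T := T) A
  have h6 : ∑ B, T.σ⁻¹ A B * ∑ C, T.σ B C * T.ham.eulerZ φ C p = T.ham.eulerZ φ A p := by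
    calc ∑ B, T.σ⁻¹ A B * ∑ C, T.σ B C * T.ham.eulerZ φ C p
        = ∑ C, (∑ B, T.σ⁻¹ A B * T.σ B C) * T.ham.eulerZ φ C p := by
          simp only [Finset.sum_mul, Finset.mul_sum, mul_assoc]
          rw [Finset.sum_comm]
      _ = T.ham.eulerZ φ A p := by simp [h4]
  simp only [eom, mul_sub, Finset.sum_sub_distrib, h6]

/-- The first variation of the Lagrangian along a flat variation. -/
theorem bulkInt_kin_sub_lin {φ χ : Hist n N m} (hφ : Smooth φ) (hχ : FlatHist S χ) (t : ℝ) :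
    S.bulkInt (T.kin χ (zdot φ) - T.ham.bulk.lin φ χ) t =
      S.bulkInt (∑ j, T.fieldEq φ j * χ j) t := by
  have hχs := hχ.smooth
  have h1 : S.bulkInt (T.ham.bulk.lin φ χ) t = S.bulkInt (fun p =>
      ∑ A, T.ham.eulerZ φ A p * χ (Sum.inl A) p + ∑ a, T.constrVal a φ p * χ (Sum.inr a) p) t := by
    rw [← ham_bulkVar]
    exact T.ham.bulk.fn.bulkInt_lin S (contDiff_columns hφ _) (hχ.columns _) t
  have hc : ContDiff ℝ ∞ (fun p => ∑ A, T.ham.eulerZ φ A p * χ (Sum.inl A) p +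
      ∑ a, T.constrVal a φ p * χ (Sum.inr a) p) :=
    (ContDiff.sum fun A _ => (T.ham.contDiff_eulerZ hφ A).mul (hχs _)).add
      (ContDiff.sum fun a _ => (T.contDiff_constrVal hφ a).mul (hχs _))
  have hk := contDiff_kin (T := T) hχs (smooth_zdot hφ)
  rw [S.bulkInt_sub hk.continuous (T.ham.bulk.contDiff_lin hφ hχs).continuous, h1,
    ← S.bulkInt_sub hk.continuous hc.continuous]
  congr 1
  ext p
  simp only [Pi.sub_apply, Finset.sum_apply, Pi.mul_apply, Fintype.sum_sum_type]
  have h2 : T.kin χ (zdot φ) p =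
      ∑ A, (∑ B, T.σ⁻¹ A B * dt (φ (Sum.inl B)) p) * χ (Sum.inl A) p := by
    simp only [kin, zdot, Sum.elim_inl, Finset.sum_mul]
    exact Finset.sum_congr rfl fun A _ => Finset.sum_congr rfl fun B _ => by ring
  have h3 : ∀ A, T.fieldEq φ (Sum.inl A) p =
      ∑ B, T.σ⁻¹ A B * dt (φ (Sum.inl B)) p - T.ham.eulerZ φ A p := by
    intro A
    rw [← sum_inv_eom]
    simp [fieldEq]
  have h4 : ∀ a, T.fieldEq φ (Sum.inr a) p = -T.constrVal a φ p := fun a => rfl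
  simp only [h2, h3, h4, sub_mul, neg_mul, Finset.sum_sub_distrib, Finset.sum_neg_distrib]
  ring

theorem sf_constrVal {φ : ℝ → Hist n N m} (hφ : ∀ j, SF fun s => φ s j) (a : Fin m) :
    SF fun s => T.constrVal a (φ s) :=
  (T.constr a).sf_eval (u := fun s A => φ s (Sum.inl A)) fun _ => hφ _

theorem sf_eom {φ : ℝ → Hist n N m} (hφ : ∀ j, SF fun s => φ s j) (A : Fin N) :
    SF fun s => T.eom A (φ s) := by
  have h1 : SF fun s p => ∑ B, T.σ A B * T.ham.eulerZ (φ s) B p :=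
    SF.sum _ fun B => ContDiff.mul contDiff_const
      (T.ham.bulk.fn.sf_euler (sf_columns hφ _) (Sum.inl B))
  exact ((hφ (Sum.inl A)).dd (vt n)).sub h1

theorem sf_fieldEq {φ : ℝ → Hist n N m} (hφ : ∀ j, SF fun s => φ s j) :
    ∀ j, SF fun s => T.fieldEq (φ s) j := by
  rintro (A | a)
  · have h1 : SF fun s p => ∑ B, T.σ⁻¹ A B * T.eom B (φ s) p :=
      SF.sum _ fun B => ContDiff.mul contDiff_const (sf_eom hφ B)
    convert h1 using 2
    ext p
    simp [fieldEq]
  · exact ContDiff.neg (sf_constrVal hφ a)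

/-- The linearized equations of motion. -/
def linFieldEq (T : Theory n N m c) (φ Q : Hist n N m) : Hist n N m :=
  fun j => ds (fun s => T.fieldEq (φ + s • Q) j) 0

theorem smooth_linFieldEq {φ Q : Hist n N m} (hφ : Smooth φ) (hQ : Smooth Q) :
    Smooth (T.linFieldEq φ Q) := fun j => (sf_fieldEq (sf_affine hφ hQ) j).ds.slice 0

/-- The second variation of the Lagrangian: the linearized equations of motion are paired with a
flat variation. -/
theorem bulkInt_kin_sub_hess {φ Q ψ : Hist n N m} (hφ : Smooth φ) (hQ : Smooth Q)
    (hψ : FlatHist S ψ) (t : ℝ) :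
    S.bulkInt (T.kin ψ (zdot Q) - T.ham.bulk.hess φ Q ψ) t =
      S.bulkInt (∑ j, T.linFieldEq φ Q j * ψ j) t := by
  have hψs := hψ.smooth
  have hsf := sf_affine hφ hQ
  have hψc : ∀ j, SF fun _ : ℝ => ψ j := fun j => SF.const (hψs j)
  have hz : ∀ j, SF fun s : ℝ => zdot (φ + s • Q) j := by
    simp only [zdot_add_smul hφ hQ]
    exact sf_affine (smooth_zdot hφ) (smooth_zdot hQ)
  have hds0 : (fun j => ds (fun _ : ℝ => ψ j) 0) = (0 : Hist n N m) := by
    funext j; ext p; simp [ds]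
  have hk := sf_kin (T := T) hψc hz
  have hl : SF fun s : ℝ => T.ham.bulk.lin (φ + s • Q) ψ :=
    T.ham.bulk.fn.sf_lin (sf_columns hsf _) (sf_columns hψc _)
  have h1 : ds (fun s : ℝ => T.kin ψ (zdot (φ + s • Q)) - T.ham.bulk.lin (φ + s • Q) ψ) 0 =
      T.kin ψ (zdot Q) - T.ham.bulk.hess φ Q ψ := by
    have e1 := ds_kin (T := T) hψc hz 0
    have e2 := T.ham.bulk.ds_lin hsf hψc 0
    rw [hds0] at e1 e2
    simp only [zdot_add_smul hφ hQ] at e1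
    rw [ds_hist_affine] at e1 e2
    simp only [zero_smul, add_zero, LocalFn.lin_zero] at e1 e2
    have e3 : T.kin (0 : Hist n N m) (zdot φ) = 0 := by ext p; simp [kin]
    rw [e3, zero_add] at e1
    rw [← e1, ← e2]
    ext p
    have e4 := (hk.hasDerivAt 0 p).sub (hl.hasDerivAt 0 p)
    simp only [zdot_add_smul hφ hQ] at e4 ⊢
    exact e4.deriv
  have h2 : ds (fun s : ℝ => ∑ j, T.fieldEq (φ + s • Q) j * ψ j) 0 =
      ∑ j, T.linFieldEq φ Q j * ψ j := by
    ext p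
    refine HasDerivAt.deriv ?_
    simp only [Finset.sum_apply, Pi.mul_apply]
    exact HasDerivAt.fun_sum fun j _ =>
      ((sf_fieldEq hsf j).hasDerivAt 0 p).mul_const (ψ j p)
  have h3 : SF fun s : ℝ => ∑ j, T.fieldEq (φ + s • Q) j * ψ j := by
    have e := SF.sum Finset.univ fun j => (sf_fieldEq (T := T) hsf j).mul (hψc j)
    convert e using 3
    simp
  have d1 := S.hasDerivAt_bulkInt_param (hk.sub hl) 0 t
  have d2 := S.hasDerivAt_bulkInt_param h3 0 t
  rw [h1] at d1
  rw [h2] at d2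
  exact d1.unique (d2.congr_of_eventuallyEq (Filter.Eventually.of_forall fun s =>
    bulkInt_kin_sub_lin (hφ.add (hQ.smul s)) hψ t))

/-! ### Symmetries of the action preserve the external boundary conditions -/

/-- Integration by parts in time; the two signs, from the antisymmetry of `σ` and from the
integration by parts, cancel. -/
theorem timeInt_kin_zdot {Q ψ : Hist n N m} (hQ : Smooth Q) (hψ : Smooth ψ) {t₀ t₁ : ℝ}
    (h : ∀ j, Region.EndsVanish t₀ t₁ (ψ j)) :
    S.timeInt t₀ t₁ (T.kin Q (zdot ψ)) = S.timeInt t₀ t₁ (T.kin ψ (zdot Q)) := by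
  have hk := contDiff_kin (T := T) hQ hψ
  have hz : ∀ t, (∀ j x, ψ j (t, x) = 0) → S.bulkInt (T.kin Q ψ) t = 0 := by
    intro t ht
    simp [Region.bulkInt, kin, ht]
  have h1 : S.timeInt t₀ t₁ (dt (T.kin Q ψ)) = 0 := by
    unfold Region.timeInt
    rw [intervalIntegral.integral_eq_sub_of_hasDerivAt
      (fun t _ => S.hasDerivAt_bulkInt_time hk t)
      ((S.continuous_bulkInt (contDiff_dt hk).continuous).intervalIntegrable _ _),
      hz _ fun j x => (h j x).2.eq_of_nhds, hz _ fun j x => (h j x).1.eq_of_nhds, sub_zero]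
  have hc1 := contDiff_kin (T := T) hψ (smooth_zdot hQ)
  have h2 : -T.kin ψ (zdot Q) = (-1 : ℝ) • T.kin ψ (zdot Q) := (neg_one_smul ℝ _).symm
  rw [dt_kin hQ hψ, kin_antisymm (zdot Q) ψ, h2, S.timeInt_add _ _
    (hc1.continuous.const_smul (-1 : ℝ)) (contDiff_kin hQ (smooth_zdot hψ)).continuous,
    S.timeInt_smul] at h1
  linarith

end Theory

namespace Theory

variable {T : Theory n N m c} {S : Region n}

theorem AwayFromBdry.smul {ψ : Hist n N m} (h : AwayFromBdry S ψ) (r : ℝ) :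
    AwayFromBdry S (r • ψ) := by
  intro j t x hx
  filter_upwards [h j t x hx] with q hq
  simp [hq]

theorem eventuallyEq_add_smul {φ ψ : Hist n N m} {p : ST n} (h : ∀ j, ψ j =ᶠ[nhds p] 0) (r : ℝ) :
    ∀ j, (φ + r • ψ) j =ᶠ[nhds p] φ j := by
  intro j
  filter_upwards [h j] with q hq
  simp [hq]

theorem transf_congr (Z : Fin N → LocalFn n N m) (Λ : Fin m → LocalFn n N m) {φ ψ : Hist n N m}
    {p : ST n} (h : ∀ j, φ j =ᶠ[nhds p] ψ j) :
    ∀ j, transf Z Λ φ j =ᶠ[nhds p] transf Z Λ ψ j := by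
  intro j
  simp only [transf_apply]
  exact (transfFn Z Λ j).eval_congr h

/-- Differentiating the invariance of the action along a variation that vanishes near the boundary
and near the end points of the time interval. -/
theorem timeInt_linFieldEq_add {Z : Fin N → LocalFn n N m} {Λ : Fin m → LocalFn n N m}
    {U : Functional n N m} {V : Fin n → LocalFn n N m} {t₀ t₁ : ℝ}
    (hact : ∀ φ, T.Admissible S φ →
      HasDerivAt (fun s : ℝ => T.action S (φ + s • transf Z Λ φ) t₀ t₁)
        (U.val S φ t₁ - U.val S φ t₀ + ∫ t in t₀..t₁, bdryTerm S V φ t) 0)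
    {φ ψ : Hist n N m} (hφ : T.Admissible S φ) (hψ : Smooth ψ) (hb : AwayFromBdry S ψ)
    (he : ∀ j, Region.EndsVanish t₀ t₁ (ψ j)) :
    S.timeInt t₀ t₁ (∑ j, T.linFieldEq φ (transf Z Λ φ) j * ψ j) +
      S.timeInt t₀ t₁ (∑ j, T.fieldEq φ j * (transfFn Z Λ j).lin φ ψ) = 0 := by
  have hs := hφ.1
  set Q : ℝ → Hist n N m := fun r => transf Z Λ (φ + r • ψ) with hQ
  have hsr : ∀ r : ℝ, Smooth (φ + r • ψ) := fun r => hs.add (hψ.smul r)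
  have hQs : ∀ r, Smooth (Q r) := fun r => smooth_transf Z Λ (hsr r)
  have hQsf : ∀ j, SF fun r => Q r j := sf_transf Z Λ (sf_affine hs hψ)
  have hzsf : ∀ j, SF fun r : ℝ => zdot (φ + r • ψ) j := by
    simp only [zdot_add_smul hs hψ]
    exact sf_affine (smooth_zdot hs) (smooth_zdot hψ)
  set χ : Hist n N m := fun j => (transfFn Z Λ j).lin φ ψ with hχ
  have hQds : (fun j => ds (fun r => Q r j) 0) = χ := by
    funext j
    have h1 := (transfFn Z Λ j).ds_eval (sf_affine hs hψ) 0
    rw [ds_hist_affine, zero_smul, add_zero] at h1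
    simp only [hQ, transf_apply]
    exact h1
  have hQ0 : Q 0 = transf Z Λ φ := by simp [hQ]
  -- the integrand of the variation of the action
  set Φ : ℝ → ST n → ℝ := fun r =>
    T.kin (Q r) (zdot (φ + r • ψ)) - T.ham.bulk.lin (φ + r • ψ) (Q r) with hΦ
  have hksf := sf_kin (T := T) hQsf hzsf
  have hlsf : SF fun r => T.ham.bulk.lin (φ + r • ψ) (Q r) :=
    T.ham.bulk.fn.sf_lin (sf_columns (sf_affine hs hψ) _) (sf_columns hQsf _)
  have hΦsf : SF Φ := hksf.sub hlsf
  have hΦds : ds Φ 0 = (T.kin χ (zdot φ) - T.ham.bulk.lin φ χ) +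
      (T.kin (Q 0) (zdot ψ) - T.ham.bulk.hess φ (Q 0) ψ) := by
    have e1 := ds_kin (T := T) hQsf hzsf 0
    have e2 := T.ham.bulk.ds_lin (sf_affine hs hψ) hQsf 0
    rw [hQds] at e1 e2
    rw [ds_hist_affine, zero_smul, add_zero] at e2
    simp only [zdot_add_smul hs hψ] at e1
    rw [ds_hist_affine, zero_smul, add_zero] at e1
    have e3 : T.ham.bulk.hess φ (Q 0) ψ = T.ham.bulk.hess φ ψ (Q 0) :=
      T.ham.bulk.fn.hess_symm _ _ _
    have e4 : ds Φ 0 = ds (fun r => T.kin (Q r) (zdot φ + r • zdot ψ)) 0 -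
        ds (fun r => T.ham.bulk.lin (φ + r • ψ) (Q r)) 0 := by
      ext p
      have e5 := (hksf.hasDerivAt 0 p).sub (hlsf.hasDerivAt 0 p)
      simp only [zdot_add_smul hs hψ] at e5
      refine Eq.trans ?_ e5.deriv
      simp only [ds, hΦ, zdot_add_smul hs hψ]
      rfl
    rw [e4, e1, e2, e3]
    ring
  -- all the other contributions do not depend on `r`
  have hends : ∀ t, (∀ x j, ψ j =ᶠ[nhds (t, x)] 0) → ∀ r : ℝ,
      S.bulkInt ((1 / 2 : ℝ) • T.kin (φ + r • ψ) (Q r)) t =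
        S.bulkInt ((1 / 2 : ℝ) • T.kin φ (Q 0)) t ∧
      U.val S (φ + r • ψ) t = U.val S φ t := by
    intro t ht r
    have h1 : ∀ x j, (φ + r • ψ) j =ᶠ[nhds (t, x)] φ j := fun x =>
      eventuallyEq_add_smul (ht x) r
    constructor
    · refine S.bulkInt_congr fun x _ => ?_
      have h2 : ∀ j, Q r j (t, x) = Q 0 j (t, x) := fun j => by
        rw [hQ0]
        exact (transf_congr Z Λ (h1 x) j).eq_of_nhds
      have h3 : ∀ j, (φ + r • ψ) j (t, x) = φ j (t, x) := fun j => (h1 x j).eq_of_nhds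
      simp only [Pi.smul_apply, kin, h2, h3]
    · unfold Functional.val
      rw [S.bulkInt_congr fun x _ => (U.bulk.eval_congr (h1 x)).eq_of_nhds,
        S.bdryInt_congr fun i x _ => ((U.bdry i).eval_congr (h1 x)).eq_of_nhds]
  have hV : ∀ (r t : ℝ), bdryTerm S V (φ + r • ψ) t = bdryTerm S V φ t := fun r t =>
    S.bdryInt_congr fun i x hx =>
      ((V i).eval_congr (eventuallyEq_add_smul (fun j => hb j t x hx) r)).eq_of_nhds
  have hHb : ∀ (r t : ℝ), S.bdryInt (fun i => (T.ham.bdry i).lin (φ + r • ψ) (Q r)) t =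
      S.bdryInt (fun i => (T.ham.bdry i).lin φ (Q 0)) t := fun r t =>
    S.bdryInt_congr fun i x hx => by
      have h1 := eventuallyEq_add_smul (φ := φ) (fun j => hb j t x hx) r
      rw [hQ0]
      exact ((T.ham.bdry i).lin_congr h1 (transf_congr Z Λ h1)).eq_of_nhds
  have hbc : Continuous fun t => S.bdryInt (fun i => (T.ham.bdry i).lin φ (Q 0)) t :=
    S.continuous_bdryInt fun i => ((T.ham.bdry i).contDiff_lin hs (hQs 0)).continuous
  have hsplit : ∀ r : ℝ, ∫ t in t₀..t₁, (S.bulkInt (T.kin (Q r) (zdot (φ + r • ψ))) t -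
      T.ham.lin S (φ + r • ψ) (Q r) t) = S.timeInt t₀ t₁ (Φ r) -
        ∫ t in t₀..t₁, S.bdryInt (fun i => (T.ham.bdry i).lin φ (Q 0)) t := by
    intro r
    unfold Region.timeInt
    rw [← intervalIntegral.integral_sub
      ((S.continuous_bulkInt (hΦsf.slice r).continuous).intervalIntegrable _ _)
      (hbc.intervalIntegrable _ _)]
    refine intervalIntegral.integral_congr fun t _ => ?_
    simp only [hΦ, Functional.lin, hHb]
    rw [S.bulkInt_sub (hksf.slice r).continuous (hlsf.slice r).continuous]
    ring
  have hconst : ∀ r : ℝ, S.timeInt t₀ t₁ (Φ r) = S.timeInt t₀ t₁ (Φ 0) := by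
    have key : ∀ r : ℝ, S.timeInt t₀ t₁ (Φ r) =
        U.val S φ t₁ - U.val S φ t₀ + (∫ t in t₀..t₁, bdryTerm S V φ t) -
          (S.bulkInt ((1 / 2 : ℝ) • T.kin φ (Q 0)) t₁ -
            S.bulkInt ((1 / 2 : ℝ) • T.kin φ (Q 0)) t₀) +
          ∫ t in t₀..t₁, S.bdryInt (fun i => (T.ham.bdry i).lin φ (Q 0)) t := by
      intro r
      have h1 := (hact _ (hφ.add (hψ.smul r) (hb.smul r))).unique
        (hasDerivAt_action (hsr r) (hQs r) t₀ t₁)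
      rw [hsplit r, (hends t₁ (fun x j => (he j x).2) r).1, (hends t₁ (fun x j => (he j x).2) r).2,
        (hends t₀ (fun x j => (he j x).1) r).1, (hends t₀ (fun x j => (he j x).1) r).2] at h1
      simp only [hV] at h1
      linarith
    exact fun r => (key r).trans (key 0).symm
  have hzero : S.timeInt t₀ t₁ (ds Φ 0) = 0 := by
    have h1 := hasDerivAt_intervalIntegral_param (S.continuous_bulkInt_family hΦsf)
      (S.continuous_bulkInt_family hΦsf.ds) (fun s t => S.hasDerivAt_bulkInt_param hΦsf s t)
      t₀ t₁ 0
    refine h1.unique ?_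
    refine (hasDerivAt_const (0 : ℝ) (S.timeInt t₀ t₁ (Φ 0))).congr_of_eventuallyEq ?_
    exact Filter.Eventually.of_forall hconst
  -- the two parts of the derivative are integrated by parts separately
  have hψf : FlatHist S ψ := hb.flatHist hψ
  have hχs : Smooth χ := fun j => (transfFn Z Λ j).contDiff_lin hs hψ
  have hχf : FlatHist S χ := by
    refine AwayFromBdry.flatHist (fun j t x hx => ?_) hχs
    have h1 := (transfFn Z Λ j).lin_congr (φ := φ) (φ' := φ) (ψ := ψ) (ψ' := 0) (p := (t, x))
      (fun _ => Filter.EventuallyEq.rfl) (fun j => hb j t x hx)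
    rwa [LocalFn.lin_zero] at h1
  have hc1 : ContDiff ℝ ∞ (T.kin χ (zdot φ) - T.ham.bulk.lin φ χ) :=
    (contDiff_kin hχs (smooth_zdot hs)).sub (T.ham.bulk.contDiff_lin hs hχs)
  have hhess : ContDiff ℝ ∞ (T.ham.bulk.hess φ (Q 0) ψ) := by
    have e1 : SF fun r : ℝ => T.ham.bulk.lin (φ + r • Q 0) ψ :=
      T.ham.bulk.fn.sf_lin (sf_columns (sf_affine hs (hQs 0)) _)
        (fun j => SF.const (contDiff_columns hψ _ j))
    have e2 := T.ham.bulk.ds_lin (sf_affine hs (hQs 0)) (χ := fun _ => ψ)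
      (fun j => SF.const (hψ j)) 0
    have e3 : (fun j => ds (fun _ : ℝ => ψ j) 0) = (0 : Hist n N m) := by
      funext j; ext p; simp [ds]
    rw [e3, ds_hist_affine, zero_smul, add_zero, LocalFn.lin_zero, add_zero] at e2
    rw [← e2]
    exact e1.ds.slice 0
  have hk1 := contDiff_kin (T := T) (hQs 0) (smooth_zdot hψ)
  have hk2 := contDiff_kin (T := T) hψ (smooth_zdot (hQs 0))
  have hpart1 : S.timeInt t₀ t₁ (T.kin χ (zdot φ) - T.ham.bulk.lin φ χ) =
      S.timeInt t₀ t₁ (∑ j, T.fieldEq φ j * χ j) := by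
    unfold Region.timeInt
    simp only [bulkInt_kin_sub_lin hs hχf]
  have hpart2 : S.timeInt t₀ t₁ (T.kin (Q 0) (zdot ψ) - T.ham.bulk.hess φ (Q 0) ψ) =
      S.timeInt t₀ t₁ (∑ j, T.linFieldEq φ (Q 0) j * ψ j) := by
    have e1 : ∀ f g : ST n → ℝ, f - g = f + (-1 : ℝ) • g := fun f g => by
      rw [neg_one_smul, sub_eq_add_neg]
    have e2 : S.timeInt t₀ t₁ (T.kin ψ (zdot (Q 0)) - T.ham.bulk.hess φ (Q 0) ψ) =
        S.timeInt t₀ t₁ (∑ j, T.linFieldEq φ (Q 0) j * ψ j) := by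
      unfold Region.timeInt
      simp only [bulkInt_kin_sub_hess hs (hQs 0) hψf]
    rw [← e2, e1, e1, S.timeInt_add _ _ hk1.continuous (hhess.continuous.const_smul (-1 : ℝ)),
      S.timeInt_add _ _ hk2.continuous (hhess.continuous.const_smul (-1 : ℝ)),
      timeInt_kin_zdot (hQs 0) hψ he]
  have hc2 : ContDiff ℝ ∞ (T.kin (Q 0) (zdot ψ) - T.ham.bulk.hess φ (Q 0) ψ) := hk1.sub hhess
  rw [hΦds, S.timeInt_add _ _ hc1.continuous hc2.continuous, hpart1, hpart2, hQ0] at hzero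
  linarith

theorem _root_.GaugeField.Region.eq_zero_of_timeInt_eq_zero (S : Region n) {f : ST n → ℝ}
    (hf : Continuous f) {t₀ t₁ : ℝ} (h0 : ∀ p, 0 ≤ f p) (h : S.timeInt t₀ t₁ f = 0)
    {t : ℝ} (ht : t ∈ Set.Ioo t₀ t₁) {x : Space n} (hx : x ∈ S.core) : f (t, x) = 0 := by
  refine S.eq_zero_of_bulkInt_eq_zero hf (fun x => h0 (t, x)) ?_ x hx
  have hnn : ∀ t, 0 ≤ S.bulkInt f t := fun t =>
    MeasureTheory.setIntegral_nonneg S.measurableSet_body fun x _ => h0 (t, x)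
  by_contra hne
  have hpos : 0 < S.bulkInt f t := lt_of_le_of_ne (hnn t) (Ne.symm hne)
  have h1 : 0 < ∫ t in t₀..t₁, S.bulkInt f t :=
    intervalIntegral.integral_pos (ht.1.trans ht.2) (S.continuous_bulkInt hf).continuousOn
      (fun t _ => hnn t) ⟨t, Set.Ioo_subset_Icc_self ht, hpos⟩
  exact absurd h h1.ne'

/-- The linearized equations of motion along a symmetry vanish to infinite order on the boundary:
in the interior they are a linear differential operator applied to the equations of motion. -/
theorem flatHist_linFieldEq {Z : Fin N → LocalFn n N m} {Λ : Fin m → LocalFn n N m}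
    {U : Functional n N m} {V : Fin n → LocalFn n N m}
    (hact : ∀ φ, T.Admissible S φ → ∀ t₀ t₁ : ℝ,
      HasDerivAt (fun s : ℝ => T.action S (φ + s • transf Z Λ φ) t₀ t₁)
        (U.val S φ t₁ - U.val S φ t₀ + ∫ t in t₀..t₁, bdryTerm S V φ t) 0)
    {φ : Hist n N m} (hφ : T.Admissible S φ) :
    FlatHist S (T.linFieldEq φ (transf Z Λ φ)) := by
  have hs := hφ.1
  set L := T.linFieldEq φ (transf Z Λ φ) with hL
  have hLs : Smooth L := smooth_linFieldEq hs (smooth_transf Z Λ hs)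
  choose P hPf hP using fun j =>
    (transfFn Z Λ j).exists_flat_adjoint S hs (hφ.flatHist_fieldEq j)
  let R : Hist n N m := fun k => ∑ j, P j k
  have hR : FlatHist S R := fun k => Flat.sum _ fun j => hPf j k
  have hW : Smooth (L + R) := hLs.add hR.smooth
  have hzero : ∀ k t, ∀ x ∈ S.core, (L + R) k (t, x) = 0 := by
    intro k t x hx
    obtain ⟨η, hη, hη0, hη1, hηb⟩ := S.exists_bump hx
    let θ : ContDiffBump t := ⟨1 / 4, 1 / 2, by norm_num, by norm_num⟩
    -- testing with `w (L + R)`, where `w` is a bump function on space-time, gives the integral of a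
    -- nonnegative function
    let w : ST n → ℝ := fun p => θ p.1 * η p.2
    have hw : ContDiff ℝ ∞ w := (θ.contDiff.comp contDiff_fst).mul (hη.comp contDiff_snd)
    let ψ : Hist n N m := fun j => w * (L + R) j
    have hψ : Smooth ψ := fun j => hw.mul (hW j)
    have hψb : AwayFromBdry S ψ := by
      intro j t' y hy
      have h1 : Filter.Tendsto Prod.snd (nhds ((t', y) : ST n)) (nhds y) :=
        continuous_snd.continuousAt
      filter_upwards [h1.eventually (hηb y hy)] with q hq
      simp [ψ, w, hq]
    have hθ : ∀ s : ℝ, 1 ≤ |s - t| → θ =ᶠ[nhds s] 0 := by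
      intro s hst
      refine notMem_tsupport_iff_eventuallyEq.1 fun hs => ?_
      rw [θ.tsupport_eq, Metric.mem_closedBall, Real.dist_eq] at hs
      have h2 : |s - t| ≤ 1 / 2 := hs
      linarith
    have hψe : ∀ j, Region.EndsVanish (t - 1) (t + 1) (ψ j) := by
      have key : ∀ s : ℝ, 1 ≤ |s - t| → ∀ j y, ψ j =ᶠ[nhds (s, y)] 0 := by
        intro s hst j y
        have h1 : Filter.Tendsto Prod.fst (nhds ((s, y) : ST n)) (nhds s) :=
          continuous_fst.continuousAt
        filter_upwards [h1.eventually (hθ s hst)] with q hq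
        simp [ψ, w, hq]
      exact fun j y => ⟨key _ (by simp) j y, key _ (by simp) j y⟩
    have h1 := timeInt_linFieldEq_add (fun φ hφ => hact φ hφ (t - 1) (t + 1)) hφ hψ hψb hψe
    have h2 : S.timeInt (t - 1) (t + 1) (∑ j, T.fieldEq φ j * (transfFn Z Λ j).lin φ ψ) =
        S.timeInt (t - 1) (t + 1) (∑ k, R k * ψ k) := by
      have e1 : (∑ k, R k * ψ k) = ∑ j, ∑ k, P j k * ψ k := by
        simp only [R, Finset.sum_mul]
        exact Finset.sum_comm
      rw [e1, S.timeInt_sum _ _ _ fun j => contDiff_mul' (hφ.flatHist_fieldEq j).1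
        ((transfFn Z Λ j).contDiff_lin hs hψ), S.timeInt_sum _ _ _ fun j =>
          contDiff_sum' fun k => contDiff_mul' (hPf j k).1 (hψ k)]
      exact Finset.sum_congr rfl fun j _ => hP j _ _ ψ hψ hψe
    have hc : ∀ {X : Hist n N m}, Smooth X → Continuous (∑ k, X k * ψ k) := fun hX =>
      (contDiff_sum' fun k => contDiff_mul' (hX k) (hψ k)).continuous
    rw [h2, ← S.timeInt_add _ _ (hc hLs) (hc hR.smooth)] at h1
    have h3 : (∑ k, L k * ψ k) + (∑ k, R k * ψ k) = fun p => w p * ∑ k, (L + R) k p ^ 2 := by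
      ext p
      simp only [Pi.add_apply, Finset.sum_apply, Pi.mul_apply, ψ, Finset.mul_sum,
        ← Finset.sum_add_distrib]
      exact Finset.sum_congr rfl fun k _ => by ring
    rw [h3] at h1
    have hcont : Continuous fun p => w p * ∑ k, (L + R) k p ^ 2 :=
      (hw.mul (ContDiff.sum fun k _ => (hW k).pow 2) :
        ContDiff ℝ ∞ fun p => w p * ∑ k, (L + R) k p ^ 2).continuous
    have h4 := S.eq_zero_of_timeInt_eq_zero hcont (fun p => mul_nonneg
      (mul_nonneg θ.nonneg (hη0 _)) (Finset.sum_nonneg fun k _ => sq_nonneg _)) h1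
      (t := t) ⟨by linarith, by linarith⟩ hx
    have h5 : w (t, x) = 1 := by
      simp only [w, hη1, mul_one]
      exact θ.one_of_mem_closedBall (Metric.mem_closedBall_self θ.rIn_pos.le)
    rw [h5, one_mul] at h4
    have h6 := (Finset.sum_eq_zero_iff_of_nonneg fun k _ => sq_nonneg _).1 h4 k (Finset.mem_univ k)
    exact pow_eq_zero_iff two_ne_zero |>.1 h6
  have hbody : ∀ k t, ∀ x ∈ S.body, (L + R) k (t, x) = 0 := by
    intro k t x hx
    have hcl : IsClosed {y | (L + R) k (t, y) = 0} :=
      isClosed_eq ((hW k).continuous.comp (by fun_prop)) continuous_const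
    exact hcl.closure_subset_iff.2 (fun y hy => hzero k t y hy) (S.body_subset_closure_core hx)
  intro k
  refine ⟨hLs k, fun β t x hx => ?_⟩
  have h1 := dMulti_eq_zero_on_body (hW k) (hbody k) β t x (S.bdry_subset_body hx)
  have h2 : dMulti β ((L + R) k) = dMulti β (L k) + dMulti β (R k) :=
    dMulti_add (hLs k) (hR k).1 β
  rw [h2, Pi.add_apply, (hR k).2 β t x hx, add_zero] at h1
  exact h1

/-- A symmetry of the action preserves the external boundary conditions. -/
theorem preservesExternal_of_action {Z : Fin N → LocalFn n N m} {Λ : Fin m → LocalFn n N m}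
    {U : Functional n N m} {V : Fin n → LocalFn n N m}
    (hact : ∀ φ, T.Admissible S φ → ∀ t₀ t₁ : ℝ,
      HasDerivAt (fun s : ℝ => T.action S (φ + s • transf Z Λ φ) t₀ t₁)
        (U.val S φ t₁ - U.val S φ t₀ + ∫ t in t₀..t₁, bdryTerm S V φ t) 0)
    {φ : Hist n N m} (hφ : T.Admissible S φ) :
    T.PreservesExternal S φ (transf Z Λ φ) := by
  have hs := hφ.1
  have hsf := sf_affine hs (smooth_transf Z Λ hs)
  have hflat := flatHist_linFieldEq hact hφ
  intro β t x hx
  refine ⟨fun a => ?_, fun A => ?_⟩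
  · have h1 : vary (fun φ' => dMulti β (T.constrVal a φ')) φ (transf Z Λ φ) =
        dMulti β (ds (fun s : ℝ => T.constrVal a (φ + s • transf Z Λ φ)) 0) :=
      (sf_constrVal hsf a).ds_dMulti β 0
    have h2 : ds (fun s : ℝ => T.constrVal a (φ + s • transf Z Λ φ)) 0 =
        -T.linFieldEq φ (transf Z Λ φ) (Sum.inr a) := by
      ext p
      have h3 := ((sf_constrVal (T := T) hsf a).hasDerivAt 0 p).neg
      have h4 : T.linFieldEq φ (transf Z Λ φ) (Sum.inr a) p = _ := h3.deriv
      rw [Pi.neg_apply, h4, neg_neg]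
    rw [h1, h2]
    exact (hflat (Sum.inr a)).neg.2 β t x hx
  · have h1 : vary (fun φ' => dMulti β (T.eom A φ')) φ (transf Z Λ φ) =
        dMulti β (ds (fun s : ℝ => T.eom A (φ + s • transf Z Λ φ)) 0) :=
      (sf_eom hsf A).ds_dMulti β 0
    have h2 : ds (fun s : ℝ => T.eom A (φ + s • transf Z Λ φ)) 0 =
        ∑ B, T.σ A B • T.linFieldEq φ (transf Z Λ φ) (Sum.inl B) := by
      have h4 := sum_mul_inv_apply (T := T) A
      have h6 : ∀ (φ : Hist n N m) (p : ST n),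
          T.eom A φ p = ∑ B, T.σ A B * T.fieldEq φ (Sum.inl B) p := by
        intro φ p
        calc T.eom A φ p = ∑ C, (∑ B, T.σ A B * T.σ⁻¹ B C) * T.eom C φ p := by simp [h4]
          _ = ∑ B, T.σ A B * ∑ C, T.σ⁻¹ B C * T.eom C φ p := by
            simp only [Finset.sum_mul, Finset.mul_sum, mul_assoc]
            rw [Finset.sum_comm]
          _ = _ := by simp [fieldEq]
      ext p
      refine HasDerivAt.deriv ?_
      simp only [h6, Finset.sum_apply, Pi.smul_apply, smul_eq_mul]
      exact HasDerivAt.fun_sum fun B _ =>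
        ((sf_fieldEq hsf (Sum.inl B)).hasDerivAt 0 p).const_mul _
    rw [h1, h2]
    exact (Flat.sum (S := S) _ fun B => (hflat (Sum.inl B)).const_smul (T.σ A B)).2 β t x hx

end Theory

/-! ### Operations on local functions -/

/-- Quantities built from the fields that are given by a local function. -/
def IsLocal (Φ : Hist n N m → ST n → ℝ) : Prop := ∃ f : LocalFn n N m, ∀ φ, f.eval φ = Φ φ

/-- A local function may be regarded as one that depends on more derivatives. -/
theorem LocalFn.exists_lift (f : LocalFn n N m) {k r : ℕ} (hk : f.timeOrder ≤ k)
    (hr : f.order ≤ r) : ∃ g : JetFn n (Fin N ⊕ Fin m × Fin (k + 1)) r,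
      ∀ φ : Hist n N m, g.eval (columns k φ) = f.eval φ := by
  let e : (Fin N ⊕ Fin m × Fin (f.timeOrder + 1)) × MI n f.order →
      (Fin N ⊕ Fin m × Fin (k + 1)) × MI n r :=
    Prod.map (Sum.map id (Prod.map id (Fin.castLE (by omega))))
      fun α i => Fin.castLE (by omega) (α i)
  refine ⟨⟨fun q => f.fn.toFun (q.1, fun a => q.2 (e a)), ?_⟩, fun φ => ?_⟩
  · refine f.fn.smooth.comp (contDiff_fst.prodMk (contDiff_pi.2 fun a => ?_))
    exact (contDiff_apply ℝ ℝ (e a)).comp contDiff_snd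
  · ext p
    have h : (fun a => JetFn.jet r (columns k φ) p (e a)) =
        JetFn.jet f.order (columns f.timeOrder φ) p := by
      ext ⟨A | q, α⟩ <;> rfl
    change f.fn.toFun (p, fun a => JetFn.jet r (columns k φ) p (e a)) = _
    rw [h]
    rfl

namespace IsLocal

variable {Φ Ψ : Hist n N m → ST n → ℝ}

theorem eval (f : LocalFn n N m) : IsLocal f.eval := ⟨f, fun _ => rfl⟩

/-- Smooth functions of local functions are local. -/
theorem map₂ (hΦ : IsLocal Φ) (hΨ : IsLocal Ψ) {g : ℝ × ℝ → ℝ} (hg : ContDiff ℝ ∞ g) :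
    IsLocal fun φ p => g (Φ φ p, Ψ φ p) := by
  obtain ⟨f₁, h₁⟩ := hΦ
  obtain ⟨f₂, h₂⟩ := hΨ
  obtain ⟨g₁, e₁⟩ := f₁.exists_lift (le_max_left _ f₂.timeOrder) (le_max_left _ f₂.order)
  obtain ⟨g₂, e₂⟩ := f₂.exists_lift (le_max_right f₁.timeOrder _) (le_max_right f₁.order _)
  refine ⟨⟨max f₁.timeOrder f₂.timeOrder, max f₁.order f₂.order,
    ⟨fun q => g (g₁.toFun q, g₂.toFun q), hg.comp (g₁.smooth.prodMk g₂.smooth)⟩⟩, fun φ => ?_⟩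
  ext p
  change _ = g (Φ φ p, Ψ φ p)
  rw [← h₁, ← h₂, ← e₁, ← e₂]
  rfl

theorem add (hΦ : IsLocal Φ) (hΨ : IsLocal Ψ) : IsLocal fun φ p => Φ φ p + Ψ φ p :=
  hΦ.map₂ hΨ (contDiff_fst.add contDiff_snd)

theorem sub (hΦ : IsLocal Φ) (hΨ : IsLocal Ψ) : IsLocal fun φ p => Φ φ p - Ψ φ p :=
  hΦ.map₂ hΨ (contDiff_fst.sub contDiff_snd)

theorem mul (hΦ : IsLocal Φ) (hΨ : IsLocal Ψ) : IsLocal fun φ p => Φ φ p * Ψ φ p :=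
  hΦ.map₂ hΨ (contDiff_fst.mul contDiff_snd)

theorem const (a : ℝ) : IsLocal fun (_ : Hist n N m) _ => a :=
  ⟨⟨0, 0, ⟨fun _ => a, contDiff_const⟩⟩, fun _ => rfl⟩

theorem neg (hΦ : IsLocal Φ) : IsLocal fun φ p => -Φ φ p := by
  simpa using (const 0).sub hΦ

theorem sum {ι : Type*} (s : Finset ι) {Φ : ι → Hist n N m → ST n → ℝ} (h : ∀ i, IsLocal (Φ i)) :
    IsLocal fun φ p => ∑ i ∈ s, Φ i φ p := by
  classical
  induction s using Finset.induction_on with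
  | empty => simpa using const 0
  | insert a s ha ih =>
    simp only [Finset.sum_insert ha]
    exact (h a).add ih

theorem field (A : Fin N) : IsLocal fun (φ : Hist n N m) => φ (Sum.inl A) := by
  refine ⟨⟨0, 0, ⟨fun q => q.2 (Sum.inl A, 0),
    (contDiff_apply ℝ ℝ ((Sum.inl A, 0) : (Fin N ⊕ Fin m × Fin (0 + 1)) × MI n 0)).comp
      contDiff_snd⟩⟩, fun φ => ?_⟩
  ext p
  have h : MI.toNat (0 : MI n 0) = 0 := rfl
  change dMulti (MI.toNat (0 : MI n 0)) (φ (Sum.inl A)) p = _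
  rw [h, dMulti_zero_index]

end IsLocal

namespace Theory

variable {T : Theory n N m c} {S : Region n}

/-- For a functional `F`, the difference `∫ ½ σ_{AB} z^A Z^B - F` is again a functional. This is
the passage between a generator and the boundary term in time of the action. -/
theorem exists_kin_sub (T : Theory n N m c) (S : Region n) (F : Functional n N m)
    (Z : Fin N → LocalFn n N m) (Λ : Fin m → LocalFn n N m) :
    ∃ F' : Functional n N m, ∀ φ, Smooth φ → ∀ t, F'.val S φ t =
      S.bulkInt ((1 / 2 : ℝ) • T.kin φ (transf Z Λ φ)) t - F.val S φ t := by
  have h1 : IsLocal fun (φ : Hist n N m) p =>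
      (1 / 2 : ℝ) * T.kin φ (transf Z Λ φ) p - F.bulk.eval φ p := by
    refine IsLocal.sub (IsLocal.mul (IsLocal.const _) ?_) (IsLocal.eval _)
    exact IsLocal.sum _ fun A => IsLocal.sum _ fun B =>
      ((IsLocal.const _).mul (IsLocal.field A)).mul (IsLocal.eval (Z B))
  obtain ⟨f, hf⟩ := h1
  choose b hb using fun i => (IsLocal.eval (F.bdry i)).neg
  refine ⟨⟨f, b⟩, fun φ hφ t => ?_⟩
  have hM : ContDiff ℝ ∞ ((1 / 2 : ℝ) • T.kin φ (transf Z Λ φ)) :=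
    contDiff_const.mul (contDiff_kin hφ (smooth_transf Z Λ hφ))
  have h2 : f.eval φ = (1 / 2 : ℝ) • T.kin φ (transf Z Λ φ) - F.bulk.eval φ := by
    rw [hf]; rfl
  have h3 : (fun i => (b i).eval φ) = fun i => -(F.bdry i).eval φ := funext fun i => hb i φ
  unfold Functional.val
  rw [h2, h3, S.bulkInt_sub hM.continuous (F.bulk.contDiff_eval hφ).continuous, S.bdryInt_neg]
  ring

theorem bulkInt_half_kin (φ : Hist n N m) (Z : Fin N → LocalFn n N m)
    (Λ : Fin m → LocalFn n N m) (t : ℝ) :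
    S.bulkInt (fun p => ∑ A, ∑ B, (1 / 2) * T.σ⁻¹ A B * φ (Sum.inl A) p * (Z B).eval φ p) t =
      S.bulkInt ((1 / 2 : ℝ) • T.kin φ (transf Z Λ φ)) t := by
  congr 1
  ext p
  simp only [kin, transf, Pi.smul_apply, smul_eq_mul, Finset.mul_sum, Sum.elim_inl]
  exact Finset.sum_congr rfl fun A _ => Finset.sum_congr rfl fun B _ => by ring

theorem continuous_bdryTerm (V : Fin n → LocalFn n N m) {φ : Hist n N m} (hφ : Smooth φ) :
    Continuous (bdryTerm S V φ) :=
  S.continuous_bdryInt fun i => ((V i).contDiff_eval hφ).continuous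

theorem continuous_pairing (Z : Fin N → LocalFn n N m) (Λ : Fin m → LocalFn n N m)
    {φ : Hist n N m} (hφ : Smooth φ) : Continuous fun t =>
      S.bulkInt (T.kin (transf Z Λ φ) (zdot φ)) t - T.ham.lin S φ (transf Z Λ φ) t :=
  (S.continuous_bulkInt (contDiff_kin (smooth_transf Z Λ hφ) (smooth_zdot hφ)).continuous).sub
    (T.ham.continuous_lin S hφ (smooth_transf Z Λ hφ))

/-! ### Symmetries and their generators -/

/-- The invariance of the action, differentiated in the end point of the time interval. -/
theorem conservation_of_action {G U : Functional n N m} {Z : Fin N → LocalFn n N m}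
    {Λ : Fin m → LocalFn n N m} {V : Fin n → LocalFn n N m} {φ : Hist n N m} (hφ : Smooth φ)
    (hact : ∀ t₀ t₁ : ℝ, HasDerivAt (fun s : ℝ => T.action S (φ + s • transf Z Λ φ) t₀ t₁)
        (U.val S φ t₁ - U.val S φ t₀ + ∫ t in t₀..t₁, bdryTerm S V φ t) 0)
    (hG : ∀ t, G.val S φ t = S.bulkInt ((1 / 2 : ℝ) • T.kin φ (transf Z Λ φ)) t - U.val S φ t)
    (t : ℝ) : G.bigD S φ t + G.lin S φ (zdot φ) t +
      (S.bulkInt (T.kin (transf Z Λ φ) (zdot φ)) t - T.ham.lin S φ (transf Z Λ φ) t) =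
        bdryTerm S V φ t := by
  have hQ := smooth_transf Z Λ hφ
  have hR := continuous_pairing (T := T) (S := S) Z Λ hφ
  have hV := continuous_bdryTerm (S := S) V hφ
  have h1 : ∀ t₁, G.val S φ t₁ + ∫ t in t..t₁, (S.bulkInt (T.kin (transf Z Λ φ) (zdot φ)) t -
      T.ham.lin S φ (transf Z Λ φ) t) = G.val S φ t + ∫ t in t..t₁, bdryTerm S V φ t := by
    intro t₁
    have h2 := (hact t t₁).unique (hasDerivAt_action hφ hQ t t₁)
    rw [hG, hG]
    linarith
  have d1 := (G.hasDerivAt_val_time S hφ t).add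
    (intervalIntegral.integral_hasDerivAt_right (hR.intervalIntegrable t t)
      (hR.stronglyMeasurableAtFilter _ _) hR.continuousAt)
  have d2 := (intervalIntegral.integral_hasDerivAt_right (hV.intervalIntegrable t t)
      (hV.stronglyMeasurableAtFilter _ _) hV.continuousAt).const_add (G.val S φ t)
  exact d1.unique (d2.congr_of_eventuallyEq (Filter.Eventually.of_forall h1))

/-- The generator of an external symmetry determines the transformation and satisfies the
conservation identity. -/
theorem IsExternalSymmetryOf.isConservedGenerator {G : Functional n N m}
    {Z : Fin N → LocalFn n N m} {Λ : Fin m → LocalFn n N m}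
    (h : T.IsExternalSymmetryOf S G Z Λ) : T.IsConservedGenerator S G Z Λ := by
  obtain ⟨U, V, hUV, hG⟩ := h
  have hcons := fun φ (hφ : T.Admissible S φ) (t : ℝ) =>
    conservation_of_action (G := G) hφ.1 (hUV.action φ hφ)
      (fun t => by rw [hG φ hφ t, bulkInt_half_kin φ Z Λ]) t
  have hZ : ∀ φ, T.Admissible S φ → ∀ (A : Fin N) (t : ℝ), ∀ x ∈ S.body,
      (Z A).eval φ (t, x) = ∑ B, T.σ A B * G.eulerZ φ B (t, x) :=
    fun φ hφ A t x hx => eval_eq_of_conservation hcons hφ A t hx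
  refine ⟨hZ, V, fun φ hφ t => ?_, hUV.invariant⟩
  rw [bigD_add_modBracket_sub hφ (hZ φ hφ)]
  exact hcons φ hφ t

/-- The conservation identity, integrated in time, is the invariance of the action with
`U = ∫ ½ σ_{AB} z^A Z^B - G`; the external boundary conditions are then preserved too. -/
theorem IsConservedGenerator.isExternalSymmetryOf {G : Functional n N m}
    {Z : Fin N → LocalFn n N m} {Λ : Fin m → LocalFn n N m}
    (hsource : T.SourceCompatible S Z Λ)
    (h : T.IsConservedGenerator S G Z Λ) : T.IsExternalSymmetryOf S G Z Λ := by
  obtain ⟨hZ, V, hcons, hinv⟩ := h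
  obtain ⟨U, hU⟩ := exists_kin_sub T S G Z Λ
  have hact : ∀ φ, T.Admissible S φ → ∀ t₀ t₁ : ℝ,
      HasDerivAt (fun s : ℝ => T.action S (φ + s • transf Z Λ φ) t₀ t₁)
        (U.val S φ t₁ - U.val S φ t₀ + ∫ t in t₀..t₁, bdryTerm S V φ t) 0 := by
    intro φ hφ t₀ t₁
    have hs := hφ.1
    have hR := continuous_pairing (T := T) (S := S) Z Λ hs
    have hV := continuous_bdryTerm (S := S) V hs
    have hpt : ∀ t, G.bigD S φ t + G.lin S φ (zdot φ) t =
        bdryTerm S V φ t - (S.bulkInt (T.kin (transf Z Λ φ) (zdot φ)) t -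
          T.ham.lin S φ (transf Z Λ φ) t) := by
      intro t
      have h1 := bigD_add_modBracket_sub (Λ := Λ) hφ (hZ φ hφ) t
      rw [hcons φ hφ t] at h1
      linarith
    have hint : ∫ t in t₀..t₁, (bdryTerm S V φ t -
        (S.bulkInt (T.kin (transf Z Λ φ) (zdot φ)) t - T.ham.lin S φ (transf Z Λ φ) t)) =
        G.val S φ t₁ - G.val S φ t₀ :=
      intervalIntegral.integral_eq_sub_of_hasDerivAt
        (fun t _ => (hpt t) ▸ G.hasDerivAt_val_time S hs t)
        ((hV.sub hR).intervalIntegrable _ _)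
    rw [intervalIntegral.integral_sub (hV.intervalIntegrable _ _) (hR.intervalIntegrable _ _)]
      at hint
    refine (hasDerivAt_action hs (smooth_transf Z Λ hs) t₀ t₁).congr_deriv ?_
    rw [hU φ hs, hU φ hs]
    linarith
  refine ⟨U, V, ⟨fun φ hφ => preservesExternal_of_action hact hφ, hsource, hact, hinv⟩,
    fun φ hφ t => ?_⟩
  rw [hU φ hφ.1, bulkInt_half_kin φ Z Λ]
  ring

/-- Every external symmetry has a generator: `∫ ½ σ_{AB} z^A Z^B - U` is a functional. -/
theorem isExternalSymmetry_iff_exists_generator {Z : Fin N → LocalFn n N m}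
    {Λ : Fin m → LocalFn n N m} :
    T.IsExternalSymmetry S Z Λ ↔ ∃ G, T.IsExternalSymmetryOf S G Z Λ := by
  constructor
  · rintro ⟨U, V, h⟩
    obtain ⟨G, hG⟩ := exists_kin_sub T S U Z Λ
    exact ⟨G, U, V, h, fun φ hφ t => by rw [hG φ hφ.1, bulkInt_half_kin φ Z Λ]⟩
  · rintro ⟨G, U, V, h, -⟩
    exact ⟨U, V, h⟩

end Theory

end GaugeField

end

theorem mainTheorem6 {n N m c : ℕ} (S : GaugeField.Region n) (T : GaugeField.Theory n N m c)
    (hfirst : T.FirstClass S) (hham : T.HamDifferentiable S)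
    (G : GaugeField.Functional n N m)
    (Z : Fin N → GaugeField.LocalFn n N m) (Λ : Fin m → GaugeField.LocalFn n N m)
    (hsource : T.SourceCompatible S Z Λ) (hdiff : T.Differentiable S G) :
    (T.IsExternalSymmetryOf S G Z Λ ↔ T.IsConservedGenerator S G Z Λ) ∧
      (T.IsExternalSymmetry S Z Λ ↔
        ∃ G' : GaugeField.Functional n N m, T.IsConservedGenerator S G' Z Λ) := by
  have key : ∀ G' : GaugeField.Functional n N m,
      T.IsExternalSymmetryOf S G' Z Λ ↔ T.IsConservedGenerator S G' Z Λ := fun G' =>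
    ⟨fun h => h.isConservedGenerator, fun h => h.isExternalSymmetryOf hsource⟩
  refine ⟨key G, ?_⟩
  rw [GaugeField.Theory.isExternalSymmetry_iff_exists_generator]
  exact exists_congr key
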